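/- For each $n$ let $K=K_n\in\mathbb N$, $p=p_n$ and $q=q_n$ with $0<q\le p\le 1$, and $t_f=t_f(n)\in\mathbb N$. Let $C^*$ be uniformly distributed over the $K$-element subsets of $[n]=\{1,\dots,n\}$ and, given $C^*$, let $G$ be the random graph on $[n]$ in which distinct pairs of vertices are joined independently, with probability $p$ if both vertices lie in $C^*$ and with probability $q$ otherwise. Put $\sigma_u=\mathbf 1\{u\in C^*\}$. Assume that, as $n\to\infty$, $p/q=O(1)$, $n^{1-o(1)}\le K\le o(n)$, that $$\lambda=\frac{K^2(p-q)^2}{(n-K)q}$$ is a constant (it does not depend on $n$) with $0<\lambda\le 1/e$, and that $(2+np)^{t_f}=n^{o(1)}$. Call an estimator $\hat C\subset[n]$ (a function of $G$ and possibly of external randomness independent of $(C^*,G)$) $t_f$-local if for each vertex $u$ and each value of the external randomness, the decision $\hat\sigma_u=\mathbf 1\{u\in\hat C\}$ depends on $G$ only through the subgraph of $G$ induced by the vertices at distance at most $t_f$ from $u$. For a vertex $u$ let $p_{e,0}=\mathbb P\{\hat\sigma_u=1\mid\sigma_u=0\}$, $p_{e,1}=\mathbb P\{\hat\sigma_u=0\mid\sigma_u=1\}$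 and $p_e=\frac{n-K}{n}p_{e,0}+\frac Kn p_{e,1}$. Then the following hold for every $t_f$-local estimator $\hat C$, where the $o(1)$ terms are uniform over all such estimators and all vertices $u$: $$\mathbb E\big[|\hat C\triangle C^*|\big]\ \ge\ \frac{K(n-K)}{n}\,e^{-\lambda e/4}-n^{o(1)},\qquad p_{e,0}+p_{e,1}\ \ge\ \tfrac12 e^{-1/4}-n^{-1+o(1)}\ \text{ for every vertex } u .$$ Furthermore, for every sequence of $t_f$-local estimators, $$\liminf_{n\to\infty}\ \min_{u\in[n]}\frac{n\,p_e}{K}\ \ge\ 1\qquad\text{and}\qquad \liminf_{n\to\infty}\frac{\mathbb E[|\hat C\triangle C^*|]}{K}\ \ge\ 1 .$$ -/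

import Mathlib

universe u

noncomputable section

open MeasureTheory ProbabilityTheory

namespace HiddenCommunity

open Classical in
/-- The probability that the pair `e` of vertices is joined by an edge: `p` if both endpoints are in
the community `C`, and `q` otherwise. -/
def edgeProb {n : ℕ} (C : Finset (Fin n)) (p q : unitInterval) (e : Sym2 (Fin n)) : unitInterval :=
  if ∀ v ∈ e, v ∈ C then p else q

/-- The law of the planted dense subgraph model on `n` vertices with a given community `C`: the
graph obtained from independent coins, one for each unordered pair of vertices, where the coin of
the pair `e` shows `True` with probability `edgeProb C p q e`. The coins of the degenerate pairs
`s(v, v)` are ignored by `SimpleGraph.fromEdgeSet`. -/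
def plantedGraph {n : ℕ} (C : Finset (Fin n)) (p q : unitInterval) :
    Measure (SimpleGraph (Fin n)) :=
  (Measure.pi fun e : Sym2 (Fin n) => bernoulliMeasure True False (edgeProb C p q e)).map
    fun ω => SimpleGraph.fromEdgeSet {e | ω e}

/-- The joint law of `(C*, G)`, where `C*` is uniformly distributed over the `K`-element subsets of
the vertex set and, given `C*`, the graph `G` is drawn from the planted dense subgraph model with
community `C*`. -/
def plantedModel (n K : ℕ) (p q : unitInterval) :
    Measure (Finset (Fin n) × SimpleGraph (Fin n)) :=
  ∑ C ∈ Finset.powersetCard K (Finset.univ : Finset (Fin n)),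
    ((n.choose K : ENNReal))⁻¹ • (plantedGraph C p q).map (Prod.mk C)

/-- The graphs `G` and `G'` have the same neighborhood of radius `t` around the vertex `u`: the same
vertices are at distance at most `t` from `u`, and the same pairs of these vertices are adjacent.
(The extended distance `edist` of vertices in different connected components is infinite.) -/
def SameNeighborhood {n : ℕ} (t : ℕ) (u : Fin n) (G G' : SimpleGraph (Fin n)) : Prop :=
  (∀ v, G.edist u v ≤ t ↔ G'.edist u v ≤ t) ∧
    ∀ v w, G.edist u v ≤ t → G.edist u w ≤ t → (G.Adj v w ↔ G'.Adj v w)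

/-- A (possibly randomized) `t`-local estimator of the community from a graph on `n` vertices. Given
the external randomness `s`, drawn independently of the community and of the graph, the estimated
community is `est s G`, and whether a vertex `u` is put into it depends only on the subgraph of `G`
induced by the vertices at distance at most `t` from `u`. The rule may differ from vertex to
vertex and may use the identities of the vertices. -/
structure LocalEstimator (n t : ℕ) where
  Seed : Type u
  [seedSpace : MeasurableSpace Seed]
  seedLaw : Measure Seed
  [seedProb : IsProbabilityMeasure seedLaw]
  est : Seed → SimpleGraph (Fin n) → Finset (Fin n)
  measurable_est : ∀ G, Measurable fun s => est s G
  isLocal : ∀ s v G G', SameNeighborhood t v G G' → (v ∈ est s G ↔ v ∈ est s G')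

attribute [instance] LocalEstimator.seedSpace LocalEstimator.seedProb

namespace LocalEstimator

variable {n t : ℕ} (E : LocalEstimator.{u} n t) (K : ℕ) (p q : unitInterval)

/-- The joint law of `((C*, G), s)`: community, graph and external randomness. -/
def law : Measure ((Finset (Fin n) × SimpleGraph (Fin n)) × E.Seed) :=
  (plantedModel n K p q).prod E.seedLaw

/-- The expected size of the symmetric difference of the estimated and the true community. -/
def expectedError : ℝ :=
  ∫ x, ((symmDiff (E.est x.2 x.1.2) x.1.1).card : ℝ) ∂(E.law K p q)

/-- The conditional probability that `v` is classified as a member of the community given that it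
is not one. -/
def errorZero (v : Fin n) : ℝ :=
  ((E.law K p q)[|{x | v ∉ x.1.1}]).real {x | v ∈ E.est x.2 x.1.2}

/-- The conditional probability that `v` is classified as a non-member of the community given that
it is a member. -/
def errorOne (v : Fin n) : ℝ :=
  ((E.law K p q)[|{x | v ∈ x.1.1}]).real {x | v ∉ E.est x.2 x.1.2}

/-- The average error probability at `v`, for the prior probabilities `(n - K) / n` and `K / n`. -/
def avgError (v : Fin n) : ℝ :=
  ((n : ℝ) - K) / n * E.errorZero K p q v + (K : ℝ) / n * E.errorOne K p q v

end LocalEstimator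

end HiddenCommunity

end

/-! A local rule sees only a ball of radius `t` in a sparse graph. Such a ball is nearly a labelled
random tree whose vertices carry independent types: a member of the community with probability `k =
K / n`, a non-member otherwise. The theorem reduces to a lower bound for testing the type of the
root of that tree, plus a one-sided comparison of the planted model with the tree.

Testing on the tree. Every vertex has `n` independent potential children, so the laws of the
observation under the two root types are products, and divergences between them obey a recursion in
the depth. Let `S_t` be the second moment of the likelihood ratio, the law under type `true` against
the law under type `false`. One child multiplies it by about `1 + k ^ 2 * (p - q) ^ 2 / q * S_t`,
and `n` children give about `S_{t+1} ≤ exp (lam * S_t)`. The bound `S_t ≤ e` reproduces itself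
because `lam * e ≤ 1` (`chiSq_obsWeight_le`). With this bound at hand, each child lowers the
Bhattacharyya coefficient by at most about `k ^ 2 * (p - q) ^ 2 / q * e / 8`, so the square of the
coefficient is at least `exp (-(lam * e / 4))` at every depth (`exp_le_affinity_obsWeight_sq`). The
first two claims follow from `testing_affinity`, with the prior weights and with weights `1 / 2`.
The two claims on the lower limit follow from `testing_chiSq` with weight ratio `(n - K) / K`, which
tends to infinity while `S_t` stays below `e`.

Comparison. An error probability is bounded below by summing over observations, so only lower bounds
on the probabilities of observations in the planted model are needed. For an observation with `N`
vertices, all with distinct labels, this probability is at least `1 - N ^ 2 * compareError` times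
its tree weight (`obsWeight_le_sum_plantedGraph`); the loss comes from coins inspected twice, from
replacing random types by a fixed community, and from sampling without replacement. First and second
moment bounds in powers of `2 + n * p` control repeated labels and `N ^ 2`, and the total loss is `n
^ (-1 + o(1))` (`mul_totalError_le`). By locality the decision is constant on the event of one
observation, so each local rule induces a test on the tree (`sub_totalError_le`). -/

noncomputable section

open MeasureTheory ProbabilityTheory

namespace HiddenCommunity

/-! ### The idealized labelled tree -/

/-- What is seen of the idealized neighborhood of depth `t` of a vertex: every vertex that is not
at the last level has `n` potential children, one for each label, and each of them is either absent
or present together with its own observation. -/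
def TreeObs (n : ℕ) : ℕ → Type
  | 0 => Unit
  | t + 1 => Fin n → Option (TreeObs n t)

instance TreeObs.fintype (n : ℕ) : ∀ t, Fintype (TreeObs n t)
  | 0 => inferInstanceAs (Fintype Unit)
  | t + 1 =>
    letI := TreeObs.fintype n t
    inferInstanceAs (Fintype (Fin n → Option (TreeObs n t)))

/-- The prior probability of the type `b`, where `true` means membership. -/
def prior (k : ℝ) (b : Bool) : ℝ := if b then k else 1 - k

/-- The connection probability of vertices of types `b` and `c`. -/
def conn (p q : ℝ) (b c : Bool) : ℝ := if b = true ∧ c = true then p else q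

/-- The connection probability of a vertex of type `b` and a vertex of random type. -/
def meanConn (k p q : ℝ) (b : Bool) : ℝ := if b then q + k * (p - q) else q

/-- The law of one potential child of a vertex of type `b`, if `μ c` is the law of the observation
at a vertex of type `c`. -/
def branchWeight {α : Type} (k p q : ℝ) (μ : Bool → α → ℝ) (b : Bool) : Option α → ℝ
  | none => 1 - meanConn k p q b
  | some y => ∑ c, prior k c * conn p q b c * μ c y

/-- The law of the observation of depth `t` at a vertex of type `b` in the idealized tree. -/
def obsWeight {n : ℕ} (k p q : ℝ) : ∀ t, Bool → TreeObs n t → ℝ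
  | 0, _, _ => 1
  | t + 1, b, x => ∏ w : Fin n, branchWeight k p q (obsWeight k p q t) b (x w)

section Basic

variable {n : ℕ} {k p q : ℝ} {α : Type}

lemma sum_treeObs_succ {t : ℕ} (F : TreeObs n (t + 1) → ℝ) :
    ∑ x, F x = ∑ x : Fin n → Option (TreeObs n t), F x := rfl

lemma sum_prior_mul_conn (b : Bool) :
    ∑ c, prior k c * conn p q b c = meanConn k p q b := by
  cases b <;> simp [prior, conn, meanConn] <;> ring

lemma prior_nonneg (hk : 0 ≤ k) (hk1 : k ≤ 1) (b : Bool) : 0 ≤ prior k b := by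
  cases b <;> simp [prior] <;> linarith

lemma sum_prior : ∑ b, prior k b = 1 := by simp [prior]

lemma conn_nonneg (hq : 0 ≤ q) (hqp : q ≤ p) (b c : Bool) : 0 ≤ conn p q b c := by
  unfold conn; split_ifs <;> linarith

lemma conn_le (hqp : q ≤ p) (b c : Bool) : conn p q b c ≤ p := by
  unfold conn; split_ifs <;> linarith

lemma meanConn_le (hk1 : k ≤ 1) (hqp : q ≤ p) (b : Bool) : meanConn k p q b ≤ p := by
  have := mul_nonneg (sub_nonneg.2 hk1) (sub_nonneg.2 hqp)
  unfold meanConn; split_ifs <;> linarith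

lemma sum_branchWeight [Fintype α] {μ : Bool → α → ℝ} (hμ : ∀ c, ∑ y, μ c y = 1) (b : Bool) :
    ∑ o, branchWeight k p q μ b o = 1 := by
  rw [Fintype.sum_option]
  simp only [branchWeight]
  rw [Finset.sum_comm]
  simp only [← Finset.mul_sum, hμ, mul_one, sum_prior_mul_conn]
  ring

lemma branchWeight_nonneg {μ : Bool → α → ℝ} (hk : 0 ≤ k) (hk1 : k ≤ 1) (hq : 0 ≤ q) (hqp : q ≤ p)
    (hp : p ≤ 1) (hμ : ∀ c y, 0 ≤ μ c y) (b : Bool) (o : Option α) :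
    0 ≤ branchWeight k p q μ b o := by
  cases o with
  | none => simpa [branchWeight] using (meanConn_le hk1 hqp b).trans hp
  | some y =>
    exact Finset.sum_nonneg fun c _ => mul_nonneg
      (mul_nonneg (prior_nonneg hk hk1 c) (conn_nonneg hq hqp b c)) (hμ c y)

lemma obsWeight_nonneg (hk : 0 ≤ k) (hk1 : k ≤ 1) (hq : 0 ≤ q) (hqp : q ≤ p) (hp : p ≤ 1) :
    ∀ (t : ℕ) (b : Bool) (x : TreeObs n t), 0 ≤ obsWeight k p q t b x
  | 0, _, _ => zero_le_one
  | t + 1, b, x => Finset.prod_nonneg fun w _ =>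
      branchWeight_nonneg hk hk1 hq hqp hp (obsWeight_nonneg hk hk1 hq hqp hp t) b (x w)

lemma sum_prod_pi [Fintype α] (f : Fin n → α → ℝ) :
    ∑ x : Fin n → α, ∏ w, f w (x w) = ∏ w, ∑ a, f w a := by
  classical
  rw [Finset.prod_univ_sum, Fintype.piFinset_univ]

lemma sum_obsWeight : ∀ (t : ℕ) (b : Bool), ∑ x : TreeObs n t, obsWeight k p q t b x = 1
  | 0, _ => by
    change ∑ x : Unit, (1 : ℝ) = 1
    simp
  | t + 1, b => by
    rw [sum_treeObs_succ]
    simp only [obsWeight]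
    rw [sum_prod_pi fun _ : Fin n => branchWeight k p q (obsWeight (n := n) k p q t) b]
    simp [sum_branchWeight (sum_obsWeight t)]

/-- Presence of a child has weight at least `(1 - k) * q` times a positive one, and absence has
weight `1 - q`. This makes the likelihood ratio against type `false` well defined. -/
lemma obsWeight_false_pos (hk : 0 ≤ k) (hk1 : k < 1) (hq : 0 < q) (hqp : q ≤ p) (hp : p ≤ 1)
    (hq1 : q < 1) : ∀ (t : ℕ) (x : TreeObs n t), 0 < obsWeight k p q t false x
  | 0, _ => zero_lt_one
  | t + 1, x => by
    refine Finset.prod_pos fun w _ => ?_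
    cases x w with
    | none => simpa [branchWeight, meanConn] using hq1
    | some y =>
      have h1 := obsWeight_false_pos hk hk1 hq hqp hp hq1 t y
      have h2 := obsWeight_nonneg hk hk1.le hq.le hqp hp t true y
      simp only [branchWeight, Fintype.sum_bool, prior, conn]
      have : 0 < (1 - k) * q * obsWeight k p q t false y :=
        mul_pos (mul_pos (by linarith) hq) h1
      have : 0 ≤ k * q * obsWeight k p q t true y := by positivity
      simp; linarith

end Basic

/-! ### Divergences for one child, and two-point testing inequalities -/

section Divergence

variable {α : Type} [Fintype α]

/-- One potential child contributes little to the second moment of the likelihood ratio. -/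
lemma sum_branchWeight_sq_div {k p q : ℝ} (hk : 0 < k) (hk1 : k < 1) (hq : 0 < q)
    (hq1 : q < 1) {μ : Bool → α → ℝ} (hμ : ∀ c, ∑ y, μ c y = 1)
    (hpos : ∀ y, 0 < μ false y) (hnn : ∀ y, 0 ≤ μ true y) :
    ∑ o, branchWeight k p q μ true o ^ 2 / branchWeight k p q μ false o =
      1 + k ^ 2 * (p - q) ^ 2 / q *
        (∑ y, μ true y ^ 2 / (k * μ true y + (1 - k) * μ false y) + q / (1 - q)) := by
  have hP : ∀ y, 0 < k * μ true y + (1 - k) * μ false y := fun y =>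
    add_pos_of_nonneg_of_pos (mul_nonneg hk.le (hnn y)) (mul_pos (by linarith) (hpos y))
  rw [Fintype.sum_option]
  simp only [branchWeight, Fintype.sum_bool, prior, conn, meanConn]
  simp only [if_true, and_self, Bool.false_eq_true, and_false, false_and, if_false]
  -- With `P` the mixture of the two laws, the numerator is the square of `q * P + k * (p - q) * μ
  -- true y` and the denominator is `q * P`. Expanding, the linear term sums to `2 * k * (p - q)`,
  -- which cancels against the absent child.
  have key : ∀ y, (k * p * μ true y + (1 - k) * q * μ false y) ^ 2 /
      (k * q * μ true y + (1 - k) * q * μ false y) =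
      q * (k * μ true y + (1 - k) * μ false y) + 2 * (k * (p - q)) * μ true y +
        k ^ 2 * (p - q) ^ 2 / q * (μ true y ^ 2 / (k * μ true y + (1 - k) * μ false y)) := by
    intro y
    have h := (hP y).ne'
    have h2 : k * q * μ true y + (1 - k) * q * μ false y =
      q * (k * μ true y + (1 - k) * μ false y) := by ring
    rw [h2]
    field_simp
    ring
  simp only [key, Finset.sum_add_distrib, ← Finset.mul_sum, hμ]
  have : 1 - q ≠ 0 := by linarith
  field_simp
  ring

/-- Convexity of `1 / x`: the reciprocal of the mixture is at most the mixture of the reciprocals.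
The gain of a factor `1 - k` over the plain second moment pays for lower-order terms later. -/
lemma sum_sq_div_mix_le {k : ℝ} (hk : 0 < k) (hk1 : k < 1) {f g : α → ℝ}
    (hf : ∑ y, f y = 1) (hpos : ∀ y, 0 < g y) (hnn : ∀ y, 0 ≤ f y) :
    ∑ y, f y ^ 2 / (k * f y + (1 - k) * g y) ≤ (1 - k) * ∑ y, f y ^ 2 / g y + k := by
  have hP : ∀ y, 0 < k * f y + (1 - k) * g y := fun y =>
    add_pos_of_nonneg_of_pos (mul_nonneg hk.le (hnn y)) (mul_pos (by linarith) (hpos y))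
  calc ∑ y, f y ^ 2 / (k * f y + (1 - k) * g y)
      ≤ ∑ y, ((1 - k) * (f y ^ 2 / g y) + k * f y) := by
        refine Finset.sum_le_sum fun y _ => ?_
        rw [div_le_iff₀ (hP y)]
        have hg := hpos y
        have hf' := hnn y
        have e : ((1 - k) * (f y ^ 2 / g y) + k * f y) * (k * f y + (1 - k) * g y) - f y ^ 2 =
            k * (1 - k) * f y * (f y - g y) ^ 2 / g y := by
          field_simp
          ring
        have : 0 ≤ k * (1 - k) * f y * (f y - g y) ^ 2 / g y := by
          have : 0 ≤ 1 - k := by linarith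
          positivity
        linarith
    _ = _ := by rw [Finset.sum_add_distrib, ← Finset.mul_sum, ← Finset.mul_sum, hf, mul_one]

/-- The quadratic coefficient is crude. It serves only for absent children, whose contribution is of
smaller order. -/
lemma one_sub_half_sub_le_sqrt {z : ℝ} (h0 : 0 ≤ z) (h1 : z ≤ 1) :
    1 - z / 2 - z ^ 2 / 2 ≤ √(1 - z) := by
  apply Real.le_sqrt_of_sq_le
  nlinarith [mul_nonneg h0 (sub_nonneg.2 h1), pow_nonneg h0 3,
    mul_nonneg (mul_nonneg h0 h0) (sub_nonneg.2 h1), mul_nonneg (pow_nonneg h0 3) (sub_nonneg.2 h1)]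

/-- Here the coefficient `1 / 8` is that of the Taylor expansion; it is the source of the exponent
`lam * e / 4`. -/
lemma one_add_half_sub_le_sqrt {x : ℝ} (hx : 0 ≤ x) : 1 + x / 2 - x ^ 2 / 8 ≤ √(1 + x) := by
  rcases le_or_gt (1 + x / 2 - x ^ 2 / 8) 0 with h | h
  · exact h.trans (Real.sqrt_nonneg _)
  · apply Real.le_sqrt_of_sq_le
    have : x ^ 2 ≤ 8 * x := by nlinarith
    have e : (1 + x / 2 - x ^ 2 / 8) ^ 2 = 1 + x - x ^ 2 * (x * (8 - x)) / 64 := by ring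
    have : 0 ≤ x ^ 2 * (x * (8 - x)) := by
      apply mul_nonneg (sq_nonneg _); nlinarith
    rw [e]; linarith

/-- One potential child decreases the Bhattacharyya coefficient only a little. -/
lemma le_sum_sqrt_branchWeight {k p q : ℝ} (hk : 0 < k) (hk1 : k < 1) (hq : 0 < q) (hqp : q ≤ p)
    (hp : p ≤ 1) (hq1 : q < 1) {μ : Bool → α → ℝ} (hμ : ∀ c, ∑ y, μ c y = 1)
    (hpos : ∀ y, 0 < μ false y) (hnn : ∀ y, 0 ≤ μ true y) :
    1 - k ^ 2 * (p - q) ^ 2 / q *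
        ((∑ y, μ true y ^ 2 / (k * μ true y + (1 - k) * μ false y)) / 8 + q / (1 - q) / 2) ≤
      ∑ o, √(branchWeight k p q μ false o * branchWeight k p q μ true o) := by
  have hP : ∀ y, 0 < k * μ true y + (1 - k) * μ false y := fun y =>
    add_pos_of_nonneg_of_pos (mul_nonneg hk.le (hnn y)) (mul_pos (by linarith) (hpos y))
  rw [Fintype.sum_option]
  simp only [branchWeight, Fintype.sum_bool, prior, conn, meanConn]
  simp only [if_true, and_self, Bool.false_eq_true, and_false, false_and, if_false]
  have hq1' : 0 < 1 - q := by linarith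
  have hd : 0 ≤ k * (p - q) := mul_nonneg hk.le (by linarith)
  have hd1 : k * (p - q) ≤ 1 - q := by nlinarith
  have none : (1 - q) - k * (p - q) / 2 - k ^ 2 * (p - q) ^ 2 / q * (q / (1 - q) / 2) ≤
      √((1 - q) * (1 - (q + k * (p - q)))) := by
    have e : (1 - q) * (1 - (q + k * (p - q))) = (1 - q) ^ 2 * (1 - k * (p - q) / (1 - q)) := by
      field_simp; ring
    rw [e, Real.sqrt_mul (sq_nonneg _), Real.sqrt_sq hq1'.le]
    refine le_trans (le_of_eq ?_) (mul_le_mul_of_nonneg_left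
      (one_sub_half_sub_le_sqrt (z := k * (p - q) / (1 - q)) (by positivity)
        ((div_le_one hq1').2 hd1)) hq1'.le)
    field_simp
  have some : ∀ y, q * (k * μ true y + (1 - k) * μ false y) + k * (p - q) / 2 * μ true y -
      k ^ 2 * (p - q) ^ 2 / q * (μ true y ^ 2 / (k * μ true y + (1 - k) * μ false y) / 8) ≤
      √((k * q * μ true y + (1 - k) * q * μ false y) *
        (k * p * μ true y + (1 - k) * q * μ false y)) := by
    intro y
    have hPy := hP y
    -- The product under the root is `(q * P) ^ 2 * (1 + x)` with `x = k * (p - q) * μ true y / (q *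
    -- P)`, to which the expansion of `√(1 + x)` applies. After summation the first-order terms
    -- cancel against those of the absent child.
    set P := k * μ true y + (1 - k) * μ false y with hPdef
    have hy := hnn y
    have e : (k * q * μ true y + (1 - k) * q * μ false y) *
        (k * p * μ true y + (1 - k) * q * μ false y) =
        (q * P) ^ 2 * (1 + k * (p - q) * μ true y / (q * P)) := by
      have h1 : k * q * μ true y + (1 - k) * q * μ false y = q * P := by rw [hPdef]; ring
      have h2 : k * p * μ true y + (1 - k) * q * μ false y = q * P + k * (p - q) * μ true y := by
        rw [hPdef]; ring
      rw [h1, h2]; field_simp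
    rw [e, Real.sqrt_mul (sq_nonneg _), Real.sqrt_sq (by positivity)]
    refine le_trans (le_of_eq ?_) (mul_le_mul_of_nonneg_left
      (one_add_half_sub_le_sqrt (x := k * (p - q) * μ true y / (q * P)) (by positivity))
        (by positivity))
    field_simp
  have hsum := Finset.sum_le_sum fun y (_ : y ∈ Finset.univ) => some y
  simp only [Finset.sum_add_distrib, Finset.sum_sub_distrib, ← Finset.mul_sum, hμ,
    ← Finset.sum_div] at hsum
  refine le_trans (le_of_eq ?_) (add_le_add none hsum)
  ring

/-- Any test errs with weight at least `∑ min (a * f) (b * g)`. Since `min * max` is the product,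
Cauchy-Schwarz bounds the squared affinity by this sum times `∑ max`, and the latter is at most `a +
b = 1`. -/
lemma testing_affinity {f g : α → ℝ} (hf : ∀ y, 0 ≤ f y) (hg : ∀ y, 0 ≤ g y)
    (hf1 : ∑ y, f y = 1) (hg1 : ∑ y, g y = 1) {a b : ℝ} (ha : 0 ≤ a) (hb : 0 ≤ b)
    (hab : a + b = 1) (D : α → Prop) [DecidablePred D] :
    a * b * (∑ y, √(f y * g y)) ^ 2 ≤
      a * (∑ y, if D y then f y else 0) + b * ∑ y, if D y then 0 else g y := by
  set m : α → ℝ := fun y => min (a * f y) (b * g y) with hm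
  set M : α → ℝ := fun y => max (a * f y) (b * g y) with hM
  have hm0 : ∀ y, 0 ≤ m y := fun y => le_min (mul_nonneg ha (hf y)) (mul_nonneg hb (hg y))
  have hM0 : ∀ y, 0 ≤ M y := fun y => (mul_nonneg ha (hf y)).trans (le_max_left _ _)
  have h1 : ∑ y, M y ≤ 1 := by
    calc ∑ y, M y ≤ ∑ y, (a * f y + b * g y) := Finset.sum_le_sum fun y _ =>
          max_le (le_add_of_nonneg_right (mul_nonneg hb (hg y)))
            (le_add_of_nonneg_left (mul_nonneg ha (hf y)))
      _ = 1 := by rw [Finset.sum_add_distrib, ← Finset.mul_sum, ← Finset.mul_sum, hf1, hg1]; linarith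
  have h2 : ∑ y, m y ≤
      a * (∑ y, if D y then f y else 0) + b * ∑ y, if D y then 0 else g y := by
    rw [Finset.mul_sum, Finset.mul_sum, ← Finset.sum_add_distrib]
    refine Finset.sum_le_sum fun y _ => ?_
    by_cases h : D y
    · simp [h, hm]
    · simp [h, hm]
  refine le_trans ?_ h2
  have h3 : (∑ y, √(m y) * √(M y)) ^ 2 ≤ (∑ y, √(m y) ^ 2) * ∑ y, √(M y) ^ 2 :=
    Finset.sum_mul_sq_le_sq_mul_sq _ _ _
  simp only [Real.sq_sqrt (hm0 _), Real.sq_sqrt (hM0 _)] at h3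
  have h4 : a * b * (∑ y, √(f y * g y)) ^ 2 = (∑ y, √(m y) * √(M y)) ^ 2 := by
    have : ∀ y, √(m y) * √(M y) = √(a * b) * √(f y * g y) := by
      intro y
      rw [← Real.sqrt_mul (hm0 y), ← Real.sqrt_mul (mul_nonneg ha hb), hm, hM, min_mul_max]
      congr 1; ring
    simp only [this, ← Finset.mul_sum]
    rw [mul_pow, Real.sq_sqrt (mul_nonneg ha hb)]
  rw [h4]
  refine h3.trans ?_
  have := Finset.sum_nonneg fun y (_ : y ∈ Finset.univ) => hm0 y
  nlinarith

/-- The bound is pointwise: both `a * f y` and `g y` are at least `g y - g y ^ 2 / (a * f y)`. It is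
useful when `a` is large and the second moment bounded, since it then gives almost the full mass of
`g`. -/
lemma testing_chiSq {f g : α → ℝ} (hf : ∀ y, 0 < f y) (hg : ∀ y, 0 ≤ g y)
    (hg1 : ∑ y, g y = 1) {a : ℝ} (ha : 0 < a) (D : α → Prop) [DecidablePred D] :
    1 - (∑ y, g y ^ 2 / f y) / a ≤
      a * (∑ y, if D y then f y else 0) + ∑ y, if D y then 0 else g y := by
  rw [← hg1, Finset.sum_div, ← Finset.sum_sub_distrib, Finset.mul_sum, ← Finset.sum_add_distrib]
  refine Finset.sum_le_sum fun y _ => ?_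
  have hy := hf y
  have hgy := hg y
  have hnn : 0 ≤ g y ^ 2 / f y / a := by positivity
  by_cases h : D y
  · simp only [h, if_true, add_zero]
    have : g y ^ 2 / f y / a = g y * (g y / (a * f y)) := by field_simp
    rw [this]
    rcases le_or_gt (g y) (a * f y) with h' | h'
    · have : 0 ≤ g y * (g y / (a * f y)) := by positivity
      linarith
    · have : 1 ≤ g y / (a * f y) := by rw [one_le_div (by positivity)]; exact h'.le
      nlinarith [mul_pos ha hy]
  · simp [h]; linarith

end Divergence

/-! ### Recursion of the divergences in the depth -/

section TreeDivergence

variable {n : ℕ} {k p q lam : ℝ}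

lemma div_one_sub_le (hq : 0 < q) (hk1 : k < 1) (hqk : 16 * q ≤ k) : q / (1 - q) ≤ k / 15 := by
  rw [div_le_iff₀ (by linarith)]; nlinarith

/-- The second moment of the likelihood ratio stays bounded at the Kesten-Stigum-type threshold
`lam = 1 / e`. -/
lemma chiSq_obsWeight_le (hk : 0 < k) (hk1 : k < 1) (hq : 0 < q) (hqp : q ≤ p) (hp : p ≤ 1)
    (hqk : 16 * q ≤ k) (hlam0 : 0 ≤ lam) (hlam : lam ≤ 1 / Real.exp 1)
    (h : n * k ^ 2 * (p - q) ^ 2 = lam * (1 - k) * q) : ∀ t : ℕ,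
    ∑ x : TreeObs n t, obsWeight k p q t true x ^ 2 / obsWeight k p q t false x ≤ Real.exp 1
  | 0 => by
    change ∑ x : Unit, (1 : ℝ) ^ 2 / 1 ≤ _
    simp
  | t + 1 => by
    have ih := chiSq_obsWeight_le hk hk1 hq hqp hp hqk hlam0 hlam h t
    have hq1 : q < 1 := by linarith
    have hpos := obsWeight_false_pos (n := n) hk.le hk1 hq hqp hp hq1 t
    have hnn := obsWeight_nonneg (n := n) hk.le hk1.le hq.le hqp hp t true
    have hsum := sum_obsWeight (n := n) (k := k) (p := p) (q := q) t
    have hmix := sum_sq_div_mix_le hk hk1 (hsum true) hpos hnn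
    have hqq := div_one_sub_le hq hk1 hqk
    rw [sum_treeObs_succ]
    simp only [obsWeight, ← Finset.prod_pow, ← Finset.prod_div_distrib]
    rw [sum_prod_pi fun _ : Fin n => fun o =>
      branchWeight k p q (obsWeight (n := n) k p q t) true o ^ 2 /
        branchWeight k p q (obsWeight (n := n) k p q t) false o]
    rw [Finset.prod_const, Finset.card_univ, Fintype.card_fin,
      sum_branchWeight_sq_div hk hk1 hq hq1 hsum hpos hnn]
    set B := ∑ y : TreeObs n t, obsWeight k p q t true y ^ 2 /
      (k * obsWeight k p q t true y + (1 - k) * obsWeight k p q t false y) with hB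
    have hB0 : 0 ≤ B := Finset.sum_nonneg fun y _ => by
      have := hpos y
      have := hnn y
      have : 0 < 1 - k := by linarith
      positivity
    have he : 2 < Real.exp 1 := by have := Real.exp_one_gt_d9; linarith
    have hqq0 : 0 ≤ q / (1 - q) := div_nonneg hq.le (by linarith)
    have hz : 0 ≤ k ^ 2 * (p - q) ^ 2 / q * (B + q / (1 - q)) := by positivity
    have hexp := Real.add_one_le_exp (k ^ 2 * (p - q) ^ 2 / q * (B + q / (1 - q)))
    rw [add_comm] at hexp
    refine (pow_le_pow_left₀ (by linarith) hexp n).trans ?_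
    rw [← Real.exp_nat_mul, Real.exp_le_exp]
    -- The relation defining `lam` turns `n` children into the factor `lam * (1 - k)`.
    have e1 : (n : ℝ) * (k ^ 2 * (p - q) ^ 2 / q * (B + q / (1 - q))) =
        lam * ((1 - k) * (B + q / (1 - q))) := by
      have : (n : ℝ) * (k ^ 2 * (p - q) ^ 2 / q) = lam * (1 - k) := by
        rw [← mul_div_assoc, ← mul_assoc, h]; field_simp
      rw [← mul_assoc, this]; ring
    rw [e1]
    -- The two factors `1 - k`, from the signal strength and from the mixture, absorb both the extra
    -- `k` of the mixture and the term `q / (1 - q) ≤ k / 15`, so that the invariant is exactly `e`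
    -- with no loss per level.
    have e2 : (1 - k) * (B + q / (1 - q)) ≤ Real.exp 1 := by
      have : B + q / (1 - q) ≤ (1 - k) * Real.exp 1 + 2 * k := by
        have := mul_le_mul_of_nonneg_left ih (by linarith : 0 ≤ 1 - k)
        linarith
      nlinarith [mul_le_mul_of_nonneg_left this (by linarith : 0 ≤ 1 - k), mul_pos hk hk]
    calc lam * ((1 - k) * (B + q / (1 - q))) ≤ lam * Real.exp 1 :=
          mul_le_mul_of_nonneg_left e2 hlam0
      _ ≤ 1 / Real.exp 1 * Real.exp 1 := mul_le_mul_of_nonneg_right hlam (Real.exp_nonneg _)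
      _ = 1 := by field_simp

lemma exp_neg_div_le_one_sub {x : ℝ} (hx : x < 1) : Real.exp (-(x / (1 - x))) ≤ 1 - x := by
  have h : 0 < 1 - x := by linarith
  rw [Real.exp_neg, inv_le_comm₀ (Real.exp_pos _) h]
  have : (1 - x)⁻¹ = x / (1 - x) + 1 := by field_simp; ring
  rw [this]; exact Real.add_one_le_exp _

/-- The Bhattacharyya coefficient of the two laws of the observation. -/
lemma exp_le_affinity_obsWeight_sq (hk : 0 < k) (hk1 : k < 1) (hq : 0 < q) (hqp : q ≤ p)
    (hp : p ≤ 1) (hqk : 16 * q ≤ k) (hlam0 : 0 ≤ lam) (hlam : lam ≤ 1 / Real.exp 1)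
    (h : n * k ^ 2 * (p - q) ^ 2 = lam * (1 - k) * q) (hnk : 1 ≤ n * k) : ∀ t : ℕ,
    Real.exp (-(lam * Real.exp 1 / 4)) ≤
      (∑ x : TreeObs n t, √(obsWeight k p q t false x * obsWeight k p q t true x)) ^ 2
  | 0 => by
    change _ ≤ (∑ x : Unit, √((1 : ℝ) * 1)) ^ 2
    simp
    positivity
  | t + 1 => by
    have ih := chiSq_obsWeight_le hk hk1 hq hqp hp hqk hlam0 hlam h t
    have hq1 : q < 1 := by linarith
    have hpos := obsWeight_false_pos (n := n) hk.le hk1 hq hqp hp hq1 t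
    have hnn := obsWeight_nonneg (n := n) hk.le hk1.le hq.le hqp hp t
    have hsum := sum_obsWeight (n := n) (k := k) (p := p) (q := q) t
    have hmix := sum_sq_div_mix_le hk hk1 (hsum true) hpos (hnn true)
    have hqq := div_one_sub_le hq hk1 hqk
    rw [sum_treeObs_succ]
    have hbr := branchWeight_nonneg (μ := obsWeight (n := n) k p q t) hk.le hk1.le hq.le hqp hp hnn
    simp only [obsWeight, ← Finset.prod_mul_distrib]
    -- The square root is written as a power in order to distribute it over the children.
    simp only [Real.sqrt_eq_rpow]
    simp only [← Real.finsetProd_rpow _ _ fun w _ => mul_nonneg (hbr _ _) (hbr _ _)]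
    simp only [← Real.sqrt_eq_rpow]
    rw [sum_prod_pi fun _ : Fin n => fun o =>
      √(branchWeight k p q (obsWeight (n := n) k p q t) false o *
        branchWeight k p q (obsWeight (n := n) k p q t) true o)]
    rw [Finset.prod_const, Finset.card_univ, Fintype.card_fin]
    have hstep := le_sum_sqrt_branchWeight hk hk1 hq hqp hp hq1 hsum hpos (hnn true)
    set B := ∑ y : TreeObs n t, obsWeight k p q t true y ^ 2 /
      (k * obsWeight k p q t true y + (1 - k) * obsWeight k p q t false y) with hB
    have hB0 : 0 ≤ B := Finset.sum_nonneg fun y _ => by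
      have := hpos y
      have := hnn true y
      have : 0 < 1 - k := by linarith
      positivity
    have hn : (0 : ℝ) < n := by
      by_contra hn
      nlinarith
    have he : 2.7 < Real.exp 1 := by have := Real.exp_one_gt_d9; linarith
    have he' : Real.exp 1 < 2.8 := by have := Real.exp_one_lt_d9; linarith
    have hqq0 : 0 ≤ q / (1 - q) := div_nonneg hq.le (by linarith)
    set y := (1 - k) * (B / 8 + q / (1 - q) / 2) with hy
    have hy0 : 0 ≤ y := mul_nonneg (by linarith) (by positivity)
    -- The slack `k / 8` pays for the passage from `1 - x` to an exponential, which costs a factor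
    -- `1 / (1 - x)` in the exponent; `e * x ≤ k` below is what makes the slack sufficient.
    have hyle : y ≤ Real.exp 1 / 8 - k / 8 := by
      have h1 := mul_le_mul_of_nonneg_left ih (by linarith : 0 ≤ 1 - k)
      have h2 : B / 8 + q / (1 - q) / 2 ≤ (1 - k) * Real.exp 1 / 8 + k / 8 + k / 30 := by linarith
      have h3 := mul_le_mul_of_nonneg_left h2 (by linarith : 0 ≤ 1 - k)
      nlinarith [mul_pos hk hk, mul_pos hk (by linarith : 0 < 1 - k)]
    set x := k ^ 2 * (p - q) ^ 2 / q * (B / 8 + q / (1 - q) / 2) with hx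
    have hnx : n * x = lam * y := by
      have : (n : ℝ) * (k ^ 2 * (p - q) ^ 2 / q) = lam * (1 - k) := by
        rw [← mul_div_assoc, ← mul_assoc, h]; field_simp
      rw [hx, hy, ← mul_assoc, this]; ring
    have hlame : lam * Real.exp 1 ≤ 1 := by
      rwa [le_div_iff₀ (Real.exp_pos 1)] at hlam
    have hnx8 : n * x ≤ 1 / 8 := by
      rw [hnx]
      have : lam * y ≤ lam * (Real.exp 1 / 8) := mul_le_mul_of_nonneg_left (by linarith) hlam0
      linarith
    have hex : Real.exp 1 * x ≤ k := by
      have h1 : x ≤ k / 8 := by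
        have : n * x ≤ n * (k / 8) := by linarith
        exact le_of_mul_le_mul_left this hn
      have := mul_le_mul_of_nonneg_left h1 (Real.exp_nonneg 1)
      nlinarith
    have hx1 : x < 1 := by nlinarith
    have hx1' : 0 < 1 - x := by linarith
    have h1 : Real.exp (-(x / (1 - x))) ≤
        ∑ o, √(branchWeight k p q (obsWeight (n := n) k p q t) false o *
          branchWeight k p q (obsWeight (n := n) k p q t) true o) :=
      (exp_neg_div_le_one_sub hx1).trans hstep
    rw [← pow_mul]
    refine le_trans ?_ (pow_le_pow_left₀ (Real.exp_nonneg _) h1 _)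
    rw [← Real.exp_nat_mul, Real.exp_le_exp]
    -- The `n` children and the square give `2 * n * x = 2 * lam * y`, and `y` is essentially `e /
    -- 8`.
    have h2 : ((n * 2 : ℕ) : ℝ) * -(x / (1 - x)) = -(2 * (lam * (y / (1 - x)))) := by
      push_cast
      rw [mul_div_assoc', ← hnx]; ring
    rw [h2, neg_le_neg_iff]
    have h3 : y / (1 - x) ≤ Real.exp 1 / 8 := by
      rw [div_le_iff₀ hx1']; nlinarith
    have := mul_le_mul_of_nonneg_left h3 hlam0
    linarith

end TreeDivergence

/-! ### Labels of an observation, and its size -/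

/-- The labels of the vertices of the subtree above the child `w`, where `V` gives the labels of the
vertices of a present subtree. -/
def branchVerts {n : ℕ} {α : Type} (V : Fin n → α → Finset (Fin n)) (w : Fin n) (o : Option α) :
    Finset (Fin n) :=
  o.elim ∅ (V w)

/-- The labels of the vertices of an observation with root label `r`. -/
def verts {n : ℕ} : ∀ t, Fin n → TreeObs n t → Finset (Fin n)
  | 0, r, _ => {r}
  | t + 1, r, x => insert r (Finset.univ.biUnion fun w => branchVerts (verts t) w (x w))

/-- All vertices of the observation have distinct labels. -/
def Good {n : ℕ} : ∀ t, Fin n → TreeObs n t → Prop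
  | 0, _, _ => True
  | t + 1, r, x => (∀ w, r ∉ branchVerts (verts t) w (x w)) ∧
      (∀ w w', w ≠ w' →
        Disjoint (branchVerts (verts t) w (x w)) (branchVerts (verts t) w' (x w'))) ∧
      ∀ w, ∀ y ∈ x w, Good t w y

/-- The number of vertices of an observation. -/
def size {n : ℕ} : ∀ t, TreeObs n t → ℕ
  | 0, _ => 1
  | t + 1, x => 1 + ∑ w : Fin n, (x w).elim 0 (size t)

/-! ### Marginals of a product of child laws -/

section Marginals

variable {n : ℕ} {β : Type} [Fintype β]

lemma sum_prod_mul_single {ν : β → ℝ} (hν : ∑ o, ν o = 1) (f : β → ℝ) (i : Fin n) :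
    ∑ x : Fin n → β, (∏ w, ν (x w)) * f (x i) = ∑ o, ν o * f o := by
  have h : ∀ x : Fin n → β, (∏ w, ν (x w)) * f (x i) =
      ∏ w, (ν (x w) * if w = i then f (x w) else 1) := by
    intro x
    rw [Finset.prod_mul_distrib, Finset.prod_ite_eq' Finset.univ i]
    simp
  simp only [h]
  rw [sum_prod_pi fun w o => ν o * if w = i then f o else 1,
    Finset.prod_eq_single i (fun j _ hj => by simp [hj, hν]) (by simp)]
  simp

lemma sum_prod_mul_pair {ν : β → ℝ} (hν : ∑ o, ν o = 1) (f g : β → ℝ) {i j : Fin n}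
    (hij : i ≠ j) :
    ∑ x : Fin n → β, (∏ w, ν (x w)) * (f (x i) * g (x j)) =
      (∑ o, ν o * f o) * ∑ o, ν o * g o := by
  have h : ∀ x : Fin n → β, (∏ w, ν (x w)) * (f (x i) * g (x j)) =
      ∏ w, (ν (x w) * ((if w = i then f (x w) else 1) * if w = j then g (x w) else 1)) := by
    intro x
    rw [Finset.prod_mul_distrib, Finset.prod_mul_distrib, Finset.prod_ite_eq' Finset.univ i,
      Finset.prod_ite_eq' Finset.univ j]
    simp
  simp only [h]
  rw [sum_prod_pi fun w o => ν o * ((if w = i then f o else 1) * if w = j then g o else 1),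
    Finset.prod_eq_mul i j hij (fun w _ hw => by simp [hw.1, hw.2, hν]) (by simp) (by simp)]
  simp [hij, hij.symm]

/-- A child is present with probability at most `p` whatever the two types are, and an absent child
contributes nothing. All moment bounds below recurse through this estimate. -/
lemma sum_branchWeight_mul_le {α : Type} [Fintype α] {k p q : ℝ} (hk : 0 ≤ k) (hk1 : k ≤ 1)
    (hq : 0 ≤ q) (hqp : q ≤ p) {μ : Bool → α → ℝ} (hμ : ∀ c y, 0 ≤ μ c y) (b : Bool)
    {f : Option α → ℝ} (h0 : f none = 0) (hf : ∀ y, 0 ≤ f (some y)) {M : ℝ}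
    (hM : ∀ c, ∑ y, μ c y * f (some y) ≤ M) :
    ∑ o, branchWeight k p q μ b o * f o ≤ p * M := by
  rw [Fintype.sum_option, h0, mul_zero, zero_add]
  simp only [branchWeight, Finset.sum_mul]
  rw [Finset.sum_comm]
  have hp : 0 ≤ p := hq.trans hqp
  calc ∑ c, ∑ y, prior k c * conn p q b c * μ c y * f (some y)
      = ∑ c, prior k c * (conn p q b c * ∑ y, μ c y * f (some y)) := by
        refine Finset.sum_congr rfl fun c _ => ?_
        rw [← mul_assoc, Finset.mul_sum]
        exact Finset.sum_congr rfl fun y _ => by ring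
    _ ≤ ∑ c, prior k c * (p * M) := by
        refine Finset.sum_le_sum fun c _ => mul_le_mul_of_nonneg_left ?_ (prior_nonneg hk hk1 c)
        exact mul_le_mul (conn_le hqp b c) (hM c)
          (Finset.sum_nonneg fun y _ => mul_nonneg (hμ c y) (hf y)) hp
    _ = p * M := by rw [← Finset.sum_mul, sum_prior, one_mul]

end Marginals

/-! ### Moments of the size, and the probability of repeated labels -/

section Moments

variable {n : ℕ} {k p q : ℝ}

lemma card_verts_le : ∀ (t : ℕ) (r : Fin n) (x : TreeObs n t), (verts t r x).card ≤ size t x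
  | 0, _, _ => by simp [verts, size]
  | t + 1, r, x => by
    simp only [verts, size]
    refine (Finset.card_insert_le _ _).trans ?_
    rw [add_comm]
    gcongr
    refine Finset.card_biUnion_le.trans (Finset.sum_le_sum fun w _ => ?_)
    cases h : x w with
    | none => simp [branchVerts]
    | some y => simpa [branchVerts] using card_verts_le t w y

-- The label `v` can be that of the child itself, possible only on branch `v`, or occur deeper,
-- which the bound `M` covers.
open Classical in
lemma sum_branchWeight_mem_le {α : Type} [Fintype α] (hk : 0 ≤ k) (hk1 : k ≤ 1) (hq : 0 ≤ q)
    (hqp : q ≤ p) {μ : Bool → α → ℝ} (hμ : ∀ c y, 0 ≤ μ c y) (hμ1 : ∀ c, ∑ y, μ c y = 1)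
    {V : Fin n → α → Finset (Fin n)} {M : ℝ} (hM : 0 ≤ M)
    (h : ∀ c w v, v ≠ w → ∑ y, μ c y * (if v ∈ V w y then 1 else 0) ≤ M) (b : Bool) (w v : Fin n) :
    ∑ o, branchWeight k p q μ b o * (if v ∈ branchVerts V w o then 1 else 0) ≤
      p * ((if w = v then 1 else 0) + M) := by
  refine sum_branchWeight_mul_le hk hk1 hq hqp hμ b (by simp [branchVerts])
    (fun _ => by positivity) fun c => ?_
  by_cases hw : w = v
  · rw [if_pos hw]
    calc _ ≤ ∑ y, μ c y := Finset.sum_le_sum fun y _ => by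
          have := hμ c y
          split_ifs <;> simp [this]
      _ = 1 := hμ1 c
      _ ≤ _ := by linarith
  · rw [if_neg hw, zero_add]
    exact h c w v (Ne.symm hw)

-- Union bound over the children: one of them may be `v` itself, and each of the `n` subtrees
-- contains `v` with small probability. This gives `p + n * p * (p * m ^ t)` for `m = 2 + n * p`,
-- which is at most `p * m ^ (t + 1)`.
open Classical in
lemma sum_obsWeight_mem_verts_le (hk : 0 ≤ k) (hk1 : k ≤ 1) (hq : 0 ≤ q) (hqp : q ≤ p)
    (hp : p ≤ 1) : ∀ (t : ℕ) (b : Bool) (r v : Fin n), v ≠ r →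
    ∑ x : TreeObs n t, obsWeight k p q t b x * (if v ∈ verts t r x then 1 else 0) ≤
      p * (2 + n * p) ^ t
  | 0, b, r, v, h => by
    have hp0 : 0 ≤ p := hq.trans hqp
    simpa [verts, h] using hp0
  | t + 1, b, r, v, h => by
    have hp0 : 0 ≤ p := hq.trans hqp
    have hnn := obsWeight_nonneg (n := n) hk hk1 hq hqp hp
    have hbr := branchWeight_nonneg hk hk1 hq hqp hp (hnn t)
    have hν := sum_branchWeight (k := k) (p := p) (q := q)
      (sum_obsWeight (n := n) (k := k) (p := p) (q := q) t) b
    have hpw : 1 ≤ (2 + n * p) ^ t := one_le_pow₀ (by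
      have : 0 ≤ n * p := by positivity
      linarith)
    calc ∑ x : TreeObs n (t + 1),
          obsWeight k p q (t + 1) b x * (if v ∈ verts (t + 1) r x then 1 else 0)
        ≤ ∑ x : Fin n → Option (TreeObs n t),
          ∑ w, (∏ w, branchWeight k p q (obsWeight k p q t) b (x w)) *
            (if v ∈ branchVerts (verts t) w (x w) then 1 else 0) := by
          rw [sum_treeObs_succ]
          refine Finset.sum_le_sum fun x _ => ?_
          rw [← Finset.mul_sum]
          refine mul_le_mul_of_nonneg_left ?_ (Finset.prod_nonneg fun w _ => hbr b (x w))
          by_cases hv : v ∈ verts (t + 1) r x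
          · rw [if_pos hv]
            simp only [verts, Finset.mem_insert, h, Finset.mem_biUnion, Finset.mem_univ,
              true_and, false_or] at hv
            obtain ⟨w, hw⟩ := hv
            refine le_trans ?_ (Finset.single_le_sum (f := fun w =>
              if v ∈ branchVerts (verts t) w (x w) then (1 : ℝ) else 0) (fun _ _ => by positivity)
              (Finset.mem_univ w))
            simp [hw]
          · rw [if_neg hv]
            positivity
      _ = ∑ w, ∑ o, branchWeight k p q (obsWeight k p q t) b o *
            (if v ∈ branchVerts (verts t) w o then 1 else 0) := by
          rw [Finset.sum_comm]
          exact Finset.sum_congr rfl fun w _ => sum_prod_mul_single hν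
            (fun o => if v ∈ branchVerts (verts t) w o then 1 else 0) w
      _ ≤ ∑ w, p * ((if w = v then 1 else 0) + p * (2 + n * p) ^ t) :=
          Finset.sum_le_sum fun w _ => sum_branchWeight_mem_le hk hk1 hq hqp (hnn t)
            (sum_obsWeight t) (by positivity)
            (sum_obsWeight_mem_verts_le hk hk1 hq hqp hp t) b w v
      _ = p + n * p * (p * (2 + n * p) ^ t) := by
          rw [← Finset.mul_sum, Finset.sum_add_distrib]
          simp; ring
      _ ≤ p * (2 + n * p) ^ (t + 1) := by
          have : p ≤ p * (2 + n * p) ^ t := le_mul_of_one_le_right hp0 hpw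
          rw [pow_succ]; nlinarith

lemma sum_obsWeight_size_le (hk : 0 ≤ k) (hk1 : k ≤ 1) (hq : 0 ≤ q) (hqp : q ≤ p)
    (hp : p ≤ 1) : ∀ (t : ℕ) (b : Bool),
    ∑ x : TreeObs n t, obsWeight k p q t b x * (size t x : ℝ) ≤ (2 + n * p) ^ t
  | 0, b => by
    change ∑ x : Unit, (1 : ℝ) * ((1 : ℕ) : ℝ) ≤ _
    simp
  | t + 1, b => by
    have hp0 : 0 ≤ p := hq.trans hqp
    have hnn := obsWeight_nonneg (n := n) hk hk1 hq hqp hp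
    have hν := sum_branchWeight (k := k) (p := p) (q := q)
      (sum_obsWeight (n := n) (k := k) (p := p) (q := q) t) b
    have hpw : 1 ≤ (2 + n * p) ^ t := one_le_pow₀ (by
      have : 0 ≤ n * p := by positivity
      linarith)
    have ih := sum_obsWeight_size_le hk hk1 hq hqp hp t
    have e : ∑ x : TreeObs n (t + 1), obsWeight k p q (t + 1) b x * (size (t + 1) x : ℝ) =
        1 + ∑ w : Fin n, ∑ o, branchWeight k p q (obsWeight (n := n) k p q t) b o *
          ((o.elim 0 (size t) : ℕ) : ℝ) := by
      have h1 : ∀ x : TreeObs n (t + 1), obsWeight k p q (t + 1) b x * (size (t + 1) x : ℝ) =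
          obsWeight k p q (t + 1) b x + ∑ w, (∏ w, branchWeight k p q (obsWeight k p q t) b (x w)) *
            (((x w).elim 0 (size t) : ℕ) : ℝ) := by
        intro x
        rw [← Finset.mul_sum]
        simp only [size, obsWeight]
        push_cast; ring
      simp only [h1]
      rw [Finset.sum_add_distrib, sum_obsWeight, sum_treeObs_succ, Finset.sum_comm]
      congr 1
      exact Finset.sum_congr rfl fun w _ => sum_prod_mul_single hν
        (fun o => ((o.elim 0 (size t) : ℕ) : ℝ)) w
    rw [e]
    have h2 : ∀ w : Fin n, ∑ o, branchWeight k p q (obsWeight (n := n) k p q t) b o *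
          ((o.elim 0 (size t) : ℕ) : ℝ) ≤ p * (2 + n * p) ^ t := fun w =>
      sum_branchWeight_mul_le hk hk1 hq hqp (hnn t) b (by simp) (fun _ => by positivity) ih
    have h3 := Finset.sum_le_sum fun w (_ : w ∈ Finset.univ) => h2 w
    simp only [Finset.sum_const, Finset.card_univ, Fintype.card_fin, nsmul_eq_mul] at h3 ⊢
    rw [pow_succ]; nlinarith

/-- The second moment of a sum over independent children. -/
lemma sum_prod_mul_sum_sq_le {β : Type} [Fintype β] {ν : β → ℝ} (hν : ∑ o, ν o = 1)
    (hν0 : ∀ o, 0 ≤ ν o) {f : β → ℝ} (hf : ∀ o, 0 ≤ f o) :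
    ∑ x : Fin n → β, (∏ w, ν (x w)) * (∑ w, f (x w)) ^ 2 ≤
      n * (∑ o, ν o * f o ^ 2) + (n * ∑ o, ν o * f o) ^ 2 := by
  have hE : 0 ≤ ∑ o, ν o * f o := Finset.sum_nonneg fun o _ => mul_nonneg (hν0 o) (hf o)
  calc ∑ x : Fin n → β, (∏ w, ν (x w)) * (∑ w, f (x w)) ^ 2
      = ∑ i, ∑ j, ∑ x : Fin n → β, (∏ w, ν (x w)) * (f (x i) * f (x j)) := by
        simp_rw [sq, Finset.sum_mul_sum, Finset.mul_sum]
        rw [Finset.sum_comm]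
        exact Finset.sum_congr rfl fun i _ => Finset.sum_comm
    _ ≤ ∑ i : Fin n, ∑ j : Fin n,
          ((if i = j then ∑ o, ν o * f o ^ 2 else 0) + (∑ o, ν o * f o) ^ 2) := by
        refine Finset.sum_le_sum fun i _ => Finset.sum_le_sum fun j _ => ?_
        by_cases hij : i = j
        · subst hij
          rw [if_pos rfl, sum_prod_mul_single hν (fun o => f o * f o) i]
          simp only [← sq]
          exact le_add_of_nonneg_right (sq_nonneg _)
        · rw [if_neg hij, sum_prod_mul_pair hν f f hij, zero_add, sq]
    _ = _ := by
        simp only [Finset.sum_add_distrib, Finset.sum_ite_eq, Finset.mem_univ, if_true,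
          Finset.sum_const, Finset.card_univ, Fintype.card_fin, nsmul_eq_mul]
        ring

lemma sum_obsWeight_size_sq_le (hk : 0 ≤ k) (hk1 : k ≤ 1) (hq : 0 ≤ q) (hqp : q ≤ p)
    (hp : p ≤ 1) : ∀ (t : ℕ) (b : Bool),
    ∑ x : TreeObs n t, obsWeight k p q t b x * (size t x : ℝ) ^ 2 ≤ (2 + n * p) ^ (3 * t)
  | 0, b => by
    change ∑ x : Unit, (1 : ℝ) * ((1 : ℕ) : ℝ) ^ 2 ≤ _
    simp
  | t + 1, b => by
    have hp0 : 0 ≤ p := hq.trans hqp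
    have hnn := obsWeight_nonneg (n := n) hk hk1 hq hqp hp
    have hbr := branchWeight_nonneg hk hk1 hq hqp hp (hnn t)
    have hν := sum_branchWeight (k := k) (p := p) (q := q)
      (sum_obsWeight (n := n) (k := k) (p := p) (q := q) t) b
    have hnp : 0 ≤ n * p := by positivity
    have hpw : 1 ≤ (2 + n * p) ^ t := one_le_pow₀ (by linarith)
    set f : Option (TreeObs n t) → ℝ := fun o => ((o.elim 0 (size t) : ℕ) : ℝ) with hf
    have hf0 : ∀ o, 0 ≤ f o := fun o => by positivity
    have e : ∑ x : TreeObs n (t + 1), obsWeight k p q (t + 1) b x * (size (t + 1) x : ℝ) ^ 2 =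
        1 + 2 * (n * ∑ o, branchWeight k p q (obsWeight (n := n) k p q t) b o * f o) +
          ∑ x : Fin n → Option (TreeObs n t),
            (∏ w, branchWeight k p q (obsWeight k p q t) b (x w)) * (∑ w, f (x w)) ^ 2 := by
      have h1 : ∀ x : TreeObs n (t + 1), obsWeight k p q (t + 1) b x * (size (t + 1) x : ℝ) ^ 2 =
          obsWeight k p q (t + 1) b x +
          2 * ∑ w, (∏ w, branchWeight k p q (obsWeight k p q t) b (x w)) * f (x w) +
          (∏ w, branchWeight k p q (obsWeight k p q t) b (x w)) * (∑ w, f (x w)) ^ 2 := by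
        intro x
        rw [← Finset.mul_sum]
        simp only [size, obsWeight, hf]
        push_cast; ring
      simp only [h1]
      rw [Finset.sum_add_distrib, Finset.sum_add_distrib, sum_obsWeight, ← Finset.mul_sum]
      congr 3
      rw [sum_treeObs_succ, Finset.sum_comm]
      rw [Finset.sum_congr rfl fun w _ => sum_prod_mul_single hν f w, Finset.sum_const,
        Finset.card_univ, Fintype.card_fin, nsmul_eq_mul]
    rw [e]
    have h1 : ∑ o, branchWeight k p q (obsWeight (n := n) k p q t) b o * f o ≤
        p * (2 + n * p) ^ t :=
      sum_branchWeight_mul_le hk hk1 hq hqp (hnn t) b (by simp [hf]) (fun _ => hf0 _)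
        (sum_obsWeight_size_le hk hk1 hq hqp hp t)
    have h2 : ∑ o, branchWeight k p q (obsWeight (n := n) k p q t) b o * f o ^ 2 ≤
        p * (2 + n * p) ^ (3 * t) :=
      sum_branchWeight_mul_le hk hk1 hq hqp (hnn t) b (f := fun o => f o ^ 2) (by simp [hf])
        (fun _ => by positivity) (sum_obsWeight_size_sq_le hk hk1 hq hqp hp t)
    have h3 := sum_prod_mul_sum_sq_le (n := n) hν (hbr b) hf0
    have h1' := mul_le_mul_of_nonneg_left h1 (Nat.cast_nonneg (α := ℝ) n)
    have h2' := mul_le_mul_of_nonneg_left h2 (Nat.cast_nonneg (α := ℝ) n)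
    have hE : 0 ≤ n * ∑ o, branchWeight k p q (obsWeight (n := n) k p q t) b o * f o :=
      mul_nonneg (Nat.cast_nonneg n) (Finset.sum_nonneg fun o _ => mul_nonneg (hbr b o) (hf0 o))
    set E := n * ∑ o, branchWeight k p q (obsWeight (n := n) k p q t) b o * f o
    set m := 2 + n * p with hm
    -- The recursion is `(1 + E) ^ 2` plus `n * p` times the second moment one level down. The
    -- exponent `3 * t` leaves room for the square of the mean, `m ^ (2 * (t + 1))`, at every depth.
    have h4 : (1 + E) ^ 2 ≤ (m ^ (t + 1)) ^ 2 := by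
      refine pow_le_pow_left₀ (by linarith) ?_ 2
      rw [pow_succ]; nlinarith
    have h5 : (m ^ (t + 1)) ^ 2 ≤ m ^ (3 * t + 2) := by
      rw [← pow_mul]
      exact pow_le_pow_right₀ (by linarith) (by omega)
    have h6 : m ^ (3 * t) ≤ m ^ (3 * t + 2) := pow_le_pow_right₀ (by linarith) (by omega)
    have h7 : m ^ (3 * (t + 1)) = m ^ (3 * t + 2) * m := by ring
    have h8 : 0 ≤ m ^ (3 * t + 2) := by positivity
    rw [h7, hm]
    nlinarith [mul_le_mul_of_nonneg_left h6 hnp]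

-- Union bound over the three ways to repeat a label: the root's label in a subtree, a common label
-- in two subtrees, a repetition inside one subtree.
open Classical in
lemma ite_not_good_le {t : ℕ} (r : Fin n) (x : TreeObs n (t + 1)) :
    (if Good (t + 1) r x then 0 else 1 : ℝ) ≤
      ∑ w, (if r ∈ branchVerts (verts t) w (x w) then 1 else 0) +
      ∑ v, ∑ w, ∑ w', (if w = w' then 0 else
        (if v ∈ branchVerts (verts t) w (x w) then 1 else 0) *
          (if v ∈ branchVerts (verts t) w' (x w') then 1 else 0)) +
      ∑ w, (if ∀ y ∈ x w, Good t w y then 0 else 1) := by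
  have h1 : (0 : ℝ) ≤ ∑ w, (if r ∈ branchVerts (verts t) w (x w) then 1 else 0) := by positivity
  have h2n : ∀ v w w', (0 : ℝ) ≤ (if w = w' then 0 else
        (if v ∈ branchVerts (verts t) w (x w) then 1 else 0) *
          (if v ∈ branchVerts (verts t) w' (x w') then 1 else 0)) := fun v w w' => by positivity
  have h2 : (0 : ℝ) ≤ ∑ v, ∑ w, ∑ w', (if w = w' then 0 else
        (if v ∈ branchVerts (verts t) w (x w) then 1 else 0) *
          (if v ∈ branchVerts (verts t) w' (x w') then 1 else 0)) :=
    Finset.sum_nonneg fun v _ => Finset.sum_nonneg fun w _ => Finset.sum_nonneg fun w' _ =>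
      h2n v w w'
  have h3 : (0 : ℝ) ≤ ∑ w, (if ∀ y ∈ x w, Good t w y then 0 else 1) := by positivity
  by_cases hg : Good (t + 1) r x
  · rw [if_pos hg]; linarith
  rw [if_neg hg]
  simp only [Good, not_and_or, not_forall] at hg
  rcases hg with ⟨w, hw⟩ | ⟨w, w', hne, hw⟩ | ⟨w, y, hy, hw⟩
  · have := Finset.single_le_sum (f := fun w =>
      (if r ∈ branchVerts (verts t) w (x w) then 1 else 0 : ℝ)) (fun _ _ => by positivity)
      (Finset.mem_univ w)
    rw [if_pos (not_not.1 hw)] at this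
    linarith
  · obtain ⟨v, hv, hv'⟩ := Finset.not_disjoint_iff.1 hw
    have e1 := Finset.single_le_sum (f := fun v => ∑ w, ∑ w', (if w = w' then 0 else
        (if v ∈ branchVerts (verts t) w (x w) then 1 else 0) *
          (if v ∈ branchVerts (verts t) w' (x w') then 1 else 0) : ℝ))
      (fun v _ => Finset.sum_nonneg fun w _ => Finset.sum_nonneg fun w' _ => h2n v w w')
      (Finset.mem_univ v)
    have e2 := Finset.single_le_sum (f := fun w => ∑ w', (if w = w' then 0 else
        (if v ∈ branchVerts (verts t) w (x w) then 1 else 0) *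
          (if v ∈ branchVerts (verts t) w' (x w') then 1 else 0) : ℝ))
      (fun w _ => Finset.sum_nonneg fun w' _ => h2n v w w') (Finset.mem_univ w)
    have e3 := Finset.single_le_sum (f := fun w' => (if w = w' then 0 else
        (if v ∈ branchVerts (verts t) w (x w) then 1 else 0) *
          (if v ∈ branchVerts (verts t) w' (x w') then 1 else 0) : ℝ))
      (fun w' _ => h2n v w w') (Finset.mem_univ w')
    have e4 := (show (1 : ℝ) = _ by rw [if_neg hne, if_pos hv, if_pos hv', mul_one]).le.trans e3
    linarith
  · have := Finset.single_le_sum (f := fun w =>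
      (if ∀ y ∈ x w, Good t w y then 0 else 1 : ℝ)) (fun _ _ => by positivity)
      (Finset.mem_univ w)
    rw [if_neg fun h => hw (h y hy)] at this
    linarith

open Classical in
/-- The labels of the idealized tree are rarely repeated. -/
lemma sum_obsWeight_not_good_le (hk : 0 ≤ k) (hk1 : k ≤ 1) (hq : 0 ≤ q) (hqp : q ≤ p)
    (hp : p ≤ 1) : ∀ (t : ℕ) (b : Bool) (r : Fin n),
    ∑ x : TreeObs n t, obsWeight k p q t b x * (if Good t r x then 0 else 1) ≤
      p * (2 + n * p) ^ (2 * t + 2)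
  | 0, b, r => by
    have hp0 : 0 ≤ p := hq.trans hqp
    have : 0 ≤ p * (2 + n * p) ^ (2 * 0 + 2) := by positivity
    simpa [Good] using this
  | t + 1, b, r => by
    have hp0 : 0 ≤ p := hq.trans hqp
    have hnn := obsWeight_nonneg (n := n) hk hk1 hq hqp hp
    have hbr := branchWeight_nonneg hk hk1 hq hqp hp (hnn t)
    have hν := sum_branchWeight (k := k) (p := p) (q := q)
      (sum_obsWeight (n := n) (k := k) (p := p) (q := q) t) b
    have hnp : 0 ≤ n * p := by positivity
    set ν := branchWeight k p q (obsWeight (n := n) k p q t) b with hνdef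
    set m := 2 + n * p with hm
    have hpw : 1 ≤ m ^ t := one_le_pow₀ (by linarith)
    set H : Fin n → Fin n → ℝ := fun w v =>
      ∑ o, ν o * (if v ∈ branchVerts (verts t) w o then 1 else 0) with hH
    have hH0 : ∀ w v, 0 ≤ H w v := fun w v =>
      Finset.sum_nonneg fun o _ => mul_nonneg (hbr b o) (by positivity)
    have hHsum : ∀ v, ∑ w, H w v ≤ p * m ^ (t + 1) := by
      intro v
      calc ∑ w, H w v ≤ ∑ w, p * ((if w = v then 1 else 0) + p * m ^ t) :=
            Finset.sum_le_sum fun w _ => sum_branchWeight_mem_le hk hk1 hq hqp (hnn t)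
              (sum_obsWeight t) (by positivity)
              (sum_obsWeight_mem_verts_le hk hk1 hq hqp hp t) b w v
        _ = p + n * p * (p * m ^ t) := by
            rw [← Finset.mul_sum, Finset.sum_add_distrib]
            simp; ring
        _ ≤ p * m ^ (t + 1) := by
            have : p ≤ p * m ^ t := le_mul_of_one_le_right hp0 hpw
            rw [pow_succ, hm]; rw [hm] at this; nlinarith
    have hbad : ∀ w : Fin n, ∑ o, ν o * (if ∀ y ∈ o, Good t w y then 0 else 1) ≤
        p * (p * m ^ (2 * t + 2)) := fun w =>
      sum_branchWeight_mul_le hk hk1 hq hqp (hnn t) b (by simp) (fun _ => by positivity)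
        fun c => by simpa using sum_obsWeight_not_good_le hk hk1 hq hqp hp t c w
    -- Distinct children are independent, so the probability that both contain `v` factors; the sum
    -- over pairs is at most the square of the sum over single children.
    have hpair : ∀ v, ∑ w, ∑ w', (if w = w' then 0 else H w v * H w' v) ≤
        (p * m ^ (t + 1)) ^ 2 := by
      intro v
      calc ∑ w, ∑ w', (if w = w' then 0 else H w v * H w' v)
          ≤ ∑ w, ∑ w', H w v * H w' v := by
            refine Finset.sum_le_sum fun w _ => Finset.sum_le_sum fun w' _ => ?_
            have := mul_nonneg (hH0 w v) (hH0 w' v)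
            split_ifs <;> simp [this]
        _ = (∑ w, H w v) ^ 2 := by rw [sq, Finset.sum_mul_sum]
        _ ≤ _ := pow_le_pow_left₀ (Finset.sum_nonneg fun w _ => hH0 w v) (hHsum v) 2
    calc ∑ x : TreeObs n (t + 1), obsWeight k p q (t + 1) b x * (if Good (t + 1) r x then 0 else 1)
        ≤ ∑ x : Fin n → Option (TreeObs n t), (∏ w, ν (x w)) *
          (∑ w, (if r ∈ branchVerts (verts t) w (x w) then 1 else 0) +
            ∑ v, ∑ w, ∑ w', (if w = w' then 0 else
              (if v ∈ branchVerts (verts t) w (x w) then 1 else 0) *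
                (if v ∈ branchVerts (verts t) w' (x w') then 1 else 0)) +
            ∑ w, (if ∀ y ∈ x w, Good t w y then 0 else 1)) := by
          rw [sum_treeObs_succ]
          exact Finset.sum_le_sum fun x _ => mul_le_mul_of_nonneg_left (ite_not_good_le r x)
            (Finset.prod_nonneg fun w _ => hbr b (x w))
      _ = ∑ w, H w r + ∑ v, ∑ w, ∑ w', (if w = w' then 0 else H w v * H w' v) +
            ∑ w, ∑ o, ν o * (if ∀ y ∈ o, Good t w y then 0 else 1) := by
          simp only [mul_add, Finset.sum_add_distrib, Finset.mul_sum]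
          congr 1
          · congr 1
            · rw [Finset.sum_comm]
              exact Finset.sum_congr rfl fun w _ => sum_prod_mul_single hν
                (fun o => if r ∈ branchVerts (verts t) w o then 1 else 0) w
            · rw [Finset.sum_comm]
              refine Finset.sum_congr rfl fun v _ => ?_
              rw [Finset.sum_comm]
              refine Finset.sum_congr rfl fun w _ => ?_
              rw [Finset.sum_comm]
              refine Finset.sum_congr rfl fun w' _ => ?_
              by_cases hw : w = w'
              · simp [hw]
              · simp only [if_neg hw]
                exact sum_prod_mul_pair hν
                  (fun o => if v ∈ branchVerts (verts t) w o then 1 else 0)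
                  (fun o => if v ∈ branchVerts (verts t) w' o then 1 else 0) hw
          · rw [Finset.sum_comm]
            exact Finset.sum_congr rfl fun w _ => sum_prod_mul_single hν
              (fun o => if ∀ y ∈ o, Good t w y then 0 else 1) w
      _ ≤ p * m ^ (t + 1) + ∑ v : Fin n, (p * m ^ (t + 1)) ^ 2 +
            ∑ w : Fin n, p * (p * m ^ (2 * t + 2)) :=
          add_le_add (add_le_add (hHsum r) (Finset.sum_le_sum fun v _ => hpair v))
            (Finset.sum_le_sum fun w _ => hbad w)
      _ = p * m ^ (t + 1) + p * (n * p * m ^ (2 * t + 2)) + p * (n * p * m ^ (2 * t + 2)) := by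
          simp only [Finset.sum_const, Finset.card_univ, Fintype.card_fin, nsmul_eq_mul]
          ring
      _ ≤ p * m ^ (2 * (t + 1) + 2) := by
          have e1 : m ^ (t + 1) ≤ m ^ (2 * t + 2) := pow_le_pow_right₀ (by linarith) (by omega)
          have e2 : m ^ (2 * (t + 1) + 2) = m ^ (2 * t + 2) * m ^ 2 := by ring
          have e3 : 0 ≤ m ^ (2 * t + 2) := by positivity
          have e4 : m ^ (t + 1) + n * p * m ^ (2 * t + 2) + n * p * m ^ (2 * t + 2) ≤
              m ^ (2 * (t + 1) + 2) := by
            rw [e2]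
            have : 1 + n * p + n * p ≤ m ^ 2 := by rw [hm]; nlinarith
            nlinarith
          calc _ = p * (m ^ (t + 1) + n * p * m ^ (2 * t + 2) + n * p * m ^ (2 * t + 2)) := by ring
            _ ≤ _ := mul_le_mul_of_nonneg_left e4 hp0

end Moments

/-! ### Types of the vertices as a set of labels -/

/-- The labels of the vertices of an observation that are not at the last level. -/
def innerVerts {n : ℕ} : ∀ t, Fin n → TreeObs n t → Finset (Fin n)
  | 0, _, _ => ∅
  | t + 1, r, x => insert r (Finset.univ.biUnion fun w => branchVerts (innerVerts t) w (x w))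

/-- The edges of an observation with root label `r`. -/
def edges {n : ℕ} : ∀ t, Fin n → TreeObs n t → Finset (Sym2 (Fin n))
  | 0, _, _ => ∅
  | t + 1, r, x => Finset.univ.biUnion fun w =>
      (x w).elim ∅ fun y => insert s(r, w) (edges t w y)

/-- The joint weight of an observation and of the types of its vertices, where the vertices with
label in `A` are the members of the community. -/
def assignWeight {n : ℕ} (k p q : ℝ) (A : Finset (Fin n)) : ∀ t, Fin n → TreeObs n t → ℝ
  | 0, r, _ => prior k (decide (r ∈ A))
  | t + 1, r, x => prior k (decide (r ∈ A)) * ∏ w : Fin n,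
      (x w).elim (1 - meanConn k p q (decide (r ∈ A)))
        fun y => conn p q (decide (r ∈ A)) (decide (w ∈ A)) * assignWeight k p q A t w y

section Assign

variable {n : ℕ} {k p q : ℝ}

lemma mem_verts_root : ∀ (t : ℕ) (r : Fin n) (x : TreeObs n t), r ∈ verts t r x
  | 0, _, _ => by simp [verts]
  | _ + 1, _, _ => by simp [verts]

lemma branchVerts_subset_verts {t : ℕ} (r : Fin n) (x : TreeObs n (t + 1)) (w : Fin n) :
    branchVerts (verts t) w (x w) ⊆ verts (t + 1) r x := fun v hv => by
  simp only [verts, Finset.mem_insert, Finset.mem_biUnion, Finset.mem_univ, true_and]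
  exact Or.inr ⟨w, hv⟩

lemma innerVerts_subset_verts : ∀ (t : ℕ) (r : Fin n) (x : TreeObs n t),
    innerVerts t r x ⊆ verts t r x
  | 0, _, _ => by simp [innerVerts]
  | t + 1, r, x => by
    intro v hv
    simp only [innerVerts, Finset.mem_insert, Finset.mem_biUnion, Finset.mem_univ, true_and] at hv
    rcases hv with rfl | ⟨w, hw⟩
    · exact mem_verts_root _ _ _
    · apply branchVerts_subset_verts r x w
      cases h : x w with
      | none => simp [h, branchVerts] at hw
      | some y =>
        simp only [h, branchVerts, Option.elim] at hw ⊢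
        exact innerVerts_subset_verts t w y hw

lemma mem_edges_succ {t : ℕ} {r : Fin n} {x : TreeObs n (t + 1)} {e : Sym2 (Fin n)} :
    e ∈ edges (t + 1) r x ↔ ∃ w, ∃ y, x w = some y ∧ (e = s(r, w) ∨ e ∈ edges t w y) := by
  simp only [edges, Finset.mem_biUnion, Finset.mem_univ, true_and]
  refine exists_congr fun w => ?_
  cases h : x w <;> simp

lemma mem_verts_of_mem_edges : ∀ (t : ℕ) (r : Fin n) (x : TreeObs n t) (e : Sym2 (Fin n)),
    e ∈ edges t r x → ∀ v ∈ e, v ∈ verts t r x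
  | 0, _, _, _, h => by simp [edges] at h
  | t + 1, r, x, e, h => by
    intro v hv
    obtain ⟨w, y, hy, rfl | he⟩ := mem_edges_succ.1 h
    · rcases Sym2.mem_iff.1 hv with rfl | rfl
      · exact mem_verts_root _ _ _
      · apply branchVerts_subset_verts r x v
        simpa [hy, branchVerts] using mem_verts_root t v y
    · apply branchVerts_subset_verts r x w
      simpa [hy, branchVerts] using mem_verts_of_mem_edges t w y e he v hv

lemma assignWeight_nonneg (hk : 0 ≤ k) (hk1 : k ≤ 1) (hq : 0 ≤ q) (hqp : q ≤ p) (hp : p ≤ 1)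
    (A : Finset (Fin n)) : ∀ (t : ℕ) (r : Fin n) (x : TreeObs n t),
    0 ≤ assignWeight k p q A t r x
  | 0, r, _ => prior_nonneg hk hk1 _
  | t + 1, r, x => by
    refine mul_nonneg (prior_nonneg hk hk1 _) (Finset.prod_nonneg fun w _ => ?_)
    cases x w with
    | none => simpa using (meanConn_le hk1 hqp _).trans hp
    | some y =>
      exact mul_nonneg (conn_nonneg hq hqp _ _) (assignWeight_nonneg hk hk1 hq hqp hp A t w y)

lemma assignWeight_congr {A A' : Finset (Fin n)} : ∀ (t : ℕ) (r : Fin n) (x : TreeObs n t),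
    (∀ v ∈ verts t r x, v ∈ A ↔ v ∈ A') →
    assignWeight k p q A t r x = assignWeight k p q A' t r x
  | 0, r, x, h => by
    have := h r (mem_verts_root _ _ _)
    simp [assignWeight, this]
  | t + 1, r, x, h => by
    have hr : decide (r ∈ A) = decide (r ∈ A') := by simp [h r (mem_verts_root _ _ _)]
    simp only [assignWeight, hr]
    congr 1
    refine Finset.prod_congr rfl fun w _ => ?_
    cases hw : x w with
    | none => rfl
    | some y =>
      have hsub : verts t w y ⊆ verts (t + 1) r x := by
        simpa [hw, branchVerts] using branchVerts_subset_verts r x w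
      have hw' : decide (w ∈ A) = decide (w ∈ A') := by simp [h w (hsub (mem_verts_root _ _ _))]
      simp only [Option.elim, hw']
      rw [assignWeight_congr t w y fun v hv => h v (hsub hv)]

/-- On an observation with distinct labels, the types of the vertices can be read off from a set of
labels. -/
lemma prior_mul_obsWeight_le (hk : 0 ≤ k) (hk1 : k ≤ 1) (hq : 0 ≤ q) (hqp : q ≤ p) (hp : p ≤ 1) :
    ∀ (t : ℕ) (b : Bool) (r : Fin n) (x : TreeObs n t), Good t r x →
    prior k b * obsWeight k p q t b x ≤
      ∑ A ∈ (verts t r x).powerset with decide (r ∈ A) = b, assignWeight k p q A t r x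
  | 0, b, r, x, _ => by
    have hmem : (if b then {r} else ∅ : Finset (Fin n)) ∈
        (verts 0 r x).powerset.filter fun A => decide (r ∈ A) = b := by
      cases b <;> simp [verts]
    refine le_trans (le_of_eq ?_) (Finset.single_le_sum
      (fun A _ => assignWeight_nonneg hk hk1 hq hqp hp A 0 r x) hmem)
    cases b <;> simp [obsWeight, assignWeight]
  | t + 1, b, r, x, hg => by
    obtain ⟨hroot, hdisj, hsub⟩ := hg
    set V : Fin n → Finset (Fin n) := fun w => branchVerts (verts t) w (x w) with hV
    set g : Fin n → Finset (Fin n) → ℝ := fun w A => (x w).elim (1 - meanConn k p q b)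
        fun y => conn p q b (decide (w ∈ A)) * assignWeight k p q A t w y with hgdef
    have hnn := obsWeight_nonneg (n := n) hk hk1 hq hqp hp t
    have hbranch : ∀ w, branchWeight k p q (obsWeight k p q t) b (x w) ≤
        ∑ A ∈ (V w).powerset, g w A := by
      intro w
      cases hw : x w with
      | none => simp [hV, hgdef, hw, branchVerts, branchWeight]
      | some y =>
        have ih := fun c => prior_mul_obsWeight_le hk hk1 hq hqp hp t c w y
          (hsub w y (by simp [hw]))
        simp only [hV, hgdef, hw, branchVerts, branchWeight, Option.elim]
        rw [← Finset.sum_fiberwise (verts t w y).powerset (fun A => decide (w ∈ A))]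
        refine Finset.sum_le_sum fun c _ => ?_
        calc prior k c * conn p q b c * obsWeight k p q t c y
            = conn p q b c * (prior k c * obsWeight k p q t c y) := by ring
          _ ≤ conn p q b c * ∑ A ∈ (verts t w y).powerset with decide (w ∈ A) = c,
                assignWeight k p q A t w y :=
              mul_le_mul_of_nonneg_left (ih c) (conn_nonneg hq hqp _ _)
          _ = _ := by
              rw [Finset.mul_sum]
              refine Finset.sum_congr rfl fun A hA => ?_
              rw [(Finset.mem_filter.1 hA).2]
    have hprod : ∏ w, branchWeight k p q (obsWeight k p q t) b (x w) ≤
        ∑ f ∈ Fintype.piFinset fun w => (V w).powerset, ∏ w, g w (f w) := by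
      rw [← Finset.prod_univ_sum]
      exact Finset.prod_le_prod
        (fun w _ => branchWeight_nonneg hk hk1 hq hqp hp hnn b (x w)) fun w _ => hbranch w
    -- A choice of types in each subtree is glued to a single set, with the root added according to
    -- `b`. Distinct labels make the subtrees disjoint and free of `r`, so each choice is recovered
    -- from the glued set and nothing is counted twice.
    set U : (Fin n → Finset (Fin n)) → Finset (Fin n) := fun f =>
      (if b then {r} else ∅) ∪ Finset.univ.biUnion f with hU
    have hf : ∀ {f}, f ∈ Fintype.piFinset (fun w => (V w).powerset) → ∀ w, f w ⊆ V w :=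
      fun hf w => Finset.mem_powerset.1 (Fintype.mem_piFinset.1 hf w)
    have hUr : ∀ {f}, f ∈ Fintype.piFinset (fun w => (V w).powerset) →
        decide (r ∈ U f) = b := by
      intro f hf'
      have : ∀ w, r ∉ f w := fun w h => hroot w (hf hf' w h)
      cases b <;> simp [hU, this]
    have hUV : ∀ {f}, f ∈ Fintype.piFinset (fun w => (V w).powerset) → ∀ w, ∀ v ∈ V w,
        (v ∈ f w ↔ v ∈ U f) := by
      intro f hf' w v hv
      have hvr : v ≠ r := fun h => hroot w (h ▸ hv)
      constructor
      · intro h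
        exact Finset.mem_union_right _ (Finset.mem_biUnion.2 ⟨w, Finset.mem_univ _, h⟩)
      · intro h
        rcases Finset.mem_union.1 h with h | h
        · cases b <;> simp [hvr] at h
        · obtain ⟨w', -, h⟩ := Finset.mem_biUnion.1 h
          by_cases hww : w = w'
          · exact hww ▸ h
          · exact absurd (hf hf' w' h) (Finset.disjoint_left.1 (hdisj w w' hww) hv)
    have hinj : Set.InjOn U (Fintype.piFinset fun w => (V w).powerset) := by
      intro f hf1 f' hf2 heq
      funext w
      ext v
      constructor
      · intro h
        have hv := hf hf1 w h
        rw [hUV hf2 w v hv, ← heq, ← hUV hf1 w v hv]; exact h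
      · intro h
        have hv := hf hf2 w h
        rw [hUV hf1 w v hv, heq, ← hUV hf2 w v hv]; exact h
    have hterm : ∀ f ∈ Fintype.piFinset (fun w => (V w).powerset),
        prior k b * ∏ w, g w (f w) = assignWeight k p q (U f) (t + 1) r x := by
      intro f hf'
      simp only [assignWeight, hUr hf']
      congr 1
      refine Finset.prod_congr rfl fun w _ => ?_
      cases hw : x w with
      | none => simp [hgdef, hw]
      | some y =>
        have hVy : V w = verts t w y := by simp [hV, hw, branchVerts]
        have hmem := hUV hf' w
        rw [hVy] at hmem
        simp only [hgdef, hw, Option.elim]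
        rw [assignWeight_congr t w y hmem]
        simp [hmem w (mem_verts_root _ _ _)]
    calc prior k b * obsWeight k p q (t + 1) b x
        ≤ prior k b * ∑ f ∈ Fintype.piFinset fun w => (V w).powerset, ∏ w, g w (f w) :=
          mul_le_mul_of_nonneg_left hprod (prior_nonneg hk hk1 b)
      _ = ∑ f ∈ Fintype.piFinset fun w => (V w).powerset,
            assignWeight k p q (U f) (t + 1) r x := by
          rw [Finset.mul_sum]
          exact Finset.sum_congr rfl hterm
      _ = ∑ A ∈ (Fintype.piFinset fun w => (V w).powerset).image U,
            assignWeight k p q A (t + 1) r x :=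
          (Finset.sum_image (f := fun A => assignWeight k p q A (t + 1) r x) hinj).symm
      _ ≤ _ := by
          refine Finset.sum_le_sum_of_subset_of_nonneg ?_ fun A _ _ =>
            assignWeight_nonneg hk hk1 hq hqp hp A _ r x
          intro A hA
          obtain ⟨f, hf', rfl⟩ := Finset.mem_image.1 hA
          refine Finset.mem_filter.2 ⟨Finset.mem_powerset.2 fun v hv => ?_, hUr hf'⟩
          rcases Finset.mem_union.1 hv with h | h
          · have : v = r := by
              cases b <;> simp at h
              exact h
            exact this ▸ mem_verts_root _ _ _
          · obtain ⟨w, -, h⟩ := Finset.mem_biUnion.1 h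
            exact branchVerts_subset_verts r x w (hf hf' w h)

end Assign

/-! ### Product form of the weight of an observation -/

section Factor

variable {n : ℕ} {k p q : ℝ}

/-- The probability that the ends of `e` are joined, as a function of the community. -/
def pairConn (p q : ℝ) (A : Finset (Fin n)) (e : Sym2 (Fin n)) : ℝ :=
  if ∀ v ∈ e, v ∈ A then p else q

lemma pairConn_mk (A : Finset (Fin n)) (v w : Fin n) :
    pairConn p q A s(v, w) = conn p q (decide (v ∈ A)) (decide (w ∈ A)) := by
  simp [pairConn, conn]

lemma pairConn_nonneg (hq : 0 ≤ q) (hqp : q ≤ p) (A : Finset (Fin n)) (e : Sym2 (Fin n)) :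
    0 ≤ pairConn p q A e := by
  unfold pairConn; split_ifs <;> linarith

lemma pairConn_le (hqp : q ≤ p) (A : Finset (Fin n)) (e : Sym2 (Fin n)) :
    pairConn p q A e ≤ p := by
  unfold pairConn; split_ifs <;> linarith

lemma prod_branchVerts {α : Type} (V : Fin n → α → Finset (Fin n)) (w : Fin n) (o : Option α)
    (F : Fin n → ℝ) :
    ∏ v ∈ branchVerts V w o, F v = o.elim 1 fun y => ∏ v ∈ V w y, F v := by
  cases o <;> simp [branchVerts]

lemma prod_insert_biUnion_branchVerts {α : Type} (V : Fin n → α → Finset (Fin n))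
    (r : Fin n) (x : Fin n → Option α) (hr : ∀ w, r ∉ branchVerts V w (x w))
    (hd : ∀ w w', w ≠ w' → Disjoint (branchVerts V w (x w)) (branchVerts V w' (x w')))
    (F : Fin n → ℝ) :
    ∏ v ∈ insert r (Finset.univ.biUnion fun w => branchVerts V w (x w)), F v =
      F r * ∏ w, (x w).elim 1 fun y => ∏ v ∈ V w y, F v := by
  rw [Finset.prod_insert (by simpa using hr), Finset.prod_biUnion fun w _ w' _ h => hd w w' h]
  simp only [prod_branchVerts]

/-- With distinct labels no edge occurs in two branches or both at the root and in a branch, so the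
union defining the edge set is disjoint. -/
lemma prod_edges_succ {t : ℕ} {r : Fin n} {x : TreeObs n (t + 1)} (hg : Good (t + 1) r x)
    (F : Sym2 (Fin n) → ℝ) :
    ∏ e ∈ edges (t + 1) r x, F e =
      ∏ w, (x w).elim 1 fun y => F s(r, w) * ∏ e ∈ edges t w y, F e := by
  obtain ⟨hroot, hdisj, -⟩ := hg
  have hr : ∀ {w y}, x w = some y → r ∉ verts t w y := fun {w y} h => by
    simpa [h, branchVerts] using hroot w
  have hd : ∀ {w y w' y'}, x w = some y → x w' = some y' → w ≠ w' →
      Disjoint (verts t w y) (verts t w' y') := fun {w y w' y'} h h' hne => by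
    simpa [h, h', branchVerts] using hdisj w w' hne
  simp only [edges]
  rw [Finset.prod_biUnion]
  · refine Finset.prod_congr rfl fun w _ => ?_
    cases hw : x w with
    | none => simp
    | some y =>
      simp only [Option.elim]
      rw [Finset.prod_insert fun h =>
        hr hw (mem_verts_of_mem_edges t w y _ h r (Sym2.mem_mk_left _ _))]
  · intro w _ w' _ hne
    rw [Function.onFun, Finset.disjoint_left]
    intro e he he'
    cases hw : x w with
    | none => simp [hw] at he
    | some y =>
      cases hw' : x w' with
      | none => simp [hw'] at he'
      | some y' =>
        simp only [hw, hw', Option.elim, Finset.mem_insert] at he he'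
        rcases he with rfl | he
        · rcases he' with he' | he'
          · exact hne (Sym2.congr_right.1 he')
          · exact hr hw' (mem_verts_of_mem_edges t w' y' _ he' r (Sym2.mem_mk_left _ _))
        · rcases he' with rfl | he'
          · exact hr hw (mem_verts_of_mem_edges t w y _ he r (Sym2.mem_mk_left _ _))
          · induction e with
            | _ a b =>
              exact Finset.disjoint_left.1 (hd hw hw' hne)
                (mem_verts_of_mem_edges t w y _ he a (Sym2.mem_mk_left _ _))
                (mem_verts_of_mem_edges t w' y' _ he' a (Sym2.mem_mk_left _ _))

/-- The weight of an observation with distinct labels, compared with a product over its vertices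
and edges. -/
lemma pow_size_mul_assignWeight_le (hk : 0 ≤ k) (hk1 : k ≤ 1) (hq : 0 ≤ q) (hqp : q ≤ p)
    (hp : p ≤ 1) (A : Finset (Fin n)) : ∀ (t : ℕ) (r : Fin n) (x : TreeObs n t), Good t r x →
    (1 - p) ^ size t x * assignWeight k p q A t r x ≤
      (1 - p) * ((∏ v ∈ verts t r x, prior k (decide (v ∈ A))) *
        (∏ e ∈ edges t r x, pairConn p q A e) *
        ∏ v ∈ innerVerts t r x, (1 - meanConn k p q (decide (v ∈ A))) ^ n)
  | 0, r, x, _ => by simp [size, assignWeight, verts, edges, innerVerts]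
  | t + 1, r, x, hg => by
    have hg' := hg
    obtain ⟨hroot, hdisj, hsub⟩ := hg
    have hinner : ∀ w, branchVerts (innerVerts t) w (x w) ⊆ branchVerts (verts t) w (x w) := by
      intro w
      cases x w with
      | none => simp [branchVerts]
      | some y => simpa [branchVerts] using innerVerts_subset_verts t w y
    rw [prod_edges_succ hg']
    simp only [verts, innerVerts]
    rw [prod_insert_biUnion_branchVerts _ _ _ hroot hdisj,
      prod_insert_biUnion_branchVerts _ _ _ (fun w h => hroot w (hinner w h))
        (fun w w' h => (hdisj w w' h).mono (hinner w) (hinner w'))]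
    simp only [size, assignWeight, pow_add, pow_one, ← Finset.prod_pow_eq_pow_sum]
    set b := decide (r ∈ A) with hb
    have hmean : 1 - p ≤ 1 - meanConn k p q b := by linarith [meanConn_le hk1 hqp b]
    have hp1 : 0 ≤ 1 - p := by linarith
    have e : (1 - meanConn k p q b) ^ n = ∏ w : Fin n, (1 - meanConn k p q b) := by simp
    rw [e]
    -- The right side charges `1 - meanConn` for all `n` labels at an inner vertex, the tree weight
    -- only for absent children. Each present child thus needs one extra factor, supplied by its own
    -- `1 - p ≤ 1 - meanConn`; the factor of the root remains outside.
    have key : ∀ w, (1 - p) ^ ((x w).elim 0 (size t)) *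
        (x w).elim (1 - meanConn k p q b)
          (fun y => conn p q b (decide (w ∈ A)) * assignWeight k p q A t w y) ≤
        ((x w).elim 1 fun y => ∏ v ∈ verts t w y, prior k (decide (v ∈ A))) *
        ((x w).elim 1 fun y => pairConn p q A s(r, w) * ∏ e ∈ edges t w y, pairConn p q A e) *
        ((1 - meanConn k p q b) * (x w).elim 1 fun y => ∏ v ∈ innerVerts t w y,
          (1 - meanConn k p q (decide (v ∈ A))) ^ n) := by
      intro w
      cases hw : x w with
      | none => simp
      | some y =>
        simp only [Option.elim]
        have ih := pow_size_mul_assignWeight_le hk hk1 hq hqp hp A t w y (hsub w y (by simp [hw]))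
        rw [pairConn_mk, ← hb]
        set R := (∏ v ∈ verts t w y, prior k (decide (v ∈ A))) *
          (∏ e ∈ edges t w y, pairConn p q A e) *
          ∏ v ∈ innerVerts t w y, (1 - meanConn k p q (decide (v ∈ A))) ^ n with hR
        have hR0 : 0 ≤ R := by
          refine mul_nonneg (mul_nonneg (Finset.prod_nonneg fun v _ => prior_nonneg hk hk1 _)
            (Finset.prod_nonneg fun e _ => pairConn_nonneg hq hqp A e))
            (Finset.prod_nonneg fun v _ => pow_nonneg ?_ n)
          linarith [meanConn_le hk1 hqp (decide (v ∈ A))]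
        have hc := conn_nonneg hq hqp b (decide (w ∈ A))
        calc _ = conn p q b (decide (w ∈ A)) *
              ((1 - p) ^ size t y * assignWeight k p q A t w y) := by ring
          _ ≤ conn p q b (decide (w ∈ A)) * ((1 - meanConn k p q b) * R) :=
              mul_le_mul_of_nonneg_left (ih.trans (mul_le_mul_of_nonneg_right hmean hR0)) hc
          _ = _ := by rw [hR]; ring
    have key0 : ∀ w, 0 ≤ (1 - p) ^ ((x w).elim 0 (size t)) *
        (x w).elim (1 - meanConn k p q b)
          (fun y => conn p q b (decide (w ∈ A)) * assignWeight k p q A t w y) := by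
      intro w
      refine mul_nonneg (pow_nonneg hp1 _) ?_
      cases x w with
      | none => simpa using hp1.trans hmean
      | some y =>
        exact mul_nonneg (conn_nonneg hq hqp _ _) (assignWeight_nonneg hk hk1 hq hqp hp A t w y)
    have hprod := Finset.prod_le_prod (s := Finset.univ) (fun w _ => key0 w) fun w _ => key w
    simp only [Finset.prod_mul_distrib] at hprod
    have := mul_le_mul_of_nonneg_left hprod (mul_nonneg hp1 (prior_nonneg hk hk1 b))
    refine le_trans (le_of_eq ?_) (this.trans (le_of_eq ?_)) <;> ring

end Factor

/-! ### Neighborhoods in a graph and observations -/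

/-- The observation `x` with root label `r` lists the paths of `G` of length at most `t` that start
at `r` and avoid the set `B`. -/
def Fits {n : ℕ} (G : SimpleGraph (Fin n)) : ∀ t, Finset (Fin n) → Fin n → TreeObs n t → Prop
  | 0, _, _, _ => True
  | t + 1, B, r, x => ∀ w, (∀ y, x w = some y → G.Adj r w ∧ w ∉ B ∧ Fits G t (insert r B) w y) ∧
      (x w = none → G.Adj r w → w ∈ B)

/-- The event that the neighborhood of `r` of radius `t` looks like the observation `x`. -/
def treeEvent {n : ℕ} (t : ℕ) (r : Fin n) (x : TreeObs n t) : Set (SimpleGraph (Fin n)) :=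
  {G | Fits G t ∅ r x ∧
    ∀ v ∈ verts t r x, ∀ w ∈ verts t r x, (G.Adj v w ↔ s(v, w) ∈ edges t r x)}

section Fits

variable {n : ℕ} {G : SimpleGraph (Fin n)}

/-- Whether the branch `w` is present is dictated by the graph, as is its content by recursion.
Hence the events of different observations are disjoint and their probabilities may be added. -/
lemma Fits.unique : ∀ {t : ℕ} {B : Finset (Fin n)} {r : Fin n} {x x' : TreeObs n t},
    Fits G t B r x → Fits G t B r x' → x = x'
  | 0, _, _, _, _, _, _ => rfl
  | t + 1, B, r, x, x', h, h' => by
    funext w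
    cases hw : x w with
    | none =>
      cases hw' : x' w with
      | none => rfl
      | some y' =>
        obtain ⟨h1, h2, -⟩ := (h' w).1 y' hw'
        exact absurd ((h w).2 hw h1) h2
    | some y =>
      obtain ⟨h1, h2, h3⟩ := (h w).1 y hw
      cases hw' : x' w with
      | none => exact absurd ((h' w).2 hw' h1) h2
      | some y' => rw [h3.unique ((h' w).1 y' hw').2.2]

lemma Fits.exists_walk : ∀ {t : ℕ} {B : Finset (Fin n)} {r : Fin n} {x : TreeObs n t},
    Fits G t B r x → ∀ v ∈ verts t r x, ∃ c : G.Walk r v, c.length ≤ t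
  | 0, _, r, _, _, v, hv => by
    obtain rfl : v = r := by simpa [verts] using hv
    exact ⟨.nil, le_rfl⟩
  | t + 1, B, r, x, h, v, hv => by
    simp only [verts, Finset.mem_insert, Finset.mem_biUnion, Finset.mem_univ, true_and] at hv
    rcases hv with rfl | ⟨w, hw⟩
    · exact ⟨.nil, Nat.zero_le _⟩
    · cases hx : x w with
      | none => simp [hx, branchVerts] at hw
      | some y =>
        obtain ⟨h1, -, h3⟩ := (h w).1 y hx
        obtain ⟨c, hc⟩ := h3.exists_walk v (by simpa [hx, branchVerts] using hw)
        exact ⟨.cons h1 c, by simpa using hc⟩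

/-- Each step of a path leads to a vertex outside the forbidden set, since a path does not return to
its earlier vertices; these are what the recursion adds to `B`. -/
lemma Fits.mem_verts_of_isPath : ∀ {t : ℕ} {B : Finset (Fin n)} {r : Fin n} {x : TreeObs n t},
    Fits G t B r x → ∀ {v : Fin n} (c : G.Walk r v), c.IsPath → c.length ≤ t →
    (∀ u ∈ c.support, u ∉ B) → v ∈ verts t r x
  | 0, _, r, x, _, v, c, _, hl, _ => by
    cases c with
    | nil => exact mem_verts_root _ _ _
    | cons h c => simp at hl
  | t + 1, B, r, x, h, v, c, hc, hl, hB => by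
    cases c with
    | nil => exact mem_verts_root _ _ _
    | @cons _ w _ hadj c =>
      rw [SimpleGraph.Walk.cons_isPath_iff] at hc
      have hwB : w ∉ B := hB w (by simp)
      apply branchVerts_subset_verts r x w
      cases hx : x w with
      | none => exact absurd ((h w).2 hx hadj) hwB
      | some y =>
        have h3 := ((h w).1 y hx).2.2
        refine h3.mem_verts_of_isPath c hc.1 (by simpa using hl) fun u hu hu' => ?_
        rcases Finset.mem_insert.1 hu' with rfl | hu'
        · exact hc.2 hu
        · exact hB u (by simp [hu]) hu'

lemma Fits.edist_le_iff {t : ℕ} {r : Fin n} {x : TreeObs n t} (h : Fits G t ∅ r x) (v : Fin n) :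
    G.edist r v ≤ t ↔ v ∈ verts t r x := by
  constructor
  · intro hd
    have hne : G.edist r v ≠ ⊤ := ne_top_of_le_ne_top (ENat.natCast_ne_top t) hd
    obtain ⟨c, hc⟩ := (SimpleGraph.edist_ne_top_iff_reachable.1 hne).exists_walk_length_eq_edist
    rw [← hc] at hd
    exact h.mem_verts_of_isPath (c.bypass) c.bypass_isPath
      (c.length_bypass_le_length.trans (by exact_mod_cast hd)) (by simp)
  · intro hv
    obtain ⟨c, hc⟩ := h.exists_walk v hv
    exact (SimpleGraph.edist_le c).trans (by exact_mod_cast hc)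

lemma sameNeighborhood_of_mem_treeEvent {t : ℕ} {r : Fin n} {x : TreeObs n t}
    {G G' : SimpleGraph (Fin n)} (h : G ∈ treeEvent t r x) (h' : G' ∈ treeEvent t r x) :
    SameNeighborhood t r G G' := by
  refine ⟨fun v => (h.1.edist_le_iff v).trans (h'.1.edist_le_iff v).symm, fun v w hv hw => ?_⟩
  rw [h.1.edist_le_iff] at hv hw
  exact (h.2 v hv w hw).trans (h'.2 v hv w hw).symm

lemma disjoint_treeEvent {t : ℕ} {r : Fin n} {x x' : TreeObs n t} (hne : x ≠ x') :
    Disjoint (treeEvent t r x) (treeEvent t r x') :=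
  Set.disjoint_left.2 fun _ h h' => hne (h.1.unique h'.1)

/-- `E` is the edge set of the whole tree, kept fixed while the recursion descends. The fourth
hypothesis says that an edge of `E` at the current subtree lies inside it or leads to the forbidden
set of ancestors; on passing to a child, `r` joins that set and the edge to the parent falls under
the second case. -/
lemma fits_of_adj_iff {E : Finset (Sym2 (Fin n))} : ∀ {t : ℕ} {B : Finset (Fin n)} {r : Fin n}
    {x : TreeObs n t}, Good t r x → Disjoint (verts t r x) B → edges t r x ⊆ E →
    (∀ e ∈ E, ∀ v ∈ verts t r x, v ∈ e → e ∈ edges t r x ∨ ∃ u ∈ B, u ∈ e) →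
    (∀ v ∈ innerVerts t r x, ∀ w, v ≠ w → (G.Adj v w ↔ s(v, w) ∈ E)) → Fits G t B r x
  | 0, _, _, _, _, _, _, _, _ => trivial
  | t + 1, B, r, x, hg, hB, hE, hT, hadj => by
    obtain ⟨hroot, hdisj, hsub⟩ := hg
    have hr : ∀ {w y}, x w = some y → r ∉ verts t w y := fun {w y} h => by
      simpa [h, branchVerts] using hroot w
    have hd : ∀ {w y w' y'}, x w = some y → x w' = some y' → w ≠ w' →
        Disjoint (verts t w y) (verts t w' y') := fun {w y w' y'} h h' hne => by
      simpa [h, h', branchVerts] using hdisj w w' hne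
    have hv : ∀ {w y}, x w = some y → verts t w y ⊆ verts (t + 1) r x := fun {w y} h => by
      simpa [h, branchVerts] using branchVerts_subset_verts r x w
    have hrB : r ∉ B := Finset.disjoint_left.1 hB (mem_verts_root _ _ _)
    have hri : r ∈ innerVerts (t + 1) r x := by simp [innerVerts]
    intro w
    constructor
    · intro y hy
      have hrw : r ≠ w := fun h => hr hy (h ▸ mem_verts_root _ _ _)
      refine ⟨(hadj r hri w hrw).2 (hE (mem_edges_succ.2 ⟨w, y, hy, Or.inl rfl⟩)),
        Finset.disjoint_left.1 hB (hv hy (mem_verts_root _ _ _)),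
        fits_of_adj_iff (E := E) (hsub w y (by simp [hy])) ?_ ?_ ?_ ?_⟩
      · rw [Finset.disjoint_insert_right]
        exact ⟨hr hy, hB.mono_left (hv hy)⟩
      · exact fun e he => hE (mem_edges_succ.2 ⟨w, y, hy, Or.inr he⟩)
      · intro e he v hvy hve
        rcases hT e he v (hv hy hvy) hve with h | ⟨u, hu, hue⟩
        · obtain ⟨w', y', hy', rfl | he'⟩ := mem_edges_succ.1 h
          · exact Or.inr ⟨r, Finset.mem_insert_self _ _, Sym2.mem_mk_left _ _⟩
          · by_cases hww : w = w'
            · subst hww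
              rw [hy] at hy'
              obtain rfl := Option.some.inj hy'
              exact Or.inl he'
            · exact absurd (mem_verts_of_mem_edges t w' y' e he' v hve)
                (Finset.disjoint_left.1 (hd hy hy' hww) hvy)
        · exact Or.inr ⟨u, Finset.mem_insert_of_mem hu, hue⟩
      · intro v hvi
        refine hadj v ?_
        simp only [innerVerts, Finset.mem_insert, Finset.mem_biUnion, Finset.mem_univ, true_and]
        exact Or.inr ⟨w, by simpa [hy, branchVerts] using hvi⟩
    · intro hw hA
      have he := (hadj r hri w hA.ne).1 hA
      rcases hT _ he r (mem_verts_root _ _ _) (Sym2.mem_mk_left _ _) with h | ⟨u, hu, hue⟩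
      · obtain ⟨w', y', hy', h | he'⟩ := mem_edges_succ.1 h
        · obtain rfl := Sym2.congr_right.1 h
          rw [hw] at hy'
          cases hy'
        · exact absurd (mem_verts_of_mem_edges t w' y' _ he' r (Sym2.mem_mk_left _ _)) (hr hy')
      · rcases Sym2.mem_iff.1 hue with rfl | rfl
        · exact absurd hu hrB
        · exact hu

lemma not_isDiag_of_mem_edges : ∀ {t : ℕ} {r : Fin n} {x : TreeObs n t}, Good t r x →
    ∀ e ∈ edges t r x, ¬ e.IsDiag
  | 0, _, _, _, _, h => by simp [edges] at h
  | t + 1, r, x, hg, e, he => by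
    obtain ⟨w, y, hy, rfl | he'⟩ := mem_edges_succ.1 he
    · rw [Sym2.mk_isDiag_iff]
      intro h
      have := hg.1 w
      rw [hy, h] at this
      exact this (mem_verts_root t w y)
    · exact not_isDiag_of_mem_edges (hg.2.2 w y (by simp [hy])) e he'

/-- Membership is decided by finitely many coins: pairs within the vertex set, including those
between last-level vertices, and all pairs at an inner vertex. -/
lemma mem_treeEvent {t : ℕ} {r : Fin n} {x : TreeObs n t} (hg : Good t r x)
    (h : ∀ v w, v ≠ w → (v ∈ verts t r x ∧ w ∈ verts t r x) ∨ v ∈ innerVerts t r x →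
      (G.Adj v w ↔ s(v, w) ∈ edges t r x)) : G ∈ treeEvent t r x := by
  refine ⟨fits_of_adj_iff hg (Finset.disjoint_empty_right _) (Finset.Subset.refl _)
    (fun e he v _ _ => Or.inl he) fun v hv w hvw => h v w hvw (Or.inr hv), fun v hv w hw => ?_⟩
  by_cases hvw : v = w
  · subst hvw
    simp only [SimpleGraph.irrefl, false_iff]
    exact fun he => not_isDiag_of_mem_edges hg _ he (Sym2.mk_isDiag_iff.2 rfl)
  · exact h v w hvw (Or.inl ⟨hv, hw⟩)

end Fits

/-! ### Products of factors in the unit interval -/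

section Products

variable {ι κ : Type} [DecidableEq ι] [DecidableEq κ]

lemma prod_le_prod_of_subset {s t : Finset ι} {f : ι → ℝ} (h : s ⊆ t) (h0 : ∀ i, 0 ≤ f i)
    (h1 : ∀ i, f i ≤ 1) : ∏ i ∈ t, f i ≤ ∏ i ∈ s, f i := by
  rw [← Finset.prod_sdiff h]
  exact mul_le_of_le_one_left (Finset.prod_nonneg fun i _ => h0 i)
    (Finset.prod_le_one (fun i _ => h0 i) fun i _ => h1 i)

/-- Passing to the image drops repeated factors, which are at most `1`. It serves to pass from
ordered pairs of vertices to unordered ones. -/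
lemma prod_le_prod_image (s : Finset ι) (g : ι → κ) {f : κ → ℝ} (h0 : ∀ i, 0 ≤ f i)
    (h1 : ∀ i, f i ≤ 1) : ∏ i ∈ s, f (g i) ≤ ∏ i ∈ s.image g, f i := by
  induction s using Finset.induction_on with
  | empty => simp
  | insert a s ha ih =>
    rw [Finset.prod_insert ha, Finset.image_insert]
    by_cases h : g a ∈ s.image g
    · rw [Finset.insert_eq_of_mem h]
      exact (mul_le_of_le_one_left (Finset.prod_nonneg fun i _ => h0 _) (h1 _)).trans ih
    · rw [Finset.prod_insert h]
      exact mul_le_mul_of_nonneg_left ih (h0 _)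

lemma prod_mul_prod_le_prod_union (s t : Finset ι) {f : ι → ℝ} (h0 : ∀ i, 0 ≤ f i)
    (h1 : ∀ i, f i ≤ 1) : (∏ i ∈ s, f i) * ∏ i ∈ t, f i ≤ ∏ i ∈ s ∪ t, f i := by
  rw [← Finset.prod_union_inter]
  exact mul_le_of_le_one_right (Finset.prod_nonneg fun i _ => h0 i)
    (Finset.prod_le_one (fun i _ => h0 i) fun i _ => h1 i)

end Products

/-! ### Probability of an observation for a given community -/

section Graph

variable {n : ℕ}

instance : MeasurableSingletonClass (SimpleGraph (Fin n)) :=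
  ⟨fun G => ⟨{G.Adj}, MeasurableSet.singleton _, by
    ext H
    simp only [Set.mem_preimage, Set.mem_singleton_iff]
    exact ⟨fun h => SimpleGraph.ext h, fun h => h ▸ rfl⟩⟩⟩

lemma coe_edgeProb (C : Finset (Fin n)) (p q : unitInterval) (e : Sym2 (Fin n)) :
    (edgeProb C p q e : ℝ) = pairConn (p : ℝ) q C e := by
  unfold edgeProb pairConn
  split_ifs <;> rfl

lemma measurable_coins : Measurable fun ω : Sym2 (Fin n) → Prop =>
    SimpleGraph.fromEdgeSet {e | ω e} :=
  measurable_of_countable _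

instance (C : Finset (Fin n)) (p q : unitInterval) : IsProbabilityMeasure (plantedGraph C p q) :=
  Measure.isProbabilityMeasure_map measurable_coins.aemeasurable

/-- The pairs of vertices that are inspected when the neighborhood of `r` is explored. -/
def inspected {t : ℕ} (r : Fin n) (x : TreeObs n t) : Finset (Sym2 (Fin n)) :=
  ((verts t r x ×ˢ verts t r x) ∪ (innerVerts t r x ×ˢ Finset.univ)).image fun a => s(a.1, a.2)

open Classical in
lemma le_plantedGraph_treeEvent (C : Finset (Fin n)) (p q : unitInterval) {t : ℕ} {r : Fin n}
    {x : TreeObs n t} (hg : Good t r x) :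
    (∏ e ∈ edges t r x, pairConn (p : ℝ) q C e) *
      ∏ e ∈ inspected r x \ edges t r x, (1 - pairConn (p : ℝ) q C e) ≤
        (plantedGraph C p q).real (treeEvent t r x) := by
  -- A cylinder: tree edges show `True`, the other inspected pairs show `False`, everything else is
  -- free.
  set T : Sym2 (Fin n) → Set Prop := fun e =>
    if e ∈ edges t r x then {True} else if e ∈ inspected r x then {False} else Set.univ with hT
  have hsub : Set.univ.pi T ⊆
      (fun ω : Sym2 (Fin n) → Prop => SimpleGraph.fromEdgeSet {e | ω e}) ⁻¹' treeEvent t r x := by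
    intro ω hω
    rw [Set.mem_univ_pi] at hω
    refine mem_treeEvent hg fun v w hvw h => ?_
    have hM : s(v, w) ∈ inspected r x := by
      refine Finset.mem_image.2 ⟨(v, w), ?_, rfl⟩
      simpa using h
    have := hω s(v, w)
    rw [SimpleGraph.fromEdgeSet_adj]
    by_cases he : s(v, w) ∈ edges t r x
    · simp only [hT, he, if_true, Set.mem_singleton_iff] at this
      simp [this, he, hvw]
    · simp only [hT, he, hM, if_true, if_false, Set.mem_singleton_iff] at this
      simp [this, he]
  rw [plantedGraph, map_measureReal_apply measurable_coins .of_discrete]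
  refine le_trans (le_of_eq ?_) (measureReal_mono hsub)
  rw [measureReal_def, Measure.pi_pi, ENNReal.toReal_prod]
  simp only [← measureReal_def]
  have : ∀ e, (bernoulliMeasure True False (edgeProb C p q e)).real (T e) =
      (if e ∈ edges t r x then pairConn (p : ℝ) q C e else 1) *
        if e ∈ inspected r x \ edges t r x then 1 - pairConn (p : ℝ) q C e else 1 := by
    intro e
    by_cases he : e ∈ edges t r x
    · simp only [hT, he, if_true, Finset.mem_sdiff, not_true, and_false, if_false, mul_one]
      rw [bernoulliMeasure_real_apply_of_mem_of_notMem _ .of_discrete (by simp) (by simp),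
        coe_edgeProb]
    · by_cases hM : e ∈ inspected r x
      · simp only [hT, he, hM, if_true, Finset.mem_sdiff, not_false_iff, and_true, if_false,
          one_mul]
        rw [bernoulliMeasure_real_apply_of_notMem_of_mem _ .of_discrete (by simp) (by simp),
          coe_edgeProb]
      · simp [hT, he, hM]
  simp only [this, Finset.prod_mul_distrib, Finset.prod_ite_mem, Finset.univ_inter]

/-- A reverse of `1 - c ≤ exp (-c)` with quadratic loss, obtained from `c + 1 ≤ exp c`. -/
lemma one_sub_sq_mul_exp_le {c : ℝ} (h1 : c ≤ 1) :
    (1 - c ^ 2) * Real.exp (-c) ≤ 1 - c := by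
  rw [Real.exp_neg, ← div_eq_mul_inv, div_le_iff₀ (Real.exp_pos _)]
  have : (1 - c) * (c + 1) ≤ (1 - c) * Real.exp c :=
    mul_le_mul_of_nonneg_left (Real.add_one_le_exp c) (by linarith)
  nlinarith

lemma sum_conn (p q : ℝ) (b : Bool) (C : Finset (Fin n)) (hn : n ≠ 0) :
    ∑ w, conn p q b (decide (w ∈ C)) = n * meanConn ((C.card : ℝ) / n) p q b := by
  have hn' : (n : ℝ) ≠ 0 := Nat.cast_ne_zero.2 hn
  cases b with
  | false => simp [conn, meanConn]
  | true =>
    have : ∀ w, conn p q true (decide (w ∈ C)) = q + if w ∈ C then p - q else 0 := by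
      intro w
      by_cases h : w ∈ C <;> simp [conn, h]
    simp only [this, Finset.sum_add_distrib, Finset.sum_ite_mem, Finset.univ_inter, meanConn]
    simp
    field_simp

/-- Not being joined to anything, for a given community and for independent random types. -/
lemma le_prod_one_sub_conn {p q : ℝ} (hq : 0 ≤ q) (hqp : q ≤ p) (hp : p ≤ 1) (b : Bool)
    (C : Finset (Fin n)) :
    (1 - p ^ 2) ^ n * (1 - meanConn ((C.card : ℝ) / n) p q b) ^ n ≤
      ∏ w, (1 - conn p q b (decide (w ∈ C))) := by
  rcases eq_or_ne n 0 with rfl | hn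
  · simp
  have hk0 : 0 ≤ (C.card : ℝ) / n := by positivity
  have hk1 : (C.card : ℝ) / n ≤ 1 := by
    rw [div_le_one (by positivity)]
    exact_mod_cast C.card_le_univ.trans (by simp)
  have hm := meanConn_le hk1 hqp b
  have hp2 : 0 ≤ 1 - p ^ 2 := by nlinarith
  calc (1 - p ^ 2) ^ n * (1 - meanConn ((C.card : ℝ) / n) p q b) ^ n
      ≤ (1 - p ^ 2) ^ n * Real.exp (-meanConn ((C.card : ℝ) / n) p q b) ^ n := by
        refine mul_le_mul_of_nonneg_left (pow_le_pow_left₀ (by linarith) ?_ n)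
          (pow_nonneg hp2 n)
        exact Real.one_sub_le_exp_neg _
    -- In exponential form the product depends only on the sum of the connection probabilities, and
    -- that sum equals `n * meanConn` because the prior is exactly the density of `C`.
    _ = ∏ w : Fin n, ((1 - p ^ 2) * Real.exp (-conn p q b (decide (w ∈ C)))) := by
        rw [Finset.prod_mul_distrib, ← Real.exp_sum, Finset.sum_neg_distrib, sum_conn _ _ _ _ hn,
          ← Real.exp_nat_mul]
        simp
    _ ≤ _ := by
        refine Finset.prod_le_prod (fun w _ => mul_nonneg hp2 (Real.exp_nonneg _)) fun w _ => ?_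
        have h1 := conn_nonneg hq hqp b (decide (w ∈ C))
        have h2 := conn_le hqp b (decide (w ∈ C))
        refine le_trans (mul_le_mul_of_nonneg_right ?_ (Real.exp_nonneg _))
          (one_sub_sq_mul_exp_le (h2.trans hp))
        nlinarith

/-- The probability of an observation in the planted model with a given community. -/
lemma le_plantedGraph_treeEvent_of_card (C : Finset (Fin n)) {p q : unitInterval} (hqp : q ≤ p)
    {t : ℕ} {r : Fin n} {x : TreeObs n t} (hg : Good t r x) :
    (1 - (p : ℝ)) ^ (size t x ^ 2) * ((1 - (p : ℝ) ^ 2) ^ n) ^ size t x *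
      ((∏ e ∈ edges t r x, pairConn (p : ℝ) q C e) *
        ∏ v ∈ innerVerts t r x, (1 - meanConn ((C.card : ℝ) / n) p q (decide (v ∈ C))) ^ n) ≤
      (plantedGraph C p q).real (treeEvent t r x) := by
  have hq0 : 0 ≤ (q : ℝ) := q.2.1
  have hp1 : (p : ℝ) ≤ 1 := p.2.2
  have hqp' : (q : ℝ) ≤ p := hqp
  have hp0 := hq0.trans hqp'
  have hk1 : (C.card : ℝ) / n ≤ 1 := div_le_one_of_le₀
    (by exact_mod_cast C.card_le_univ.trans (by simp)) (Nat.cast_nonneg _)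
  set f : Sym2 (Fin n) → ℝ := fun e => 1 - pairConn (p : ℝ) q C e with hf
  have hfp : ∀ e, 1 - (p : ℝ) ≤ f e := fun e => by
    have := pairConn_le hqp' C e
    simp only [hf]; linarith
  have hf0 : ∀ e, 0 ≤ f e := fun e => by have := hfp e; linarith
  have hf1 : ∀ e, f e ≤ 1 := fun e => by
    have := pairConn_nonneg hq0 hqp' C e
    simp only [hf]; linarith
  have hp2 : 0 ≤ 1 - (p : ℝ) ^ 2 := by nlinarith
  have hp2' : 1 - (p : ℝ) ^ 2 ≤ 1 := by nlinarith
  -- Pairs inside the vertex set and pairs at inner vertices are bounded separately, although they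
  -- overlap and include tree edges; surplus factors at most `1` only weaken the lower bound.
  have h1 : (1 - (p : ℝ)) ^ (size t x ^ 2) ≤
      ∏ a ∈ verts t r x ×ˢ verts t r x, f s(a.1, a.2) := by
    calc (1 - (p : ℝ)) ^ (size t x ^ 2)
        ≤ (1 - (p : ℝ)) ^ (verts t r x ×ˢ verts t r x).card := by
          refine pow_le_pow_of_le_one (by linarith) (by linarith) ?_
          rw [Finset.card_product, ← sq]
          exact Nat.pow_le_pow_left (card_verts_le t r x) 2
      _ = ∏ a ∈ verts t r x ×ˢ verts t r x, (1 - (p : ℝ)) := by simp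
      _ ≤ _ := Finset.prod_le_prod (fun _ _ => by linarith) fun a _ => hfp _
  have h2 : ((1 - (p : ℝ) ^ 2) ^ n) ^ size t x *
      ∏ v ∈ innerVerts t r x, (1 - meanConn ((C.card : ℝ) / n) p q (decide (v ∈ C))) ^ n ≤
      ∏ a ∈ innerVerts t r x ×ˢ Finset.univ, f s(a.1, a.2) := by
    rw [Finset.prod_product]
    calc _ ≤ ((1 - (p : ℝ) ^ 2) ^ n) ^ (innerVerts t r x).card *
          ∏ v ∈ innerVerts t r x, (1 - meanConn ((C.card : ℝ) / n) p q (decide (v ∈ C))) ^ n := by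
          refine mul_le_mul_of_nonneg_right (pow_le_pow_of_le_one (by positivity)
            (pow_le_one₀ hp2 hp2') ((Finset.card_le_card
              (innerVerts_subset_verts t r x)).trans (card_verts_le t r x)))
            (Finset.prod_nonneg fun v _ => pow_nonneg ?_ n)
          linarith [meanConn_le hk1 hqp' (decide (v ∈ C))]
      _ = ∏ v ∈ innerVerts t r x, ((1 - (p : ℝ) ^ 2) ^ n *
          (1 - meanConn ((C.card : ℝ) / n) p q (decide (v ∈ C))) ^ n) := by
          rw [Finset.prod_mul_distrib, Finset.prod_const]
      _ ≤ _ := by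
          refine Finset.prod_le_prod (fun v _ => mul_nonneg (pow_nonneg hp2 n) (pow_nonneg ?_ n))
            fun v _ => ?_
          · linarith [meanConn_le hk1 hqp' (decide (v ∈ C))]
          · refine (le_prod_one_sub_conn hq0 hqp' hp1 _ C).trans (le_of_eq ?_)
            exact Finset.prod_congr rfl fun w _ => by
              simp only [hf]; rw [pairConn_mk]
  have h3 := mul_le_mul h1 h2 (mul_nonneg (by positivity) (Finset.prod_nonneg fun v _ =>
      pow_nonneg (by linarith [meanConn_le hk1 hqp' (decide (v ∈ C))]) n))
    (Finset.prod_nonneg fun a _ => hf0 _)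
  have h4 := prod_mul_prod_le_prod_union (verts t r x ×ˢ verts t r x)
    (innerVerts t r x ×ˢ Finset.univ) (f := fun a => f s(a.1, a.2)) (fun _ => hf0 _)
    fun _ => hf1 _
  have h5 := prod_le_prod_image ((verts t r x ×ˢ verts t r x) ∪
    (innerVerts t r x ×ˢ Finset.univ)) (fun a => s(a.1, a.2)) hf0 hf1
  have h6 : ∏ e ∈ inspected r x, f e ≤ ∏ e ∈ inspected r x \ edges t r x, f e :=
    prod_le_prod_of_subset Finset.sdiff_subset hf0 hf1
  have h7 := ((h3.trans h4).trans h5).trans h6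
  have h8 := mul_le_mul_of_nonneg_left h7
    (Finset.prod_nonneg fun e (_ : e ∈ edges t r x) => pairConn_nonneg hq0 hqp' C e)
  refine le_trans (le_of_eq ?_) (h8.trans (le_plantedGraph_treeEvent C p q hg))
  ring

end Graph

/-! ### Uniform sets of size `K` against independent draws -/

section Hypergeometric

/-- Each removal of an element changes the binomial coefficient by a ratio `K' / n'` with `K' ≥ c`
and `n' ≤ m`. Free `c` and `m` let the induction keep one common lower bound for all ratios. -/
lemma choose_mul_pow_le : ∀ (a : ℕ) {n K : ℕ} {c m : ℝ}, a ≤ K → K ≤ n → 0 ≤ c → c + a ≤ K →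
    (n : ℝ) ≤ m → 0 < m → (n.choose K : ℝ) * (c / m) ^ a ≤ ((n - a).choose (K - a) : ℝ)
  | 0, n, K, c, m, _, _, _, _, _, _ => by simp
  | a + 1, 0, K, c, m, ha, hK, _, _, _, _ => by omega
  | a + 1, n + 1, 0, c, m, ha, hK, _, _, _, _ => by omega
  | a + 1, n + 1, K + 1, c, m, ha, hK, hc, hcK, hm, hm0 => by
    have ih := choose_mul_pow_le a (n := n) (K := K) (c := c) (m := m) (by omega) (by omega) hc
      (by push_cast at hcK; linarith) (by push_cast at hm; linarith) hm0
    have h1 : ((n : ℝ) + 1) * n.choose K = (n + 1).choose (K + 1) * ((K : ℝ) + 1) := by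
      exact_mod_cast Nat.add_one_mul_choose_eq n K
    have h2 : ((n + 1).choose (K + 1) : ℝ) * (c / m) ≤ n.choose K := by
      rw [mul_div_assoc', div_le_iff₀ hm0]
      have hcK' : c ≤ (K : ℝ) + 1 := by push_cast at hcK; have : (0 : ℝ) ≤ a := by positivity
                                        linarith
      calc ((n + 1).choose (K + 1) : ℝ) * c ≤ (n + 1).choose (K + 1) * ((K : ℝ) + 1) := by gcongr
        _ = ((n : ℝ) + 1) * n.choose K := h1.symm
        _ ≤ m * n.choose K := by
            push_cast at hm; gcongr
        _ = _ := mul_comm _ _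
    have h3 : n + 1 - (a + 1) = n - a := by omega
    have h4 : K + 1 - (a + 1) = K - a := by omega
    rw [h3, h4, pow_succ]
    calc ((n + 1).choose (K + 1) : ℝ) * ((c / m) ^ a * (c / m))
        = ((n + 1).choose (K + 1) : ℝ) * (c / m) * (c / m) ^ a := by ring
      _ ≤ n.choose K * (c / m) ^ a := by gcongr
      _ ≤ _ := ih

lemma one_sub_sq_div_le_pow {a : ℕ} {x : ℝ} (hx : a ≤ x) (hx0 : 0 < x) :
    1 - (a : ℝ) ^ 2 / x ≤ (1 - a / x) ^ a := by
  have h1 : (a : ℝ) / x ≤ 1 := (div_le_one hx0).2 hx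
  have := one_add_mul_le_pow (a := -((a : ℝ) / x)) (by linarith) a
  calc 1 - (a : ℝ) ^ 2 / x = 1 + a * -((a : ℝ) / x) := by ring
    _ ≤ _ := this
    _ = _ := by ring

lemma le_choose_sub {n K a b : ℕ} (haK : a ≤ K) (hbK : b ≤ n - K) (hK : 0 < K) (hKn : K < n) :
    (n.choose K : ℝ) * ((((K : ℝ) / n) ^ a * (1 - a / K) ^ a) *
      ((1 - (K : ℝ) / n) ^ b * (1 - b / ((n : ℝ) - K)) ^ b)) ≤
      ((n - (a + b)).choose (K - a) : ℝ) := by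
  have hn0 : (0 : ℝ) < n := by exact_mod_cast hK.trans hKn
  have hK0 : (0 : ℝ) < K := by exact_mod_cast hK
  have hKn' : (0 : ℝ) < (n : ℝ) - K := by rw [sub_pos]; exact_mod_cast hKn
  have haK' : (a : ℝ) ≤ K := by exact_mod_cast haK
  have hbK' : (b : ℝ) ≤ (n : ℝ) - K := by
    rw [← Nat.cast_sub hKn.le]; exact_mod_cast hbK
  have h1 := choose_mul_pow_le a (n := n) (K := K) (c := K - a) (m := n) haK hKn.le
    (by linarith) (by linarith) le_rfl hn0
  -- The `b` elements kept out of the community are removed from the complement, by the symmetry of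
  -- binomial coefficients.
  have h2 := choose_mul_pow_le b (n := n - a) (K := n - K) (c := (n : ℝ) - K - b) (m := n) hbK
    (by omega) (by linarith) (by rw [Nat.cast_sub hKn.le]; linarith)
    (by exact_mod_cast Nat.sub_le n a) hn0
  have e1 : (n - a).choose (n - K) = (n - a).choose (K - a) := by
    rw [← Nat.choose_symm (by omega : n - K ≤ n - a)]
    congr 1; omega
  have e2 : (n - a - b).choose (n - K - b) = (n - (a + b)).choose (K - a) := by
    rw [← Nat.choose_symm (by omega : n - K - b ≤ n - a - b)]
    congr 1 <;> omega
  rw [e1, e2] at h2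
  have e3 : ((K : ℝ) / n) ^ a * (1 - a / K) ^ a = (((K : ℝ) - a) / n) ^ a := by
    rw [← mul_pow]; congr 1; field_simp
  have e4 : (1 - (K : ℝ) / n) ^ b * (1 - b / ((n : ℝ) - K)) ^ b = (((n : ℝ) - K - b) / n) ^ b := by
    rw [← mul_pow]; congr 1; field_simp
  rw [e3, e4, ← mul_assoc]
  refine le_trans (mul_le_mul_of_nonneg_right h1 (pow_nonneg (div_nonneg ?_ hn0.le) b)) h2
  linarith

lemma card_filter_inter_eq {n K : ℕ} {S A : Finset (Fin n)} (hA : A ⊆ S) (hAK : A.card ≤ K) :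
    (n - S.card).choose (K - A.card) ≤
      ((Finset.powersetCard K (Finset.univ : Finset (Fin n))).filter fun C => C ∩ S = A).card := by
  have h1 : (n - S.card).choose (K - A.card) =
      (Finset.powersetCard (K - A.card) (Finset.univ \ S)).card := by
    rw [Finset.card_powersetCard, Finset.card_univ_sdiff, Fintype.card_fin]
  rw [h1]
  refine Finset.card_le_card_of_injOn (fun D => A ∪ D) ?_ ?_
  · intro D hD
    obtain ⟨hD1, hD2⟩ := Finset.mem_powersetCard.1 hD
    have hDS : Disjoint D S := (Finset.disjoint_sdiff.mono_right hD1).symm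
    have hAD : Disjoint A D := (hDS.mono_right hA).symm
    refine Finset.mem_coe.2 (Finset.mem_filter.2 ⟨Finset.mem_powersetCard.2
      ⟨Finset.subset_univ _, ?_⟩, ?_⟩)
    · rw [Finset.card_union_of_disjoint hAD, hD2]; omega
    · rw [Finset.union_inter_distrib_right, Finset.inter_eq_left.2 hA,
        Finset.disjoint_iff_inter_eq_empty.1 hDS, Finset.union_empty]
  · intro D hD D' hD' h
    have hd : ∀ {D}, D ∈ Finset.powersetCard (K - A.card) (Finset.univ \ S) → Disjoint A D :=
      fun {D} hD => (Finset.disjoint_sdiff.mono_right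
        (Finset.mem_powersetCard.1 hD).1).mono_left hA
    have h' : A ∪ D = A ∪ D' := h
    rw [← Finset.union_sdiff_cancel_left (hd hD), h', Finset.union_sdiff_cancel_left (hd hD')]

lemma prod_prior_eq {n : ℕ} {S A : Finset (Fin n)} (hA : A ⊆ S) (k : ℝ) :
    ∏ v ∈ S, prior k (decide (v ∈ A)) = k ^ A.card * (1 - k) ^ (S \ A).card := by
  rw [← Finset.prod_sdiff hA, mul_comm]
  congr 1
  · rw [← Finset.prod_const]
    exact Finset.prod_congr rfl fun v hv => by simp [prior, hv]
  · rw [← Finset.prod_const]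
    exact Finset.prod_congr rfl fun v hv => by simp [prior, (Finset.mem_sdiff.1 hv).2]

/-- Drawing a uniform set of size `K`, compared with independent draws. -/
lemma le_card_filter_inter_div {n K s : ℕ} {S A : Finset (Fin n)} (hA : A ⊆ S) (hK : 0 < K)
    (hKn : K < n) (hs : S.card ≤ s) :
    (1 - (s : ℝ) ^ 2 / K - (s : ℝ) ^ 2 / ((n : ℝ) - K)) *
      ∏ v ∈ S, prior ((K : ℝ) / n) (decide (v ∈ A)) ≤
    (n.choose K : ℝ)⁻¹ *
      ((Finset.powersetCard K (Finset.univ : Finset (Fin n))).filter fun C => C ∩ S = A).card := by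
  have hn0 : (0 : ℝ) < n := by exact_mod_cast hK.trans hKn
  have hK0 : (0 : ℝ) < K := by exact_mod_cast hK
  have hKn' : (0 : ℝ) < (n : ℝ) - K := by rw [sub_pos]; exact_mod_cast hKn
  have hk0 : 0 ≤ (K : ℝ) / n := by positivity
  have hk1 : 0 ≤ 1 - (K : ℝ) / n := by
    rw [sub_nonneg, div_le_one hn0]; exact_mod_cast hKn.le
  have hpr : 0 ≤ ∏ v ∈ S, prior ((K : ℝ) / n) (decide (v ∈ A)) :=
    Finset.prod_nonneg fun v _ => prior_nonneg hk0 (by linarith) _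
  -- A nonpositive factor makes the claim trivial. Otherwise `s ^ 2 < K` and `s ^ 2 < n - K`, which
  -- rules out truncation in the subtractions below.
  rcases le_or_gt (1 - (s : ℝ) ^ 2 / K - (s : ℝ) ^ 2 / ((n : ℝ) - K)) 0 with h | h
  · exact (mul_nonpos_of_nonpos_of_nonneg h hpr).trans (by positivity)
  have hs1 : (s : ℝ) ^ 2 / K < 1 := by
    have : 0 ≤ (s : ℝ) ^ 2 / ((n : ℝ) - K) := by positivity
    linarith
  have hs2 : (s : ℝ) ^ 2 / ((n : ℝ) - K) < 1 := by
    have : 0 ≤ (s : ℝ) ^ 2 / K := by positivity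
    linarith
  rw [div_lt_one hK0] at hs1
  rw [div_lt_one hKn'] at hs2
  set a := A.card
  set b := (S \ A).card
  have hab : a + b = S.card := by
    rw [add_comm]; exact Finset.card_sdiff_add_card_eq_card hA
  have hss : s ≤ s ^ 2 := Nat.le_self_pow two_ne_zero s
  have has : a ≤ s := by omega
  have hbs : b ≤ s := by omega
  have hsK : s < K := by
    have : s ^ 2 < K := by exact_mod_cast hs1
    omega
  have hsn : s < n - K := by
    have : s ^ 2 < n - K := by
      rw [← Nat.cast_sub hKn.le] at hs2; exact_mod_cast hs2
    omega
  have hch : (0 : ℝ) < n.choose K := by exact_mod_cast Nat.choose_pos hKn.le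
  have h1 := le_choose_sub (n := n) (K := K) (a := a) (b := b) (by omega) (by omega) hK hKn
  rw [hab] at h1
  have h2 : ((n - S.card).choose (K - a) : ℝ) ≤
      ((Finset.powersetCard K (Finset.univ : Finset (Fin n))).filter fun C => C ∩ S = A).card := by
    exact_mod_cast card_filter_inter_eq hA (by omega)
  rw [inv_mul_eq_div, le_div_iff₀ hch]
  refine le_trans ?_ (h1.trans h2)
  rw [prod_prior_eq hA]
  have haK : (a : ℝ) ≤ K := by exact_mod_cast (has.trans hsK.le)
  have hbK : (b : ℝ) ≤ (n : ℝ) - K := by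
    rw [← Nat.cast_sub hKn.le]; exact_mod_cast (hbs.trans hsn.le)
  have h3 := one_sub_sq_div_le_pow haK hK0
  have h4 := one_sub_sq_div_le_pow hbK hKn'
  have h3' : (a : ℝ) ^ 2 / K ≤ (s : ℝ) ^ 2 / K := by gcongr
  have h4' : (b : ℝ) ^ 2 / ((n : ℝ) - K) ≤ (s : ℝ) ^ 2 / ((n : ℝ) - K) := by gcongr
  have h5 : (1 - (a : ℝ) / K) ^ a ≤ 1 := pow_le_one₀
    (by rw [sub_nonneg, div_le_one hK0]; exact haK) (by
      have : 0 ≤ (a : ℝ) / K := by positivity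
      linarith)
  have h6 : (1 - (b : ℝ) / ((n : ℝ) - K)) ^ b ≤ 1 := pow_le_one₀
    (by rw [sub_nonneg, div_le_one hKn']; exact hbK) (by
      have : 0 ≤ (b : ℝ) / ((n : ℝ) - K) := by positivity
      linarith)
  have h7 : 1 - (s : ℝ) ^ 2 / K - (s : ℝ) ^ 2 / ((n : ℝ) - K) ≤
      (1 - (a : ℝ) / K) ^ a * (1 - (b : ℝ) / ((n : ℝ) - K)) ^ b := by
    nlinarith [mul_nonneg (sub_nonneg.2 h5) (sub_nonneg.2 h6)]
  calc _ ≤ (1 - (a : ℝ) / K) ^ a * (1 - (b : ℝ) / ((n : ℝ) - K)) ^ b *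
        (((K : ℝ) / n) ^ a * (1 - (K : ℝ) / n) ^ b) * n.choose K := by gcongr
    _ = _ := by ring

end Hypergeometric

/-! ### Comparison of the planted model with the tree, per observation -/

section Combine

variable {n K t : ℕ} {p q : unitInterval}

lemma one_sub_mul_le_pow {x : ℝ} (hx : x ≤ 1) (m : ℕ) :
    1 - m * x ≤ (1 - x) ^ m := by
  have := one_add_mul_le_pow (a := -x) (by linarith) m
  calc 1 - m * x = 1 + m * -x := by ring
    _ ≤ _ := this
    _ = _ := by ring

/-- The relative error in the comparison of the planted model with the idealized tree, per squared
number of vertices. -/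
def compareError (n K : ℕ) (p : ℝ) : ℝ :=
  2 * p + n * p ^ 2 + 1 / K + 1 / ((n : ℝ) - K)

/-- Bernoulli's inequality for each factor, then `x + y - 1 ≤ x * y` for numbers at most `1`; `N ≤ N
^ 2` brings all losses to the same form. The maximum with `0` keeps the product monotone in its
other factors. -/
lemma one_sub_le_factor {N : ℕ} (hN : 1 ≤ N) {P : ℝ} (hP0 : 0 ≤ P) (hP1 : P ≤ 1) (hK : 0 < K)
    (hKn : K < n) :
    1 - (N : ℝ) ^ 2 * compareError n K P ≤
      (1 - P) ^ N * ((1 - P) ^ (N ^ 2) * ((1 - P ^ 2) ^ n) ^ N) *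
        max (1 - (N : ℝ) ^ 2 / K - (N : ℝ) ^ 2 / ((n : ℝ) - K)) 0 := by
  have hK0 : (0 : ℝ) < K := by exact_mod_cast hK
  have hKn' : (0 : ℝ) < (n : ℝ) - K := by rw [sub_pos]; exact_mod_cast hKn
  have hP2 : P ^ 2 ≤ 1 := pow_le_one₀ hP0 hP1
  have hN1 : (1 : ℝ) ≤ N := by exact_mod_cast hN
  have hNN : (N : ℝ) ≤ (N : ℝ) ^ 2 := by nlinarith
  have e1 := one_sub_mul_le_pow hP1 N
  have e2 := one_sub_mul_le_pow hP1 (N ^ 2)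
  have e3 := one_sub_mul_le_pow hP2 (n * N)
  rw [pow_mul] at e3
  push_cast at e2 e3
  have e4 := le_max_left (1 - (N : ℝ) ^ 2 / K - (N : ℝ) ^ 2 / ((n : ℝ) - K)) 0
  have b1 : (1 - P) ^ N ≤ 1 := pow_le_one₀ (by linarith) (by linarith)
  have b2 : (1 - P) ^ (N ^ 2) ≤ 1 := pow_le_one₀ (by linarith) (by linarith)
  have b0 : (1 - P ^ 2) ^ n ≤ 1 := pow_le_one₀ (by linarith) (by nlinarith)
  have b00 : 0 ≤ (1 - P ^ 2) ^ n := pow_nonneg (by linarith) _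
  have b3 : ((1 - P ^ 2) ^ n) ^ N ≤ 1 := pow_le_one₀ b00 b0
  have b4 : max (1 - (N : ℝ) ^ 2 / K - (N : ℝ) ^ 2 / ((n : ℝ) - K)) 0 ≤ 1 := by
    refine max_le ?_ zero_le_one
    have : 0 ≤ (N : ℝ) ^ 2 / K := by positivity
    have : 0 ≤ (N : ℝ) ^ 2 / ((n : ℝ) - K) := by positivity
    linarith
  have c1 : 0 ≤ (1 - P) ^ N := pow_nonneg (by linarith) _
  have c2 : 0 ≤ (1 - P) ^ (N ^ 2) := pow_nonneg (by linarith) _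
  have c3 : 0 ≤ ((1 - P ^ 2) ^ n) ^ N := pow_nonneg b00 _
  have key : ∀ {x y : ℝ}, x ≤ 1 → y ≤ 1 → x + y - 1 ≤ x * y := fun {x y} hx hy => by
    nlinarith [mul_nonneg (sub_nonneg.2 hx) (sub_nonneg.2 hy)]
  have k1 := key b2 b3
  have k2 := key b1 (mul_le_one₀ b2 c3 b3)
  have k3 := key (mul_le_one₀ b1 (mul_nonneg c2 c3) (mul_le_one₀ b2 c3 b3)) b4
  have f1 : (n : ℝ) * N * P ^ 2 ≤ (N : ℝ) ^ 2 * (n * P ^ 2) := by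
    have : 0 ≤ (n : ℝ) * P ^ 2 := by positivity
    nlinarith
  have f2 : N * P ≤ (N : ℝ) ^ 2 * P := by gcongr
  have f3 : (N : ℝ) ^ 2 * compareError n K P = (N : ℝ) ^ 2 * P + (N : ℝ) ^ 2 * P +
      (N : ℝ) ^ 2 * (n * P ^ 2) + (N : ℝ) ^ 2 / K + (N : ℝ) ^ 2 / ((n : ℝ) - K) := by
    unfold compareError; ring
  rw [f3]
  linarith

lemma one_le_size : ∀ (t : ℕ) (x : TreeObs n t), 1 ≤ size t x
  | 0, _ => le_rfl
  | _ + 1, _ => Nat.le_add_right _ _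

/-- The probability of an observation with distinct labels in the planted model is not much smaller
than in the idealized tree. -/
lemma obsWeight_le_sum_plantedGraph (hqp : q ≤ p) (hK : 0 < K) (hKn : K < n) (b : Bool) {r : Fin n}
    {x : TreeObs n t} (hg : Good t r x) :
    (1 - (size t x : ℝ) ^ 2 * compareError n K p) *
      (prior ((K : ℝ) / n) b * obsWeight ((K : ℝ) / n) p q t b x) ≤
    ∑ C ∈ Finset.powersetCard K (Finset.univ : Finset (Fin n)) with decide (r ∈ C) = b,
      (n.choose K : ℝ)⁻¹ * (plantedGraph C p q).real (treeEvent t r x) := by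
  have hq0 : 0 ≤ (q : ℝ) := q.2.1
  have hp1 : (p : ℝ) ≤ 1 := p.2.2
  have hqp' : (q : ℝ) ≤ p := hqp
  have hp0 := hq0.trans hqp'
  have hn0 : (0 : ℝ) < n := by exact_mod_cast hK.trans hKn
  set k : ℝ := (K : ℝ) / n with hk
  have hk0 : 0 ≤ k := by positivity
  have hk1 : k ≤ 1 := by rw [hk, div_le_one hn0]; exact_mod_cast hKn.le
  set N := size t x with hN
  set S := verts t r x with hS
  set c1 := (1 - (p : ℝ)) ^ (N ^ 2) * ((1 - (p : ℝ) ^ 2) ^ n) ^ N with hc1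
  set h := max (1 - (N : ℝ) ^ 2 / K - (N : ℝ) ^ 2 / ((n : ℝ) - K)) 0 with hh
  have hP2 : (p : ℝ) ^ 2 ≤ 1 := pow_le_one₀ hp0 hp1
  have hc10 : 0 ≤ c1 := mul_nonneg (pow_nonneg (by linarith) _)
    (pow_nonneg (pow_nonneg (by linarith) _) _)
  have hh0 : 0 ≤ h := le_max_right _ _
  have hp1' : 0 ≤ (1 - (p : ℝ)) ^ N := pow_nonneg (by linarith) _
  have hobs : 0 ≤ prior k b * obsWeight k p q t b x :=
    mul_nonneg (prior_nonneg hk0 hk1 b) (obsWeight_nonneg hk0 hk1 hq0 hqp' hp1 t b x)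
  refine (mul_le_mul_of_nonneg_right
    (one_sub_le_factor (one_le_size t x) hp0 hp1 hK hKn) hobs).trans ?_
  rw [← hc1, ← hh]
  refine (mul_le_mul_of_nonneg_left (prior_mul_obsWeight_le hk0 hk1 hq0 hqp' hp1 t b r x hg)
    (mul_nonneg (mul_nonneg hp1' hc10) hh0)).trans ?_
  -- Communities are grouped by their trace on the vertices of the observation. Edges and inner
  -- vertices see the community only through this trace, so the lower bound used is constant on each
  -- group.
  rw [← Finset.sum_fiberwise_of_maps_to (g := fun C => C ∩ S)
    (s := (Finset.powersetCard K (Finset.univ : Finset (Fin n))).filter fun C => decide (r ∈ C) = b)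
    (t := S.powerset.filter fun A => decide (r ∈ A) = b)]
  · rw [Finset.mul_sum]
    refine Finset.sum_le_sum fun A hA => ?_
    obtain ⟨hAS, hAb⟩ := Finset.mem_filter.1 hA
    rw [Finset.mem_powerset] at hAS
    have hfib : ((Finset.powersetCard K (Finset.univ : Finset (Fin n))).filter
        fun C => decide (r ∈ C) = b).filter (fun C => C ∩ S = A) =
        (Finset.powersetCard K (Finset.univ : Finset (Fin n))).filter fun C => C ∩ S = A := by
      rw [Finset.filter_filter]
      refine Finset.filter_congr fun C _ => ⟨fun h => h.2, fun h => ⟨?_, h⟩⟩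
      rw [← hAb, ← h]
      simp [hS, mem_verts_root]
    rw [hfib]
    set R := (∏ e ∈ edges t r x, pairConn (p : ℝ) q A e) *
        ∏ v ∈ innerVerts t r x, (1 - meanConn k p q (decide (v ∈ A))) ^ n with hR
    have hR0 : 0 ≤ R := mul_nonneg (Finset.prod_nonneg fun e _ => pairConn_nonneg hq0 hqp' A e)
      (Finset.prod_nonneg fun v _ => pow_nonneg
        (by linarith [meanConn_le hk1 hqp' (decide (v ∈ A))]) n)
    have hC : ∀ C ∈ (Finset.powersetCard K (Finset.univ : Finset (Fin n))).filter
        (fun C => C ∩ S = A), (n.choose K : ℝ)⁻¹ * (c1 * R) ≤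
          (n.choose K : ℝ)⁻¹ * (plantedGraph C p q).real (treeEvent t r x) := by
      intro C hC
      obtain ⟨hCK, hCA⟩ := Finset.mem_filter.1 hC
      have hcard := (Finset.mem_powersetCard.1 hCK).2
      have hmem : ∀ v ∈ S, (v ∈ A ↔ v ∈ C) := fun v hv => by
        rw [← hCA, Finset.mem_inter]; exact and_iff_left hv
      refine mul_le_mul_of_nonneg_left ?_ (by positivity)
      refine le_trans (le_of_eq ?_) (le_plantedGraph_treeEvent_of_card C hqp hg)
      rw [hcard, ← hk, hR]
      congr 2
      · refine Finset.prod_congr rfl fun e he => ?_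
        have : (∀ v ∈ e, v ∈ A) ↔ ∀ v ∈ e, v ∈ C := forall₂_congr fun v hv =>
          hmem v (mem_verts_of_mem_edges t r x e he v hv)
        simp only [pairConn, this]
      · refine Finset.prod_congr rfl fun v hv => ?_
        have : decide (v ∈ A) = decide (v ∈ C) := by
          simp [hmem v (innerVerts_subset_verts t r x hv)]
        rw [this]
    refine le_trans ?_ (Finset.sum_le_sum hC)
    rw [Finset.sum_const, nsmul_eq_mul]
    set M := ((Finset.powersetCard K (Finset.univ : Finset (Fin n))).filter
      fun C => C ∩ S = A).card
    have hM : h * ∏ v ∈ S, prior k (decide (v ∈ A)) ≤ (n.choose K : ℝ)⁻¹ * M := by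
      rw [hh, max_mul_of_nonneg _ _ (Finset.prod_nonneg fun v _ => prior_nonneg hk0 hk1 _)]
      refine max_le (le_card_filter_inter_div hAS hK hKn (card_verts_le t r x)) ?_
      rw [zero_mul]; positivity
    have hw := pow_size_mul_assignWeight_le hk0 hk1 hq0 hqp' hp1 A t r x hg
    have hpr : 0 ≤ ∏ v ∈ S, prior k (decide (v ∈ A)) :=
      Finset.prod_nonneg fun v _ => prior_nonneg hk0 hk1 _
    have hw' : (1 - (p : ℝ)) ^ N * assignWeight k p q A t r x ≤
        (∏ v ∈ S, prior k (decide (v ∈ A))) * R := by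
      refine hw.trans ?_
      rw [mul_assoc (∏ v ∈ S, prior k (decide (v ∈ A)))]
      exact mul_le_of_le_one_left (mul_nonneg hpr hR0) (by linarith)
    calc _ = c1 * h * ((1 - (p : ℝ)) ^ N * assignWeight k p q A t r x) := by ring
      _ ≤ c1 * h * ((∏ v ∈ S, prior k (decide (v ∈ A))) * R) :=
          mul_le_mul_of_nonneg_left hw' (mul_nonneg hc10 hh0)
      _ = c1 * R * (h * ∏ v ∈ S, prior k (decide (v ∈ A))) := by ring
      _ ≤ c1 * R * ((n.choose K : ℝ)⁻¹ * M) :=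
          mul_le_mul_of_nonneg_left hM (mul_nonneg hc10 hR0)
      _ = _ := by ring
  · intro C hC
    refine Finset.mem_filter.2 ⟨Finset.mem_powerset.2 Finset.inter_subset_right, ?_⟩
    rw [← (Finset.mem_filter.1 hC).2]
    simp [hS, mem_verts_root]

end Combine

/-! ### Events implied by observations -/

section FixedRule

variable {n K t : ℕ} {p q : unitInterval}

lemma sum_prior_powersetCard (hK : 0 < K) (hKn : K < n) (b : Bool) (r : Fin n) :
    ∑ C ∈ Finset.powersetCard K (Finset.univ : Finset (Fin n)) with decide (r ∈ C) = b,
      (n.choose K : ℝ)⁻¹ = prior ((K : ℝ) / n) b := by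
  have hn0 : (n : ℝ) ≠ 0 := by exact_mod_cast (hK.trans hKn).ne'
  have hch : (n.choose K : ℝ) ≠ 0 := by exact_mod_cast (Nat.choose_pos hKn.le).ne'
  have hfalse : ((Finset.powersetCard K (Finset.univ : Finset (Fin n))).filter
      fun C => r ∉ C).card = (n - 1).choose K := by
    have : (Finset.powersetCard K (Finset.univ : Finset (Fin n))).filter (fun C => r ∉ C) =
        Finset.powersetCard K (Finset.univ.erase r) := by
      ext C
      simp only [Finset.mem_filter, Finset.mem_powersetCard, Finset.subset_univ, true_and,
        Finset.subset_erase]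
      exact and_comm
    rw [this, Finset.card_powersetCard, Finset.card_erase_of_mem (Finset.mem_univ _),
      Finset.card_univ, Fintype.card_fin]
  have hmul : ((n - 1).choose K : ℝ) * n = n.choose K * ((n : ℝ) - K) := by
    obtain ⟨m, rfl⟩ : ∃ m, n = m + 1 := ⟨n - 1, by omega⟩
    rw [← Nat.cast_sub hKn.le]
    exact_mod_cast Nat.choose_mul_succ_eq m K
  have htot := Finset.card_filter_add_card_filter_not
    (s := Finset.powersetCard K (Finset.univ : Finset (Fin n))) (fun C => r ∉ C)
  rw [Finset.card_powersetCard, Finset.card_univ, Fintype.card_fin, hfalse] at htot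
  have hf : ((n - 1).choose K : ℝ) * (n.choose K : ℝ)⁻¹ = 1 - (K : ℝ) / n := by
    field_simp; exact hmul
  cases b with
  | false =>
    simp only [decide_eq_false_iff_not, Finset.sum_const, hfalse, nsmul_eq_mul, prior]
    simpa using hf
  | true =>
    simp only [decide_eq_true_eq, Finset.sum_const, nsmul_eq_mul, prior, if_true]
    simp only [not_not] at htot
    have h2 : ((n - 1).choose K : ℝ) + (((Finset.powersetCard K
        (Finset.univ : Finset (Fin n))).filter fun C => r ∈ C).card : ℝ) = n.choose K := by
      exact_mod_cast htot
    rw [← eq_sub_iff_add_eq'] at h2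
    rw [h2, sub_mul, hf, mul_inv_cancel₀ hch]
    ring

/-- The total error in the comparison of the planted model with the idealized tree. -/
def totalError (n K t : ℕ) (p : ℝ) : ℝ :=
  if t = 0 then 0 else
    p * (2 + n * p) ^ (2 * t + 2) + compareError n K p * (2 + n * p) ^ (3 * t)

lemma compareError_nonneg {P : ℝ} (hP : 0 ≤ P) (hKn : K < n) : 0 ≤ compareError n K P := by
  have hKn' : (0 : ℝ) < (n : ℝ) - K := by rw [sub_pos]; exact_mod_cast hKn
  unfold compareError; positivity

lemma totalError_nonneg {P : ℝ} (hP : 0 ≤ P) (hKn : K < n) : 0 ≤ totalError n K t P := by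
  unfold totalError
  have := compareError_nonneg hP hKn
  split_ifs <;> positivity

lemma measureReal_sum_le {α ι : Type} [MeasurableSpace α] (μ : Measure α) [IsFiniteMeasure μ]
    [DiscreteMeasurableSpace α] {s : Finset ι} {F : ι → Set α} {T : Set α}
    (hd : ∀ i ∈ s, ∀ j ∈ s, i ≠ j → Disjoint (F i) (F j)) (hT : ∀ i ∈ s, F i ⊆ T) :
    ∑ i ∈ s, μ.real (F i) ≤ μ.real T := by
  rw [← measureReal_biUnion_finset (fun i hi j hj h => hd i hi j hj h) fun _ _ => .of_discrete]
  exact measureReal_mono (Set.iUnion₂_subset hT)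

open Classical in
/-- The probability of an event that is implied by some of the observations. -/
lemma sum_obsWeight_le_sum_plantedGraph (hqp : q ≤ p) (hK : 0 < K) (hKn : K < n) (b : Bool)
    (r : Fin n) {T : Set (SimpleGraph (Fin n))} {Q : TreeObs n t → Prop}
    (hQ : ∀ x, Q x → treeEvent t r x ⊆ T) :
    prior ((K : ℝ) / n) b *
      ((∑ x, if Q x then obsWeight ((K : ℝ) / n) p q t b x else 0) - totalError n K t p) ≤
    ∑ C ∈ Finset.powersetCard K (Finset.univ : Finset (Fin n)) with decide (r ∈ C) = b,
      (n.choose K : ℝ)⁻¹ * (plantedGraph C p q).real T := by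
  have hq0 : 0 ≤ (q : ℝ) := q.2.1
  have hp1 : (p : ℝ) ≤ 1 := p.2.2
  have hqp' : (q : ℝ) ≤ p := hqp
  have hp0 := hq0.trans hqp'
  have hn0 : (0 : ℝ) < n := by exact_mod_cast hK.trans hKn
  set k : ℝ := (K : ℝ) / n with hk
  have hk0 : 0 ≤ k := by positivity
  have hk1 : k ≤ 1 := by rw [hk, div_le_one hn0]; exact_mod_cast hKn.le
  have hpr := prior_nonneg hk0 hk1 b
  have hobs := obsWeight_nonneg (n := n) hk0 hk1 hq0 hqp' hp1 t b
  by_cases ht : t = 0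
  · subst ht
    simp only [totalError, if_true, sub_zero]
    by_cases h : Q ()
    · have hT : T = Set.univ := by
        refine Set.univ_subset_iff.1 (Set.Subset.trans (fun G _ => ?_) (hQ () h))
        exact mem_treeEvent trivial fun v w hvw h => by simp [verts, innerVerts] at h; omega
      rw [hT]
      simp only [probReal_univ, mul_one]
      rw [sum_prior_powersetCard hK hKn]
      refine mul_le_of_le_one_right hpr ?_
      rw [← sum_obsWeight (n := n) (k := k) (p := p) (q := q) 0 b]
      exact Finset.sum_le_sum fun x _ => by
        have := hobs x
        split_ifs <;> linarith
    · have : ∀ x : TreeObs n 0, ¬ Q x := fun _ => h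
      simp only [this, if_false, Finset.sum_const_zero, mul_zero]
      exact Finset.sum_nonneg fun C _ => mul_nonneg (by positivity) measureReal_nonneg
  · have hbad := sum_obsWeight_not_good_le (n := n) hk0 hk1 hq0 hqp' hp1 t b r
    have hsize := mul_le_mul_of_nonneg_left
      (sum_obsWeight_size_sq_le (n := n) hk0 hk1 hq0 hqp' hp1 t b) (compareError_nonneg hp0 hKn)
    simp only [totalError, ht, if_false]
    calc prior k b * ((∑ x, if Q x then obsWeight k p q t b x else 0) -
          (p * (2 + n * p) ^ (2 * t + 2) + compareError n K p * (2 + n * p) ^ (3 * t)))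
        ≤ prior k b * ∑ x, if Q x ∧ Good t r x then
            (1 - (size t x : ℝ) ^ 2 * compareError n K p) * obsWeight k p q t b x else 0 := by
          refine mul_le_mul_of_nonneg_left ?_ hpr
          -- Observations with repeated labels are discarded at the cost of their tree weight, and
          -- the relative loss on the others is enlarged to a sum over all observations; the moment
          -- bounds control both.
          have : ∀ x, (if Q x then obsWeight k p q t b x else 0) -
              (obsWeight k p q t b x * (if Good t r x then 0 else 1) +
              compareError n K p * (obsWeight k p q t b x * (size t x : ℝ) ^ 2)) ≤
              if Q x ∧ Good t r x then
            (1 - (size t x : ℝ) ^ 2 * compareError n K p) * obsWeight k p q t b x else 0 := by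
            intro x
            have h1 := hobs x
            have h2 : 0 ≤ compareError n K p * (obsWeight k p q t b x * (size t x : ℝ) ^ 2) :=
              mul_nonneg (compareError_nonneg hp0 hKn) (by positivity)
            by_cases hx : Q x <;> by_cases hg : Good t r x <;> simp [hx, hg] <;> linarith
          refine le_trans ?_ (Finset.sum_le_sum fun x _ => this x)
          rw [Finset.sum_sub_distrib, Finset.sum_add_distrib, ← Finset.mul_sum]
          linarith
      _ = ∑ x with Q x ∧ Good t r x,
            (1 - (size t x : ℝ) ^ 2 * compareError n K p) * (prior k b * obsWeight k p q t b x) := by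
          rw [Finset.sum_filter, Finset.mul_sum]
          refine Finset.sum_congr rfl fun x _ => ?_
          split_ifs <;> ring
      _ ≤ ∑ x with Q x ∧ Good t r x,
            ∑ C ∈ Finset.powersetCard K (Finset.univ : Finset (Fin n)) with decide (r ∈ C) = b,
              (n.choose K : ℝ)⁻¹ * (plantedGraph C p q).real (treeEvent t r x) :=
          Finset.sum_le_sum fun x hx =>
            obsWeight_le_sum_plantedGraph hqp hK hKn b (Finset.mem_filter.1 hx).2.2
      _ ≤ _ := by
          rw [Finset.sum_comm]
          refine Finset.sum_le_sum fun C _ => ?_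
          rw [← Finset.mul_sum]
          refine mul_le_mul_of_nonneg_left (measureReal_sum_le _
            (fun x _ y _ h => disjoint_treeEvent h)
            fun x hx => hQ x (Finset.mem_filter.1 hx).2.1) (by positivity)

end FixedRule

/-! ### The joint law and conditioning on the seed -/

section Law

variable {n K t : ℕ} {p q : unitInterval}

lemma plantedModel_real_apply (hKn : K < n) (S : Set (Finset (Fin n) × SimpleGraph (Fin n))) :
    (plantedModel n K p q).real S = ∑ C ∈ Finset.powersetCard K (Finset.univ : Finset (Fin n)),
      (n.choose K : ℝ)⁻¹ * (plantedGraph C p q).real {G | (C, G) ∈ S} := by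
  have hch : n.choose K ≠ 0 := (Nat.choose_pos hKn.le).ne'
  rw [measureReal_def, plantedModel, Measure.finsetSum_apply, ENNReal.toReal_sum]
  · refine Finset.sum_congr rfl fun C _ => ?_
    rw [Measure.smul_apply, smul_eq_mul, ENNReal.toReal_mul,
      Measure.map_apply (measurable_of_countable _) .of_discrete]
    simp [measureReal_def]
    left; rfl
  · intro C _
    rw [Measure.smul_apply, smul_eq_mul,
      Measure.map_apply (measurable_of_countable _) .of_discrete]
    exact ENNReal.mul_ne_top (by simpa using hch) (measure_ne_top _ _)

lemma isProbabilityMeasure_plantedModel (hKn : K < n) :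
    IsProbabilityMeasure (plantedModel n K p q) := by
  have hch : (n.choose K : ENNReal) ≠ 0 := by exact_mod_cast (Nat.choose_pos hKn.le).ne'
  constructor
  rw [plantedModel, Measure.finsetSum_apply]
  have : ∀ C : Finset (Fin n), ((n.choose K : ENNReal)⁻¹ • (plantedGraph C p q).map (Prod.mk C)) Set.univ =
      (n.choose K : ENNReal)⁻¹ := by
    intro C
    rw [Measure.smul_apply, Measure.map_apply (measurable_of_countable _) .univ]
    simp
  simp only [this, Finset.sum_const, Finset.card_powersetCard, Finset.card_univ, Fintype.card_fin,
    nsmul_eq_mul]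
  exact ENNReal.mul_inv_cancel hch (ENNReal.natCast_ne_top _)

lemma measurableSet_prod_of_countable {α β : Type*} [MeasurableSpace α] [MeasurableSpace β]
    [Countable α] [MeasurableSingletonClass α] {P : α → β → Prop}
    (h : ∀ a, MeasurableSet {b | P a b}) : MeasurableSet {x : α × β | P x.1 x.2} := by
  have : {x : α × β | P x.1 x.2} = ⋃ a, {a} ×ˢ {b | P a b} := by
    ext ⟨a, b⟩; simp
  rw [this]
  exact MeasurableSet.iUnion fun a => (MeasurableSet.singleton a).prod (h a)

namespace LocalEstimator

variable (E : LocalEstimator.{u} n t)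

lemma measurableSet_mem_est (G : SimpleGraph (Fin n)) (v : Fin n) :
    MeasurableSet {s | v ∈ E.est s G} :=
  (E.measurable_est G) (measurableSet_mem_finset v)

lemma measurableSet_falsePositive (v : Fin n) :
    MeasurableSet {x : (Finset (Fin n) × SimpleGraph (Fin n)) × E.Seed |
      v ∉ x.1.1 ∧ v ∈ E.est x.2 x.1.2} :=
  measurableSet_prod_of_countable (P := fun (a : Finset (Fin n) × SimpleGraph (Fin n)) (s : E.Seed) =>
      v ∉ a.1 ∧ v ∈ E.est s a.2) fun a =>
    (MeasurableSet.const _).inter (E.measurableSet_mem_est a.2 v)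

lemma measurableSet_falseNegative (v : Fin n) :
    MeasurableSet {x : (Finset (Fin n) × SimpleGraph (Fin n)) × E.Seed |
      v ∈ x.1.1 ∧ v ∉ E.est x.2 x.1.2} :=
  measurableSet_prod_of_countable (P := fun (a : Finset (Fin n) × SimpleGraph (Fin n)) (s : E.Seed) =>
      v ∈ a.1 ∧ v ∉ E.est s a.2) fun a =>
    (MeasurableSet.const _).inter (E.measurableSet_mem_est a.2 v).compl

/-- Conditioning on the external randomness. -/
lemma law_real_eq_integral (hKn : K < n)
    {A : Set ((Finset (Fin n) × SimpleGraph (Fin n)) × E.Seed)} (hA : MeasurableSet A) :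
    Integrable (fun s => (plantedModel n K p q).real {a | (a, s) ∈ A}) E.seedLaw ∧
    (E.law K p q).real A = ∫ s, (plantedModel n K p q).real {a | (a, s) ∈ A} ∂E.seedLaw := by
  have := isProbabilityMeasure_plantedModel (p := p) (q := q) hKn
  have hm : Measurable fun s => plantedModel n K p q {a | (a, s) ∈ A} :=
    measurable_measure_prodMk_right hA
  have hl : E.law K p q A = ∫⁻ s, plantedModel n K p q {a | (a, s) ∈ A} ∂E.seedLaw :=
    Measure.prod_apply_symm hA
  have hprob : IsProbabilityMeasure (E.law K p q) := by unfold law; infer_instance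
  constructor
  · refine integrable_toReal_of_lintegral_ne_top hm.aemeasurable ?_
    rw [← hl]; exact measure_ne_top _ _
  · rw [measureReal_def, hl]
    exact (integral_toReal hm.aemeasurable (.of_forall fun s => measure_lt_top _ _)).symm

end LocalEstimator

end Law

/-! ### Error probabilities of a local estimator -/

namespace LocalEstimator

variable {n K t : ℕ} {p q : unitInterval} (E : LocalEstimator.{u} n t)

/-- The event that `v` is wrongly put into the community. -/
def falsePositive (v : Fin n) : Set ((Finset (Fin n) × SimpleGraph (Fin n)) × E.Seed) :=
  {x | v ∉ x.1.1 ∧ v ∈ E.est x.2 x.1.2}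

/-- The event that `v` is wrongly left out of the community. -/
def falseNegative (v : Fin n) : Set ((Finset (Fin n) × SimpleGraph (Fin n)) × E.Seed) :=
  {x | v ∈ x.1.1 ∧ v ∉ E.est x.2 x.1.2}

lemma plantedModel_real_mem (hK : 0 < K) (hKn : K < n) (b : Bool) (v : Fin n) :
    (plantedModel n K p q).real {a | decide (v ∈ a.1) = b} = prior ((K : ℝ) / n) b := by
  rw [plantedModel_real_apply hKn, ← sum_prior_powersetCard hK hKn b v, Finset.sum_filter]
  refine Finset.sum_congr rfl fun C _ => ?_
  by_cases h : decide (v ∈ C) = b <;> simp [h]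

lemma law_real_mem (hK : 0 < K) (hKn : K < n) (b : Bool) (v : Fin n) :
    (E.law K p q).real {x | decide (v ∈ x.1.1) = b} = prior ((K : ℝ) / n) b := by
  have hm : MeasurableSet {x : (Finset (Fin n) × SimpleGraph (Fin n)) × E.Seed |
      decide (v ∈ x.1.1) = b} :=
    measurableSet_prod_of_countable
      (P := fun (a : Finset (Fin n) × SimpleGraph (Fin n)) (_ : E.Seed) => decide (v ∈ a.1) = b)
      fun a => MeasurableSet.const _
  rw [(E.law_real_eq_integral hKn hm).2]
  have : ∀ s : E.Seed, (plantedModel n K p q).real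
      {a | (a, s) ∈ {x : (Finset (Fin n) × SimpleGraph (Fin n)) × E.Seed |
        decide (v ∈ x.1.1) = b}} = prior ((K : ℝ) / n) b := fun s =>
    plantedModel_real_mem hK hKn b v
  simp only [this, integral_const, probReal_univ, one_smul]

lemma errorZero_eq (hK : 0 < K) (hKn : K < n) (v : Fin n) :
    E.errorZero K p q v =
      (1 - (K : ℝ) / n)⁻¹ * (E.law K p q).real (E.falsePositive v) := by
  have h := E.law_real_mem (p := p) (q := q) hK hKn false v
  simp only [decide_eq_false_iff_not, prior, Bool.false_eq_true, if_false] at h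
  have hm : MeasurableSet {x : (Finset (Fin n) × SimpleGraph (Fin n)) × E.Seed | v ∉ x.1.1} :=
    measurableSet_prod_of_countable
      (P := fun (a : Finset (Fin n) × SimpleGraph (Fin n)) (_ : E.Seed) => v ∉ a.1)
      fun a => MeasurableSet.const _
  rw [errorZero, measureReal_def, cond_apply hm, ENNReal.toReal_mul, ENNReal.toReal_inv,
    ← measureReal_def, ← measureReal_def, h]
  rfl

lemma errorOne_eq (hK : 0 < K) (hKn : K < n) (v : Fin n) :
    E.errorOne K p q v =
      ((K : ℝ) / n)⁻¹ * (E.law K p q).real (E.falseNegative v) := by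
  have h := E.law_real_mem (p := p) (q := q) hK hKn true v
  simp only [decide_eq_true_eq, prior, if_true] at h
  have hm : MeasurableSet {x : (Finset (Fin n) × SimpleGraph (Fin n)) × E.Seed | v ∈ x.1.1} :=
    measurableSet_prod_of_countable
      (P := fun (a : Finset (Fin n) × SimpleGraph (Fin n)) (_ : E.Seed) => v ∈ a.1)
      fun a => MeasurableSet.const _
  rw [errorOne, measureReal_def, cond_apply hm, ENNReal.toReal_mul, ENNReal.toReal_inv,
    ← measureReal_def, ← measureReal_def, h]
  rfl

lemma avgError_eq (hK : 0 < K) (hKn : K < n) (v : Fin n) :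
    E.avgError K p q v =
      (E.law K p q).real (E.falsePositive v) + (E.law K p q).real (E.falseNegative v) := by
  have hn0 : (0 : ℝ) < n := by exact_mod_cast hK.trans hKn
  have hK0 : (0 : ℝ) < K := by exact_mod_cast hK
  have hKn' : (0 : ℝ) < (n : ℝ) - K := by rw [sub_pos]; exact_mod_cast hKn
  have h1 : 1 - (K : ℝ) / n = ((n : ℝ) - K) / n := by field_simp
  rw [avgError, E.errorZero_eq hK hKn, E.errorOne_eq hK hKn, h1]
  field_simp

lemma expectedError_eq (hK : 0 < K) (hKn : K < n) :
    E.expectedError K p q = ∑ v, E.avgError K p q v := by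
  have := isProbabilityMeasure_plantedModel (p := p) (q := q) hKn
  have hprob : IsProbabilityMeasure (E.law K p q) := by unfold law; infer_instance
  have hFP : ∀ v, MeasurableSet (E.falsePositive v) := E.measurableSet_falsePositive
  have hFN : ∀ v, MeasurableSet (E.falseNegative v) := E.measurableSet_falseNegative
  have hcard : ∀ x : (Finset (Fin n) × SimpleGraph (Fin n)) × E.Seed,
      ((symmDiff (E.est x.2 x.1.2) x.1.1).card : ℝ) =
      ∑ v, ((E.falsePositive v).indicator 1 x + (E.falseNegative v).indicator 1 x) := by
    intro x
    rw [Finset.card_eq_sum_ones, Nat.cast_sum, ← Finset.sum_filter_add_sum_filter_not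
      Finset.univ (fun v => v ∈ symmDiff (E.est x.2 x.1.2) x.1.1)]
    rw [Finset.sum_eq_zero (s := Finset.univ.filter fun v => ¬ _), add_zero,
      Finset.filter_univ_mem]
    · refine Finset.sum_congr rfl fun v hv => ?_
      rcases Finset.mem_symmDiff.1 hv with ⟨h1, h2⟩ | ⟨h1, h2⟩ <;>
        simp [falsePositive, falseNegative, h1, h2]
    · intro v hv
      have hv' := (Finset.mem_filter.1 hv).2
      rw [Finset.mem_symmDiff, not_or] at hv'
      have h1 : x ∉ E.falsePositive v := fun h => hv'.1 ⟨h.2, h.1⟩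
      have h2 : x ∉ E.falseNegative v := fun h => hv'.2 ⟨h.1, h.2⟩
      simp [h1, h2]
  have hi : ∀ {A : Set ((Finset (Fin n) × SimpleGraph (Fin n)) × E.Seed)}, MeasurableSet A →
      
      Integrable (A.indicator (1 : ((Finset (Fin n) × SimpleGraph (Fin n)) × E.Seed) → ℝ))
        (E.law K p q) := fun hA =>
    (integrable_const (1 : ℝ)).indicator hA
  rw [expectedError]
  simp only [hcard]
  rw [integral_finsetSum (f := fun v x => (E.falsePositive v).indicator (1 : _ × E.Seed → ℝ) x +
    (E.falseNegative v).indicator 1 x) _ fun v _ => (hi (hFP v)).add (hi (hFN v))]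
  refine Finset.sum_congr rfl fun v _ => ?_
  rw [integral_add (hi (hFP v)) (hi (hFN v)), integral_indicator_one (hFP v),
    integral_indicator_one (hFN v), E.avgError_eq hK hKn]

open Classical in
/-- A lower bound for all tests of the type of the root of the idealized tree is, up to a small
error, a lower bound for all local estimators. -/
lemma sub_totalError_le (hqp : q ≤ p) (hK : 0 < K) (hKn : K < n) {a₀ a₁ c : ℝ} (ha₀ : 0 ≤ a₀)
    (ha₁ : 0 ≤ a₁)
    (hc : ∀ Q : TreeObs n t → Prop,
      c ≤ a₀ * (∑ x, if Q x then obsWeight ((K : ℝ) / n) p q t false x else 0) +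
        a₁ * ∑ x, if Q x then 0 else obsWeight ((K : ℝ) / n) p q t true x) (v : Fin n) :
    c - (a₀ + a₁) * totalError n K t p ≤
      a₀ * E.errorZero K p q v + a₁ * E.errorOne K p q v := by
  have hn0 : (0 : ℝ) < n := by exact_mod_cast hK.trans hKn
  have hK0 : (0 : ℝ) < K := by exact_mod_cast hK
  have hk0 : 0 < (K : ℝ) / n := by positivity
  have hk1 : 0 < 1 - (K : ℝ) / n := by
    rw [sub_pos, div_lt_one hn0]; exact_mod_cast hKn
  obtain ⟨hi0, h0⟩ := E.law_real_eq_integral (p := p) (q := q) hKn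
    (E.measurableSet_falsePositive v)
  obtain ⟨hi1, h1⟩ := E.law_real_eq_integral (p := p) (q := q) hKn
    (E.measurableSet_falseNegative v)
  have h0' : (E.law K p q).real (E.falsePositive v) = _ := h0
  have h1' : (E.law K p q).real (E.falseNegative v) = _ := h1
  rw [E.errorZero_eq hK hKn, E.errorOne_eq hK hKn, h0', h1', ← mul_assoc, ← mul_assoc,
    ← integral_const_mul, ← integral_const_mul,
    ← integral_add (hi0.const_mul _) (hi1.const_mul _)]
  -- Writing the constant as an integral over the seed allows a comparison seed by seed, that is,
  -- for deterministic rules.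
  have hconst : ∫ _ : E.Seed, (c - (a₀ + a₁) * totalError n K t p) ∂E.seedLaw =
      c - (a₀ + a₁) * totalError n K t p := by simp
  rw [← hconst]
  refine integral_mono (integrable_const _) ((hi0.const_mul _).add (hi1.const_mul _)) fun s => ?_
  -- The test induced on the tree: accept `x` if the rule accepts on all graphs showing `x`. If it
  -- rejects on one of them, locality makes it reject on all, so both `Q` and its negation determine
  -- the decision.
  obtain ⟨Q, hQ⟩ : ∃ Q : TreeObs n t → Prop,
      ∀ x, Q x ↔ ∀ G ∈ treeEvent t v x, v ∈ E.est s G := ⟨_, fun _ => Iff.rfl⟩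
  have b0 := sum_obsWeight_le_sum_plantedGraph hqp hK hKn false v (T := {G | v ∈ E.est s G})
    (Q := Q) fun x hx G hG => (hQ x).1 hx G hG
  have b1 := sum_obsWeight_le_sum_plantedGraph hqp hK hKn true v (T := {G | v ∉ E.est s G})
    (Q := fun x => ¬ Q x) fun x hx G hG => by
      simp only [hQ, not_forall] at hx
      obtain ⟨G', hG', hv⟩ := hx
      exact fun h => hv ((E.isLocal s v G G' (sameNeighborhood_of_mem_treeEvent hG hG')).1 h)
  have m0 : (plantedModel n K p q).real {a | (a, s) ∈ {x : (Finset (Fin n) ×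
      SimpleGraph (Fin n)) × E.Seed | v ∉ x.1.1 ∧ v ∈ E.est x.2 x.1.2}} =
      ∑ C ∈ Finset.powersetCard K (Finset.univ : Finset (Fin n)) with decide (v ∈ C) = false,
        (n.choose K : ℝ)⁻¹ * (plantedGraph C p q).real {G | v ∈ E.est s G} := by
    rw [plantedModel_real_apply hKn, Finset.sum_filter]
    refine Finset.sum_congr rfl fun C _ => ?_
    by_cases h : v ∈ C <;> simp [h]
  have m1 : (plantedModel n K p q).real {a | (a, s) ∈ {x : (Finset (Fin n) ×
      SimpleGraph (Fin n)) × E.Seed | v ∈ x.1.1 ∧ v ∉ E.est x.2 x.1.2}} =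
      ∑ C ∈ Finset.powersetCard K (Finset.univ : Finset (Fin n)) with decide (v ∈ C) = true,
        (n.choose K : ℝ)⁻¹ * (plantedGraph C p q).real {G | v ∉ E.est s G} := by
    rw [plantedModel_real_apply hKn, Finset.sum_filter]
    refine Finset.sum_congr rfl fun C _ => ?_
    by_cases h : v ∈ C <;> simp [h]
  rw [← m0] at b0
  rw [← m1] at b1
  simp only [prior, Bool.false_eq_true, if_false, if_true] at b0 b1
  have scale : ∀ {a π X M : ℝ}, 0 ≤ a → 0 < π → π * X ≤ M → a * X ≤ a * π⁻¹ * M := by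
    intro a π X M ha hπ h
    rw [mul_assoc]
    exact mul_le_mul_of_nonneg_left ((le_inv_mul_iff₀ hπ).2 h) ha
  have := hc Q
  refine le_trans ?_ (add_le_add (scale ha₀ hk1 b0) (scale ha₁ hk0
    (X := (∑ x, if Q x then 0 else obsWeight ((K : ℝ) / n) p q t true x) - totalError n K t p)
    (le_trans (le_of_eq ?_) b1)))
  · linarith
  · congr 2
    exact Finset.sum_congr rfl fun x _ => by by_cases h : Q x <;> simp [h]

end LocalEstimator

/-! ### Bounds for a fixed number of vertices -/

section Bounds

variable {n K t : ℕ} {p q : unitInterval} {lam : ℝ}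

/-- The hypotheses under which the bounds hold for a fixed number of vertices. -/
structure Regime (lam : ℝ) (n K t : ℕ) (p q : unitInterval) : Prop where
  lam_nonneg : 0 ≤ lam
  lam_le : lam ≤ 1 / Real.exp 1
  q_pos : (0 : ℝ) < q
  q_le_p : q ≤ p
  K_pos : 0 < K
  K_lt : K < n
  lam_eq : (K : ℝ) ^ 2 * ((p : ℝ) - q) ^ 2 / (((n : ℝ) - K) * q) = lam
  sparse : t = 0 ∨ 16 * (q : ℝ) ≤ (K : ℝ) / n

namespace Regime

lemma prior_pos (h : Regime lam n K t p q) : 0 < (K : ℝ) / n := by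
  have := h.K_pos
  have := h.K_pos.trans h.K_lt
  positivity

lemma prior_lt (h : Regime lam n K t p q) : (K : ℝ) / n < 1 := by
  have := h.K_pos.trans h.K_lt
  rw [div_lt_one (by positivity)]
  exact_mod_cast h.K_lt

lemma signal_eq (h : Regime lam n K t p q) :
    n * ((K : ℝ) / n) ^ 2 * ((p : ℝ) - q) ^ 2 = lam * (1 - (K : ℝ) / n) * q := by
  have hn : (0 : ℝ) < n := by exact_mod_cast h.K_pos.trans h.K_lt
  have hKn : (0 : ℝ) < (n : ℝ) - K := by rw [sub_pos]; exact_mod_cast h.K_lt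
  have hq := h.q_pos
  have := h.lam_eq
  rw [div_eq_iff (by positivity)] at this
  have e : 1 - (K : ℝ) / n = ((n : ℝ) - K) / n := by field_simp
  rw [e]
  field_simp
  linarith

lemma one_le_mul (h : Regime lam n K t p q) : 1 ≤ n * ((K : ℝ) / n) := by
  have hn : (0 : ℝ) < n := by exact_mod_cast h.K_pos.trans h.K_lt
  rw [mul_div_cancel₀ _ hn.ne']
  exact_mod_cast h.K_pos

lemma exp_le_affinity_sq (h : Regime lam n K t p q) :
    Real.exp (-(lam * Real.exp 1 / 4)) ≤
      (∑ x : TreeObs n t, √(obsWeight ((K : ℝ) / n) p q t false x *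
        obsWeight ((K : ℝ) / n) p q t true x)) ^ 2 := by
  rcases h.sparse with ht | ht
  · subst ht
    have := h.lam_nonneg
    change _ ≤ (∑ x : Unit, √((1 : ℝ) * 1)) ^ 2
    simp
    positivity
  · exact exp_le_affinity_obsWeight_sq h.prior_pos h.prior_lt h.q_pos h.q_le_p p.2.2 ht
      h.lam_nonneg h.lam_le h.signal_eq h.one_le_mul t

open Classical in
lemma le_testing (h : Regime lam n K t p q) {a b : ℝ} (ha : 0 ≤ a) (hb : 0 ≤ b) (hab : a + b = 1)
    (Q : TreeObs n t → Prop) :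
    a * b * Real.exp (-(lam * Real.exp 1 / 4)) ≤
      a * (∑ x, if Q x then obsWeight ((K : ℝ) / n) p q t false x else 0) +
        b * ∑ x, if Q x then 0 else obsWeight ((K : ℝ) / n) p q t true x := by
  have hnn := obsWeight_nonneg (n := n) h.prior_pos.le h.prior_lt.le h.q_pos.le
    (show (q : ℝ) ≤ p from h.q_le_p) p.2.2 t
  refine le_trans (mul_le_mul_of_nonneg_left h.exp_le_affinity_sq (mul_nonneg ha hb)) ?_
  exact testing_affinity (hnn false) (hnn true) (sum_obsWeight t false) (sum_obsWeight t true)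
    ha hb hab Q

open Classical in
lemma le_testing_ratio (h : Regime lam n K t p q) {a : ℝ} (ha : 0 < a)
    (Q : TreeObs n t → Prop) :
    1 - Real.exp 1 / a ≤
      a * (∑ x, if Q x then obsWeight ((K : ℝ) / n) p q t false x else 0) +
        1 * ∑ x, if Q x then 0 else obsWeight ((K : ℝ) / n) p q t true x := by
  have hqp : (q : ℝ) ≤ p := h.q_le_p
  have hnn := obsWeight_nonneg (n := n) h.prior_pos.le h.prior_lt.le h.q_pos.le hqp p.2.2 t true
  rw [one_mul]
  have key : (∀ x : TreeObs n t, 0 < obsWeight ((K : ℝ) / n) p q t false x) ∧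
      ∑ x : TreeObs n t, obsWeight ((K : ℝ) / n) p q t true x ^ 2 /
        obsWeight ((K : ℝ) / n) p q t false x ≤ Real.exp 1 := by
    -- At depth `0` both laws are the same point mass, so no smallness of `q` is required.
    rcases h.sparse with ht | ht
    · subst ht
      refine ⟨fun _ => zero_lt_one, ?_⟩
      change ∑ x : Unit, (1 : ℝ) ^ 2 / 1 ≤ _
      simp
    · exact ⟨obsWeight_false_pos h.prior_pos.le h.prior_lt h.q_pos hqp p.2.2
        (by have := h.prior_lt; linarith) t,
        chiSq_obsWeight_le h.prior_pos h.prior_lt h.q_pos hqp p.2.2 ht h.lam_nonneg h.lam_le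
          h.signal_eq t⟩
  refine le_trans ?_ (testing_chiSq key.1 hnn (sum_obsWeight t true) ha Q)
  have := div_le_div_of_nonneg_right key.2 ha.le
  linarith

lemma avgError_ge (h : Regime lam n K t p q) (E : LocalEstimator.{u} n t) (v : Fin n) :
    (K : ℝ) * ((n : ℝ) - K) / n ^ 2 * Real.exp (-(lam * Real.exp 1 / 4)) - totalError n K t p ≤
      E.avgError K p q v := by
  have hn : (n : ℝ) ≠ 0 := by exact_mod_cast (h.K_pos.trans h.K_lt).ne'
  have h1 := h.prior_lt
  have e : 1 - (K : ℝ) / n = ((n : ℝ) - K) / n := by field_simp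
  have := E.sub_totalError_le h.q_le_p h.K_pos h.K_lt (a₀ := 1 - (K : ℝ) / n)
    (by linarith) h.prior_pos.le
    (h.le_testing (by linarith) h.prior_pos.le (by ring)) v
  rw [LocalEstimator.avgError, ← e]
  refine le_trans (le_of_eq ?_) this
  rw [e]
  field_simp
  ring

lemma errorSum_ge (h : Regime lam n K t p q) (E : LocalEstimator.{u} n t) (v : Fin n) :
    1 / 2 * Real.exp (-(1 / 4)) - 2 * totalError n K t p ≤
      E.errorZero K p q v + E.errorOne K p q v := by
  have := E.sub_totalError_le h.q_le_p h.K_pos h.K_lt (a₀ := 1 / 2) (a₁ := 1 / 2)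
    (by norm_num) (by norm_num) (h.le_testing (by norm_num) (by norm_num) (by norm_num)) v
  have hl : lam * Real.exp 1 ≤ 1 := by
    have := h.lam_le
    rwa [le_div_iff₀ (Real.exp_pos 1)] at this
  have : Real.exp (-(1 / 4)) ≤ Real.exp (-(lam * Real.exp 1 / 4)) :=
    Real.exp_le_exp.2 (by linarith)
  linarith

/-- After division by `K / n` the false positives carry weight `(n - K) / K` and the false negatives
weight `1`, the setting of the second-moment testing bound. -/
lemma avgError_ratio_ge (h : Regime lam n K t p q) (E : LocalEstimator.{u} n t) (v : Fin n) :
    1 - Real.exp 1 * (K / ((n : ℝ) - K)) - n / K * totalError n K t p ≤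
      n * E.avgError K p q v / K := by
  have hn : (0 : ℝ) < n := by exact_mod_cast h.K_pos.trans h.K_lt
  have hK : (0 : ℝ) < K := by exact_mod_cast h.K_pos
  have hKn : (0 : ℝ) < (n : ℝ) - K := by rw [sub_pos]; exact_mod_cast h.K_lt
  have := E.sub_totalError_le h.q_le_p h.K_pos h.K_lt (a₀ := ((n : ℝ) - K) / K) (a₁ := 1)
    (by positivity) zero_le_one (h.le_testing_ratio (by positivity)) v
  have e1 : n * E.avgError K p q v / K =
      ((n : ℝ) - K) / K * E.errorZero K p q v + 1 * E.errorOne K p q v := by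
    rw [LocalEstimator.avgError]
    field_simp
  rw [e1]
  refine le_trans (le_of_eq ?_) this
  field_simp
  ring

lemma expectedError_ge (h : Regime lam n K t p q) (E : LocalEstimator.{u} n t) :
    (K : ℝ) * ((n : ℝ) - K) / n * Real.exp (-(lam * Real.exp 1 / 4)) - n * totalError n K t p ≤
      E.expectedError K p q := by
  have hn : (0 : ℝ) < n := by exact_mod_cast h.K_pos.trans h.K_lt
  rw [E.expectedError_eq h.K_pos h.K_lt]
  have := Finset.sum_le_sum fun v (_ : v ∈ Finset.univ) => h.avgError_ge E v
  rw [Finset.sum_const, Finset.card_univ, Fintype.card_fin, nsmul_eq_mul] at this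
  refine le_trans (le_of_eq ?_) this
  field_simp

lemma expectedError_ratio_ge (h : Regime lam n K t p q) (E : LocalEstimator.{u} n t) :
    1 - Real.exp 1 * (K / ((n : ℝ) - K)) - n / K * totalError n K t p ≤
      E.expectedError K p q / K := by
  have hn : (0 : ℝ) < n := by exact_mod_cast h.K_pos.trans h.K_lt
  rw [E.expectedError_eq h.K_pos h.K_lt]
  have := Finset.sum_le_sum fun v (_ : v ∈ Finset.univ) => h.avgError_ratio_ge E v
  rw [Finset.sum_const, Finset.card_univ, Fintype.card_fin, nsmul_eq_mul, ← Finset.sum_div,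
    ← Finset.mul_sum, mul_div_assoc] at this
  exact le_of_mul_le_mul_left this hn

end Regime

end Bounds

open Filter Topology

/-! ### Subpolynomial sequences and the limit -/

section Asymptotics

/-- The sequence grows more slowly than every positive power of `n`. -/
def SubPoly (f : ℕ → ℝ) : Prop :=
  ∀ δ : ℝ, 0 < δ → ∀ᶠ n : ℕ in atTop, f n ≤ (n : ℝ) ^ δ

lemma subPoly_const (c : ℝ) : SubPoly fun _ => c := fun _ hδ =>
  ((tendsto_rpow_atTop hδ).comp tendsto_natCast_atTop_atTop).eventually_ge_atTop c

lemma SubPoly.mul {f g : ℕ → ℝ} (hf : SubPoly f) (hg : SubPoly g) (hg0 : ∀ᶠ n in atTop, 0 ≤ g n) :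
    SubPoly fun n => f n * g n := by
  intro δ hδ
  filter_upwards [hf (δ / 2) (by linarith), hg (δ / 2) (by linarith), hg0,
    eventually_gt_atTop 0] with n h1 h2 h3 h4
  have hn : (0 : ℝ) < n := by exact_mod_cast h4
  calc f n * g n ≤ (n : ℝ) ^ (δ / 2) * (n : ℝ) ^ (δ / 2) :=
        mul_le_mul h1 h2 h3 (Real.rpow_nonneg hn.le _)
    _ = (n : ℝ) ^ δ := by rw [← Real.rpow_add hn]; congr 1; ring

lemma SubPoly.mono {f g : ℕ → ℝ} (hg : SubPoly g) (h : ∀ᶠ n in atTop, f n ≤ g n) :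
    SubPoly f := fun δ hδ => by
  filter_upwards [hg δ hδ, h] with n h1 h2 using h2.trans h1

lemma SubPoly.of_le_rpow {f ε : ℕ → ℝ} (hε : Tendsto ε atTop (𝓝 0))
    (h : ∀ᶠ n : ℕ in atTop, f n ≤ (n : ℝ) ^ ε n) : SubPoly f := fun δ hδ => by
  filter_upwards [h, hε.eventually_le_const hδ, eventually_ge_atTop 1] with n h1 h2 h3
  exact h1.trans (Real.rpow_le_rpow_of_exponent_le (by exact_mod_cast h3) h2)

lemma SubPoly.exists_rpow {f : ℕ → ℝ} (hf : SubPoly f) :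
    ∃ ε : ℕ → ℝ, Tendsto ε atTop (𝓝 0) ∧ ∀ᶠ n : ℕ in atTop, f n ≤ (n : ℝ) ^ ε n := by
  -- The exponent is the logarithm of `f n` to base `n`, replaced by `0` where `f n ≤ 1`: there the
  -- logarithm could be very negative or meaningless, and only an upper bound on `f` is wanted.
  refine ⟨fun n => if f n ≤ 1 then 0 else Real.log (f n) / Real.log n, ?_, ?_⟩
  · rw [Metric.tendsto_nhds]
    intro δ hδ
    filter_upwards [hf (δ / 2) (by linarith), eventually_ge_atTop 2] with n h1 h2
    rw [Real.dist_0_eq_abs]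
    split_ifs with h
    · simpa using hδ
    · rw [not_le] at h
      have hn : (1 : ℝ) < n := by exact_mod_cast h2
      have hlog := Real.log_pos hn
      have h3 : Real.log (f n) ≤ δ / 2 * Real.log n := by
        rw [← Real.log_rpow (by linarith)]
        exact Real.log_le_log (by linarith) h1
      rw [abs_of_nonneg (div_nonneg (Real.log_pos h).le hlog.le), div_lt_iff₀ hlog]
      nlinarith
  · filter_upwards [eventually_ge_atTop 2] with n h2
    have hn : (1 : ℝ) < n := by exact_mod_cast h2
    split_ifs with h
    · simpa using h
    · rw [not_le] at h
      have hlog := Real.log_pos hn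
      rw [Real.rpow_def_of_pos (by linarith), mul_div_cancel₀ _ hlog.ne',
        Real.exp_log (by linarith)]

/-- For `t ≥ 1` the quantity `M = (2 + n * P) ^ t` also dominates `n * P`, so every term is a power
of `M` up to the factor `n / K` caused by sampling without replacement. -/
lemma mul_totalError_le {n K t : ℕ} {P : ℝ} (hP : 0 ≤ P) (hK : 0 < K)
    (hKn : (K : ℝ) ≤ n / 2) :
    n * totalError n K t P ≤ 8 * (n / K) * ((2 + n * P) ^ t) ^ 5 := by
  have hK0 : (0 : ℝ) < K := by exact_mod_cast hK
  have hn0 : (0 : ℝ) < n := by linarith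
  have hnP : 0 ≤ n * P := by positivity
  unfold totalError
  split_ifs with ht
  · rw [mul_zero]; positivity
  · set m := 2 + n * P with hm
    set M := m ^ t with hM
    have hmM : m ≤ M := le_self_pow₀ (by linarith) ht
    have hM1 : 1 ≤ M := by linarith
    have hnPM : n * P ≤ M := by linarith
    have hnK : 1 ≤ (n : ℝ) / K := by rw [one_le_div hK0]; linarith
    have hnnK : n * (1 / ((n : ℝ) - K)) ≤ 2 := by
      rw [mul_one_div, div_le_iff₀ (by linarith)]; linarith
    have e1 : m ^ (2 * t + 2) ≤ M ^ 4 := by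
      calc m ^ (2 * t + 2) = M ^ 2 * m ^ 2 := by rw [hM, ← pow_mul, ← pow_add]; ring_nf
        _ ≤ M ^ 2 * M ^ 2 := by gcongr
        _ = M ^ 4 := by ring
    have e2 : m ^ (3 * t) = M ^ 3 := by rw [hM, ← pow_mul]; ring_nf
    have e3 : n * compareError n K P ≤ (n / K + 5) * M ^ 2 := by
      have h1 : n * compareError n K P =
          2 * (n * P) + (n * P) ^ 2 + n / K + n * (1 / ((n : ℝ) - K)) := by
        unfold compareError; ring
      have h2 : (n * P) ^ 2 ≤ M ^ 2 := by gcongr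
      have h3 : M ≤ M ^ 2 := by nlinarith
      have h4 : (n : ℝ) / K ≤ n / K * M ^ 2 := le_mul_of_one_le_right (by positivity) (by nlinarith)
      rw [h1]
      nlinarith
    have e4 : 0 ≤ M ^ 5 := by positivity
    calc n * (P * m ^ (2 * t + 2) + compareError n K P * m ^ (3 * t))
        = (n * P) * m ^ (2 * t + 2) + (n * compareError n K P) * M ^ 3 := by rw [e2]; ring
      _ ≤ M * M ^ 4 + ((n / K + 5) * M ^ 2) * M ^ 3 := by gcongr
      _ = (6 + n / K) * M ^ 5 := by ring
      _ ≤ 8 * (n / K) * M ^ 5 := by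
          refine mul_le_mul_of_nonneg_right ?_ e4
          linarith

variable {lam : ℝ} {K t : ℕ → ℕ} {p q : ℕ → unitInterval}

lemma subPoly_div
    (hK_lower : ∃ ε : ℕ → ℝ, Tendsto ε atTop (𝓝 0) ∧
      ∀ᶠ n : ℕ in atTop, (n : ℝ) ^ (1 - ε n) ≤ K n) :
    SubPoly fun n => (n : ℝ) / K n := by
  obtain ⟨ε, hε, h⟩ := hK_lower
  refine SubPoly.of_le_rpow hε ?_
  filter_upwards [h, eventually_gt_atTop 0] with n h1 h2
  have hn : (0 : ℝ) < n := by exact_mod_cast h2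
  have hK : (0 : ℝ) < K n := (Real.rpow_pos_of_pos hn _).trans_le h1
  rw [div_le_iff₀ hK]
  calc (n : ℝ) = (n : ℝ) ^ ε n * (n : ℝ) ^ (1 - ε n) := by
        rw [← Real.rpow_add hn, add_sub_cancel, Real.rpow_one]
    _ ≤ _ := mul_le_mul_of_nonneg_left h1 (Real.rpow_nonneg hn.le _)

lemma eventually_pos_and_le_half
    (hK_lower : ∃ ε : ℕ → ℝ, Tendsto ε atTop (𝓝 0) ∧
      ∀ᶠ n : ℕ in atTop, (n : ℝ) ^ (1 - ε n) ≤ K n)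
    (hK_upper : (fun n => (K n : ℝ)) =o[atTop] fun n => (n : ℝ)) :
    ∀ᶠ n in atTop, 0 < K n ∧ (K n : ℝ) ≤ (n : ℝ) / 2 := by
  obtain ⟨ε, -, h⟩ := hK_lower
  filter_upwards [h, eventually_gt_atTop 0, hK_upper.bound (c := 1 / 2) (by norm_num)]
    with n h1 h2 h3
  have hn : (0 : ℝ) < n := by exact_mod_cast h2
  have hK : (0 : ℝ) < K n := (Real.rpow_pos_of_pos hn _).trans_le h1
  refine ⟨by exact_mod_cast hK, ?_⟩
  simp only [Real.norm_natCast] at h3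
  linarith

lemma subPoly_mul_totalError
    (hK_lower : ∃ ε : ℕ → ℝ, Tendsto ε atTop (𝓝 0) ∧
      ∀ᶠ n : ℕ in atTop, (n : ℝ) ^ (1 - ε n) ≤ K n)
    (hK_upper : (fun n => (K n : ℝ)) =o[atTop] fun n => (n : ℝ))
    (hM : SubPoly fun n => (2 + (n : ℝ) * p n) ^ t n) :
    SubPoly fun n => n * totalError n (K n) (t n) (p n) := by
  have hM0 : ∀ n : ℕ, 0 ≤ (2 + (n : ℝ) * p n) ^ t n := fun n => by
    have := (p n).2.1
    positivity
  have h5 : SubPoly fun n => ((2 + (n : ℝ) * p n) ^ t n) ^ 5 := by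
    have h2 := hM.mul hM (.of_forall hM0)
    have h3 := (h2.mul h2 (.of_forall fun n => mul_nonneg (hM0 n) (hM0 n))).mul hM (.of_forall hM0)
    exact h3.mono (.of_forall fun n => le_of_eq (by ring))
  refine (((subPoly_const 8).mul (subPoly_div hK_lower) (.of_forall fun n => by positivity)).mul h5
    (.of_forall fun n => pow_nonneg (hM0 n) 5)).mono ?_
  filter_upwards [eventually_pos_and_le_half hK_lower hK_upper] with n hn
  exact mul_totalError_le (p n).2.1 hn.1 hn.2

/-- For `t n ≥ 1`, `n * p n` is at most `n ^ (1 / 4)`, while `K n ≥ n ^ (3 / 4)`. Hence `q n ≤ n ^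
(-3 / 4)` lies below `K n / n ≥ n ^ (-1 / 4)` by a factor of at least `n ^ (1 / 2)`, eventually more
than `16`. -/
lemma eventually_sparse
    (hqp : ∀ᶠ n in atTop, (q n : ℝ) ≤ p n)
    (hK : SubPoly fun n => (n : ℝ) / K n) (hK0 : ∀ᶠ n in atTop, 0 < K n)
    (hM : SubPoly fun n => (2 + (n : ℝ) * p n) ^ t n) :
    ∀ᶠ n in atTop, t n = 0 ∨ 16 * (q n : ℝ) ≤ (K n : ℝ) / n := by
  filter_upwards [hqp, hK (1 / 4) (by norm_num), hM (1 / 4) (by norm_num), hK0,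
    subPoly_const 16 (1 / 2) (by norm_num), eventually_gt_atTop 0] with n h1 h2 h3 h4 h5 h6
  by_cases ht : t n = 0
  · exact Or.inl ht
  right
  have hn : (0 : ℝ) < n := by exact_mod_cast h6
  have hK : (0 : ℝ) < K n := by exact_mod_cast h4
  have hp := (p n).2.1
  have hnp : 0 ≤ n * (p n : ℝ) := by positivity
  have h7 : 2 + n * (p n : ℝ) ≤ (2 + (n : ℝ) * p n) ^ t n := le_self_pow₀ (by linarith) ht
  rw [div_le_iff₀ hK] at h2
  rw [le_div_iff₀ hn]
  set y := (n : ℝ) ^ (1 / 4 : ℝ) with hy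
  have hy0 : 0 < y := Real.rpow_pos_of_pos hn _
  have hy2 : (n : ℝ) ^ (1 / 2 : ℝ) = y ^ 2 := by
    rw [hy, ← Real.rpow_natCast, ← Real.rpow_mul hn.le]; norm_num
  have hy4 : (n : ℝ) = y ^ 4 := by
    rw [hy, ← Real.rpow_natCast, ← Real.rpow_mul hn.le]; norm_num
  have h8 : y ^ 3 ≤ K n := by
    have : y * y ^ 3 ≤ y * K n := by linarith [hy4, (by ring : y * y ^ 3 = y ^ 4)]
    exact le_of_mul_le_mul_left this hy0
  have h9 : n * (q n : ℝ) ≤ y := by nlinarith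
  rw [hy2] at h5
  nlinarith

lemma tendsto_ratio_bound
    (hK_upper : (fun n => (K n : ℝ)) =o[atTop] fun n => (n : ℝ))
    (hK : SubPoly fun n => (n : ℝ) / K n)
    (hT0 : ∀ᶠ n in atTop, 0 ≤ totalError n (K n) (t n) (p n))
    (hT : SubPoly fun n => n * totalError n (K n) (t n) (p n)) :
    Tendsto (fun n : ℕ => 1 - Real.exp 1 * (K n / ((n : ℝ) - K n)) -
      n / K n * totalError n (K n) (t n) (p n)) atTop (𝓝 1) := by
  have h1 : Tendsto (fun n : ℕ => (K n : ℝ) / n) atTop (𝓝 0) := hK_upper.tendsto_div_nhds_zero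
  have h2 : Tendsto (fun n : ℕ => (K n : ℝ) / ((n : ℝ) - K n)) atTop (𝓝 0) := by
    have : Tendsto (fun n : ℕ => (K n : ℝ) / n / (1 - (K n : ℝ) / n)) atTop (𝓝 (0 / (1 - 0))) :=
      h1.div (tendsto_const_nhds.sub h1) (by norm_num)
    rw [zero_div] at this
    refine this.congr' ?_
    filter_upwards [eventually_gt_atTop 0] with n hn
    have hn : (0 : ℝ) < n := by exact_mod_cast hn
    rw [one_sub_div hn.ne', div_div_div_cancel_right₀ hn.ne']
  have h3 : Tendsto (fun n : ℕ => n / K n * totalError n (K n) (t n) (p n)) atTop (𝓝 0) := by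
    -- The product of `n * totalError` and `n / K` is subpolynomial, hence eventually at most `n ^
    -- (1 / 2)`; dividing by `n` leaves `n ^ (-1 / 2)`.
    have hprod := hT.mul hK (.of_forall fun n => by positivity)
    have hlim : Tendsto (fun n : ℕ => (n : ℝ) ^ (-(1 / 2) : ℝ)) atTop (𝓝 0) :=
      (tendsto_rpow_neg_atTop (by norm_num)).comp tendsto_natCast_atTop_atTop
    refine squeeze_zero' ?_ ?_ hlim
    · filter_upwards [hT0] with n hn
      positivity
    · filter_upwards [hprod (1 / 2) (by norm_num), eventually_gt_atTop 0] with n h1 h2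
      have hn : (0 : ℝ) < n := by exact_mod_cast h2
      have e : (n : ℝ) ^ (-(1 / 2) : ℝ) = (n : ℝ) ^ (1 / 2 : ℝ) / n := by
        rw [← Real.rpow_sub_one hn.ne']; norm_num
      rw [e, le_div_iff₀ hn]
      linarith
  have := (tendsto_const_nhds (x := (1 : ℝ))).sub (h2.const_mul (Real.exp 1)) |>.sub h3
  simpa using this

lemma one_le_liminf_coe {L : ℕ → ℝ} {F : ℕ → EReal} (hL : Tendsto L atTop (𝓝 1))
    (h : ∀ᶠ n in atTop, (L n : EReal) ≤ F n) : 1 ≤ liminf F atTop := by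
  have h1 : Tendsto (fun n => (L n : EReal)) atTop (𝓝 ((1 : ℝ) : EReal)) :=
    (continuous_coe_real_ereal.tendsto 1).comp hL
  rw [← EReal.coe_one, ← h1.liminf_eq]
  exact liminf_le_liminf h

end Asymptotics

end HiddenCommunity

end

/-! ### Assembly of the four bounds -/

theorem theorem3
    (lam : ℝ) (hlam_pos : 0 < lam) (hlam_le : lam ≤ 1 / Real.exp 1)
    (K t : ℕ → ℕ) (p q : ℕ → unitInterval)
    (hq : ∀ᶠ n in Filter.atTop, (0 : ℝ) < q n)
    (hqp : ∀ᶠ n in Filter.atTop, (q n : ℝ) ≤ p n)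
    (hpq : (fun n => (p n : ℝ) / q n) =O[Filter.atTop] fun _ => (1 : ℝ))
    (hK_lower : ∃ ε : ℕ → ℝ, Filter.Tendsto ε Filter.atTop (nhds 0) ∧
      ∀ᶠ n : ℕ in Filter.atTop, (n : ℝ) ^ (1 - ε n) ≤ K n)
    (hK_upper : (fun n => (K n : ℝ)) =o[Filter.atTop] fun n => (n : ℝ))
    (hlam : ∀ᶠ n : ℕ in Filter.atTop,
      (K n : ℝ) ^ 2 * ((p n : ℝ) - q n) ^ 2 / (((n : ℝ) - K n) * q n) = lam)
    (ht : ∃ ε : ℕ → ℝ, Filter.Tendsto ε Filter.atTop (nhds 0) ∧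
      ∀ᶠ n : ℕ in Filter.atTop, (2 + (n : ℝ) * p n) ^ t n = (n : ℝ) ^ ε n) :
    (∃ ε : ℕ → ℝ, Filter.Tendsto ε Filter.atTop (nhds 0) ∧
      ∀ᶠ n : ℕ in Filter.atTop, ∀ E : HiddenCommunity.LocalEstimator.{u} n (t n),
        (K n : ℝ) * ((n : ℝ) - K n) / n * Real.exp (-(lam * Real.exp 1 / 4)) - (n : ℝ) ^ ε n
          ≤ E.expectedError (K n) (p n) (q n)) ∧
    (∃ ε : ℕ → ℝ, Filter.Tendsto ε Filter.atTop (nhds 0) ∧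
      ∀ᶠ n : ℕ in Filter.atTop, ∀ (E : HiddenCommunity.LocalEstimator.{u} n (t n)) (v : Fin n),
        1 / 2 * Real.exp (-(1 / 4)) - (n : ℝ) ^ (-1 + ε n)
          ≤ E.errorZero (K n) (p n) (q n) v + E.errorOne (K n) (p n) (q n) v) ∧
    (∀ E : ∀ n, HiddenCommunity.LocalEstimator.{u} n (t n),
      1 ≤ Filter.liminf (fun n : ℕ => ⨅ v : Fin n,
        (((n : ℝ) * (E n).avgError (K n) (p n) (q n) v / K n : ℝ) : EReal)) Filter.atTop) ∧
    (∀ E : ∀ n, HiddenCommunity.LocalEstimator.{u} n (t n),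
      1 ≤ Filter.liminf (fun n : ℕ =>
        (((E n).expectedError (K n) (p n) (q n) / K n : ℝ) : EReal)) Filter.atTop) := by
  have hM : HiddenCommunity.SubPoly fun n => (2 + (n : ℝ) * p n) ^ t n := by
    obtain ⟨ε, hε, h⟩ := ht
    exact HiddenCommunity.SubPoly.of_le_rpow hε (h.mono fun n hn => hn.le)
  have hKdiv := HiddenCommunity.subPoly_div hK_lower
  have hKev := HiddenCommunity.eventually_pos_and_le_half hK_lower hK_upper
  have hT := HiddenCommunity.subPoly_mul_totalError (p := p) hK_lower hK_upper hM
  have hreg : ∀ᶠ n in Filter.atTop, HiddenCommunity.Regime lam n (K n) (t n) (p n) (q n) := by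
    filter_upwards [hq, hqp, hlam, hKev,
      HiddenCommunity.eventually_sparse hqp hKdiv (hKev.mono fun n hn => hn.1) hM] with n h1 h2 h3 h4 h5
    have hK0 : (0 : ℝ) < K n := by exact_mod_cast h4.1
    have hKn : (K n : ℝ) < n := by linarith [h4.2]
    exact ⟨hlam_pos.le, hlam_le, h1, h2, h4.1, by exact_mod_cast hKn, h3, h5⟩
  have hL := HiddenCommunity.tendsto_ratio_bound (p := p) (t := t) hK_upper hKdiv
    (hreg.mono fun n hn => HiddenCommunity.totalError_nonneg (p n).2.1 hn.K_lt) hT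
  refine ⟨?_, ?_, ?_, ?_⟩
  -- The exponent comes from `n * totalError`, which involves neither the estimator nor the vertex;
  -- this gives the uniformity here and in the second claim.
  · obtain ⟨ε, hε, h⟩ := hT.exists_rpow
    refine ⟨ε, hε, ?_⟩
    filter_upwards [hreg, h] with n hn h E
    have := hn.expectedError_ge E
    linarith
  · obtain ⟨ε, hε, h⟩ := ((HiddenCommunity.subPoly_const 2).mul hT (by
      filter_upwards [hreg] with n hn
      exact mul_nonneg (Nat.cast_nonneg n) (HiddenCommunity.totalError_nonneg (p n).2.1 hn.K_lt))).exists_rpow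
    refine ⟨ε, hε, ?_⟩
    filter_upwards [hreg, h] with n hn h E v
    have hn0 : (0 : ℝ) < n := by exact_mod_cast hn.K_pos.trans hn.K_lt
    have h1 : 2 * HiddenCommunity.totalError n (K n) (t n) (p n) ≤ (n : ℝ) ^ (-1 + ε n) := by
      rw [neg_add_eq_sub, Real.rpow_sub_one hn0.ne', le_div_iff₀ hn0]
      linarith
    have := hn.errorSum_ge E v
    linarith
  · intro E
    refine HiddenCommunity.one_le_liminf_coe hL ?_
    filter_upwards [hreg] with n hn
    exact le_iInf fun v => EReal.coe_le_coe_iff.2 (hn.avgError_ratio_ge (E n) v)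
  · intro E
    refine HiddenCommunity.one_le_liminf_coe hL ?_
    filter_upwards [hreg] with n hn
    exact EReal.coe_le_coe_iff.2 (hn.expectedError_ratio_ge (E n))
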